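/- Let $d\ge 3$ be an integer and $p\in(\frac1{d-1},1)$ a real. Let $\phi=\phi(p)$ be the probability that a branching process (started from one individual) with offspring distribution $\mathrm{Bin}(d-1,p)$ dies out; equivalently, $\phi$ is the unique solution in $(0,1)$ of $\phi=(p\phi+1-p)^{d-1}$. Set $$\chi=1-(p\phi+1-p)^d,\qquad \psi=\tfrac12\,dp\,(1-\phi^2).$$ For $n$ with $dn$ even, let $\boldsymbol{G}_p=\boldsymbol{G}_p(n,d)$ (binomial-edge model) be the random multigraph on $[n]$ obtained by choosing a uniformly random perfect matching of the complete graph on the points $[n]\times[d]$, keeping each edge of the matching independently with probability $p$, and contracting the points $\{i\}\times[d]$ into the vertex $i$ for every $i\in[n]$. Let $\tilde{\boldsymbol{G}}_p=\tilde{\boldsymbol{G}}_p(n,d)$ (exact-edge model) be the random multigraph obtained in the same way, except that a uniformly random set of exactly $m$ edges of the matching is kept, where $m$ is $pdn/2$ rounded to an integer (up or down). For a multigraph $G$ let $C_1(G)$ be a connected component with the largest number of vertices, and let $|C_1(G)|$ and $|E(C_1(G))|$ be its numbers of vertices and of edges. Then for every $\delta>0$ there are $c>0$ and $n_0$ such that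 for all $n\ge n_0$ with $dn$ even, for $G=\boldsymbol{G}_p$ as well as for $G=\tilde{\boldsymbol{G}}_p$, with probability at least $1-e^{-cn}$, $$(\chi-\delta)n\le |C_1(G)|\le(\chi+\delta)n\quad\text{and}\quad(\psi-\delta)n\le |E(C_1(G))|\le(\psi+\delta)n$$ (for every choice of $C_1(G)$, if several components have the largest number of vertices). -/

import Mathlib

namespace GiantPerc

open MeasureTheory

noncomputable section

/-! ### Branching process -/

/-- The size of generation `k` of the branching process with one individual in generation `0`,
in which the `i`-th individual of generation `k` has `ξ (k, i)` children. -/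
def generation (ξ : ℕ × ℕ → ℕ) : ℕ → ℕ
  | 0 => 1
  | k + 1 => ∑ i ∈ Finset.range (generation ξ k), ξ (k, i)

/-- `φ`: the probability that the branching process with independent offspring numbers
distributed as `Bin(d - 1, p)` dies out. -/
def extinctionProb (d : ℕ) (p : unitInterval) : ℝ :=
  (Measure.infinitePi fun _ : ℕ × ℕ => ProbabilityTheory.binomial (d - 1) p).real
    {ξ | ∃ k, generation ξ k = 0}

/-- `χ = 1 - (p φ + 1 - p) ^ d`. -/
def chi (d : ℕ) (p : unitInterval) : ℝ :=
  1 - ((p : ℝ) * extinctionProb d p + 1 - p) ^ d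

/-- `ψ = d p (1 - φ ^ 2) / 2`. -/
def psi (d : ℕ) (p : unitInterval) : ℝ :=
  (1 / 2 : ℝ) * d * p * (1 - extinctionProb d p ^ 2)

/-! ### Components of a multigraph -/

section Multigraph

variable {V E : Type*}

/-- `C` is the vertex set of a connected component of the multigraph `G`. -/
def IsComponent (G : Graph V E) (C : Set V) : Prop :=
  ∃ v ∈ G.vertexSet, C = {w | Relation.ReflTransGen G.Adj v w}

/-- `C` is the vertex set of a connected component with the largest number of vertices. -/
def IsLargestComponent (G : Graph V E) (C : Set V) : Prop :=
  IsComponent G C ∧ ∀ C', IsComponent G C' → C'.ncard ≤ C.ncard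

/-- The edges of `G` (parallel edges are distinct, a loop is one edge) with all ends in `C`. -/
def edgesWithin (G : Graph V E) (C : Set V) : Set E :=
  {e | e ∈ G.edgeSet ∧ ∀ v, G.Inc e v → v ∈ C}

end Multigraph

/-! ### The pairing model and its percolation -/

/-- The points `[n] × [d]`, i.e. `d` clones of each of the `n` vertices. -/
abbrev Point (n d : ℕ) : Type := Fin n × Fin d

open Classical in
/-- The perfect matchings of the complete graph on `[n] × [d]`, as sets of edges. -/
def pairings (n d : ℕ) : Finset (Finset (Sym2 (Point n d))) :=
  Finset.univ.filter fun M =>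
    (∀ e ∈ M, ¬ e.IsDiag) ∧ ∀ x : Point n d, ∃! e, e ∈ M ∧ x ∈ e

/-- The multigraph on `[n]` obtained from the set `S` of edges on the points `[n] × [d]`, by
contracting the clones `{i} × [d]` into the vertex `i`: each `e ∈ S` is an edge, which joins the
vertices that its two points belong to. -/
def project {n d : ℕ} (S : Finset (Sym2 (Point n d))) : Graph (Fin n) (Sym2 (Point n d)) where
  vertexSet := Set.univ
  IsLink e x y := e ∈ S ∧ e.map Prod.fst = s(x, y)
  edgeSet := {e | e ∈ S}
  isLink_symm _ _ := ⟨fun _ _ h => ⟨h.1, h.2.trans Sym2.eq_swap⟩⟩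
  eq_or_eq_of_isLink_of_isLink := by
    rintro e x y v w ⟨-, h⟩ ⟨-, h'⟩
    rw [h, Sym2.eq_iff] at h'
    tauto
  edge_mem_iff_exists_isLink e := by
    refine ⟨fun he => ?_, fun ⟨_, _, h⟩ => h.1⟩
    induction e with
    | _ x y => exact ⟨x.1, y.1, he, rfl⟩
  left_mem_of_isLink := fun _ _ _ _ => Set.mem_univ _

open Classical in
/-- The probability of `A` in the binomial-edge model: a uniformly random perfect matching `M` of
`[n] × [d]` is chosen, each of its edges is kept independently with probability `p`, and the set of
kept edges is projected. -/
def binomialEdgeProb (n d : ℕ) (p : ℝ) (A : Graph (Fin n) (Sym2 (Point n d)) → Prop) : ℝ :=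
  (∑ M ∈ pairings n d,
    ∑ S ∈ M.powerset with A (project S), p ^ S.card * (1 - p) ^ (M.card - S.card)) /
      (pairings n d).card

open Classical in
/-- The probability of `A` in the exact-edge model: a uniformly random perfect matching `M` of
`[n] × [d]` is chosen, a uniformly random set of exactly `m` of its edges is kept, and the set of
kept edges is projected. -/
def exactEdgeProb (n d m : ℕ) (A : Graph (Fin n) (Sym2 (Point n d)) → Prop) : ℝ :=
  (∑ M ∈ pairings n d,
    (((M.powersetCard m).filter fun S => A (project S)).card : ℝ) / (M.powersetCard m).card) /
      (pairings n d).card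

/-- `|C₁(G)| = (χ ± δ) n` and `|E(C₁(G))| = (ψ ± δ) n`, for every choice of the largest component
`C₁(G)` if several components have the largest number of vertices. -/
def GiantEvent (d : ℕ) (p : unitInterval) (δ : ℝ) {n : ℕ} {E : Type*} (G : Graph (Fin n) E) :
    Prop :=
  ∀ C, IsLargestComponent G C →
    |(C.ncard : ℝ) - chi d p * n| ≤ δ * n ∧
      |((edgesWithin G C).ncard : ℝ) - psi d p * n| ≤ δ * n

end

end GiantPerc

/-! Explore the component of a vertex by matching one unmatched point of a found vertex at a time.
As long as few points are matched, the number of such points follows a random walk that falls by 1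
if the revealed edge is deleted and changes by d - 2 if it is kept. Started at a, the walk hits 0
with probability θ^a, where θ = pφ + 1 - p satisfies θ = 1 - p + pθ^(d-1) (`tendsto_walkProb`). A
vertex starts at a = d, so a share of about 1 - θ^d = χ of the vertices lies in large components. A
point has a kept edge with probability p, and the walk then starts at 2(d-1); so a share of about
p(1 - θ^(2(d-1))) = p(1 - φ²) of the points is matched inside large components, and two such points
make one edge, which gives ψ.

Concentration comes from moments of order linear in n. The quotient of `percSum p P Q F` by
`extCount P` is the conditional expectation of F when the edges P are revealed and Q is the kept
part. `explore` bounds the contribution of a local event even in the presence of another nonnegative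
weight. With a power of the count as the weight, the r-th moment of the number of points with a
local property is at most ((q + η)nd)^r while r is a small multiple of n (`moment_le`), and Markov's
inequality gives an exponential tail (`exists_tail_bound`).

Sprinkling shows that nearly all large components merge. Percolate with p' slightly below p and then
add edges (`percSum_sprinkle`); at p' there are still nearly χn vertices in large components
(`exists_supersolution`). Suppose that two disjoint unions of p'-components of size at least K both
have at least ηn vertices and stay unconnected. Either one of them has few points without a kept
edge, so almost all edges at it were kept (`sum_saturated_le`), or both have many such points and
the added edges avoid all pairs between them (`sum_separated_le`). For a fixed graph there are at
most 2^(n/K) such unions, so both cases have exponentially small probability once K is a large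
constant. `exists_comp_of_no_cut` and `largest_component_bounds` then identify the largest
component.

Given that exactly m edges are kept, the binomial-edge model is the exact-edge model, and for m near
the mean this condition has probability at least of order 1/n (`one_le_binomialWeight`). An
exponentially small failure probability survives the conditioning (`exactEdgeProb_ge`). -/

namespace GiantPerc

open Finset

set_option linter.unusedSectionVars false

/-! ### Partially revealed random matchings and conditional expectations -/

section Matching

variable {X : Type*} [Fintype X] [DecidableEq X]

/-- `M` is a perfect matching of the complete graph on `X`. -/
def IsPerfect (M : Finset (Sym2 X)) : Prop :=
  (∀ e ∈ M, ¬ e.IsDiag) ∧ ∀ x : X, ∃! e, e ∈ M ∧ x ∈ e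

open Classical in
/-- The perfect matchings that contain `P`. -/
noncomputable def extensions (P : Finset (Sym2 X)) : Finset (Finset (Sym2 X)) :=
  univ.filter fun M => IsPerfect M ∧ P ⊆ M

/-- The number of perfect matchings that contain `P`. -/
noncomputable def extCount (P : Finset (Sym2 X)) : ℝ := (extensions P).card

/-- The points covered by `P`. -/
def covered (P : Finset (Sym2 X)) : Finset X := univ.filter fun x => ∃ e ∈ P, x ∈ e

/-- The possible partners of `x`, if `P` has been revealed. -/
def free (P : Finset (Sym2 X)) (x : X) : Finset X := univ.filter fun y => y ∉ covered P ∧ y ≠ x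

lemma mem_covered {P : Finset (Sym2 X)} {x : X} : x ∈ covered P ↔ ∃ e ∈ P, x ∈ e := by
  simp [covered]

lemma mem_free {P : Finset (Sym2 X)} {x y : X} : y ∈ free P x ↔ y ∉ covered P ∧ y ≠ x := by
  simp [free]

lemma mem_extensions {P M : Finset (Sym2 X)} : M ∈ extensions P ↔ IsPerfect M ∧ P ⊆ M := by
  simp [extensions]

lemma covered_insert (P : Finset (Sym2 X)) (x y : X) :
    covered (insert s(x, y) P) = insert x (insert y (covered P)) := by
  ext z
  simp [mem_covered, or_assoc]

lemma card_covered_le (P : Finset (Sym2 X)) : (covered P).card ≤ 2 * P.card := by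
  have h : covered P ⊆ P.biUnion fun e => e.toFinset := by
    intro x hx
    obtain ⟨e, he, hxe⟩ := mem_covered.1 hx
    exact mem_biUnion.2 ⟨e, he, Sym2.mem_toFinset.2 hxe⟩
  refine (card_le_card h).trans ((card_biUnion_le_card_mul _ _ 2 fun e _ => ?_).trans_eq
    (mul_comm _ _))
  induction e with
  | _ a b => rw [Sym2.toFinset_mk_eq]; exact card_le_two

lemma IsPerfect.eq_of_mem {M : Finset (Sym2 X)} (hM : IsPerfect M) {e f : Sym2 X} {x : X}
    (he : e ∈ M) (hf : f ∈ M) (hxe : x ∈ e) (hxf : x ∈ f) : e = f :=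
  (hM.2 x).unique ⟨he, hxe⟩ ⟨hf, hxf⟩

lemma notMem_of_notMem_covered {P : Finset (Sym2 X)} {x y : X} (hx : x ∉ covered P) :
    s(x, y) ∉ P := fun h => hx (mem_covered.2 ⟨_, h, Sym2.mem_mk_left _ _⟩)

lemma IsPerfect.exists_partner {M : Finset (Sym2 X)} (hM : IsPerfect M) (x : X) :
    ∃ y, y ≠ x ∧ s(x, y) ∈ M := by
  obtain ⟨e, ⟨he, hx⟩, -⟩ := hM.2 x
  obtain ⟨y, rfl⟩ := hx
  refine ⟨y, fun h => hM.1 _ he ?_, he⟩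
  simp [h]

/-- Revealing the partner of `x`. -/
lemma sum_extensions_eq (F : Finset (Sym2 X) → ℝ) {P : Finset (Sym2 X)} {x : X}
    (hx : x ∉ covered P) :
    ∑ M ∈ extensions P, F M = ∑ y ∈ free P x, ∑ M ∈ extensions (insert s(x, y) P), F M := by
  classical
  have : extensions P = (free P x).biUnion fun y => extensions (insert s(x, y) P) := by
    ext M
    simp only [mem_biUnion, mem_extensions, mem_free]
    constructor
    · rintro ⟨hM, hP⟩
      obtain ⟨y, hyx, hy⟩ := hM.exists_partner x
      refine ⟨y, ⟨fun hc => ?_, hyx⟩, hM, insert_subset hy hP⟩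
      obtain ⟨e, he, hye⟩ := mem_covered.1 hc
      have := hM.eq_of_mem hy (hP he) (Sym2.mem_mk_right _ _) hye
      exact hx (mem_covered.2 ⟨e, he, this ▸ Sym2.mem_mk_left _ _⟩)
    · rintro ⟨y, -, hM, hP⟩
      exact ⟨hM, (subset_insert _ _).trans hP⟩
  rw [this, sum_biUnion]
  intro y _ z _ hyz
  refine disjoint_left.2 fun M hM hM' => hyz ?_
  rw [mem_extensions] at hM hM'
  have := hM.1.eq_of_mem (hM.2 (mem_insert_self _ _)) (hM'.2 (mem_insert_self _ _))
    (Sym2.mem_mk_left x y) (Sym2.mem_mk_left x z)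
  rw [Sym2.congr_right] at this
  exact this

lemma isPerfect_map (σ : Equiv.Perm X) {M : Finset (Sym2 X)} (hM : IsPerfect M) :
    IsPerfect (M.map σ.toEmbedding.sym2Map) := by
  constructor
  · intro e he
    obtain ⟨f, hf, rfl⟩ := Finset.mem_map.1 he
    have := hM.1 f hf
    induction f with
    | _ a b => simpa using this
  · intro x
    obtain ⟨e, ⟨he, hx⟩, hu⟩ := hM.2 (σ.symm x)
    refine ⟨σ.toEmbedding.sym2Map e, ⟨Finset.mem_map.2 ⟨e, he, rfl⟩, ?_⟩, ?_⟩
    · exact Sym2.mem_map.2 ⟨_, hx, by simp⟩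
    · rintro f ⟨hf, hxf⟩
      obtain ⟨g, hg, rfl⟩ := Finset.mem_map.1 hf
      obtain ⟨z, hz, hzx⟩ := Sym2.mem_map.1 hxf
      have : z = σ.symm x := by rw [← hzx]; simp
      rw [← hu g ⟨hg, this ▸ hz⟩]

/-- The transposition of `y` and `z` fixes `x` and every point covered by `P`, so it injects the
matchings on the left into those on the right. By symmetry equality holds: the partner of `x` is
uniform on the free points. -/
lemma extCount_insert_le {P : Finset (Sym2 X)} {x y z : X}
    (hy : y ∈ free P x) (hz : z ∈ free P x) :
    extCount (insert s(x, y) P) ≤ extCount (insert s(x, z) P) := by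
  rw [mem_free] at hy hz
  unfold extCount
  norm_cast
  refine card_le_card_of_injOn
    (fun M => M.map (Equiv.swap y z).toEmbedding.sym2Map) (fun M hM => ?_)
    (fun M _ M' _ h => Finset.map_injective _ h)
  rw [mem_coe, mem_extensions] at hM ⊢
  refine ⟨isPerfect_map _ hM.1, insert_subset ?_ fun e he => ?_⟩
  · refine Finset.mem_map.2 ⟨_, hM.2 (mem_insert_self _ _), ?_⟩
    simp [Equiv.swap_apply_of_ne_of_ne hy.2.symm hz.2.symm]
  · refine Finset.mem_map.2 ⟨e, hM.2 (mem_insert_of_mem he), ?_⟩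
    have : ∀ w ∈ e, Equiv.swap y z w = w := fun w hw =>
      Equiv.swap_apply_of_ne_of_ne (fun h => hy.1 (mem_covered.2 ⟨e, he, h ▸ hw⟩))
        (fun h => hz.1 (mem_covered.2 ⟨e, he, h ▸ hw⟩))
    induction e with
    | _ a b => simp [this a, this b]

lemma extCount_nonneg (P : Finset (Sym2 X)) : 0 ≤ extCount P := Nat.cast_nonneg _

lemma sum_extCount {P : Finset (Sym2 X)} {x : X} (hx : x ∉ covered P) :
    ∑ y ∈ free P x, extCount (insert s(x, y) P) = extCount P := by
  have := sum_extensions_eq (fun _ => 1) hx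
  simpa [extCount] using this.symm

lemma card_free_mul_extCount {P : Finset (Sym2 X)} {x y : X} (hx : x ∉ covered P)
    (hy : y ∈ free P x) : ((free P x).card : ℝ) * extCount (insert s(x, y) P) = extCount P := by
  rw [← sum_extCount hx, ← nsmul_eq_mul, ← sum_const]
  exact sum_congr rfl fun z hz =>
    le_antisymm (extCount_insert_le hy hz) (extCount_insert_le hz hy)

lemma card_free {P : Finset (Sym2 X)} {x : X} (hx : x ∉ covered P) :
    (free P x).card + (covered P).card + 1 = Fintype.card X := by
  have h : free P x = univ \ (insert x (covered P)) := by
    ext y; simp [mem_free, and_comm]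
  have h2 := card_sdiff_add_card_eq_card (subset_univ (insert x (covered P)))
  rw [← h, card_insert_of_notMem hx, card_univ] at h2
  omega

/-- The sum of `F S` over the percolated matchings, if the edges in `P` have been revealed, and
those in `Q` among them are kept. -/
noncomputable def percSum (p : ℝ) (P Q : Finset (Sym2 X)) (F : Finset (Sym2 X) → ℝ) : ℝ :=
  ∑ M ∈ extensions P, ∑ T ∈ (M \ P).powerset,
    p ^ T.card * (1 - p) ^ ((M \ P) \ T).card * F (Q ∪ T)

lemma percSum_mono {p : ℝ} (hp : 0 ≤ p) (hp1 : p ≤ 1) {P Q : Finset (Sym2 X)}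
    {F G : Finset (Sym2 X) → ℝ}
    (h : ∀ M ∈ extensions P, ∀ T ⊆ M \ P, F (Q ∪ T) ≤ G (Q ∪ T)) :
    percSum p P Q F ≤ percSum p P Q G := by
  refine sum_le_sum fun M hM => sum_le_sum fun T hT => ?_
  have : 0 ≤ 1 - p := by linarith
  exact mul_le_mul_of_nonneg_left (h M hM T (mem_powerset.1 hT)) (by positivity)

lemma sum_powerset_pow (p q : ℝ) (A : Finset (Sym2 X)) :
    ∑ T ∈ A.powerset, p ^ T.card * q ^ (A \ T).card = (p + q) ^ A.card := by
  rw [← Finset.sum_pow_mul_eq_add_pow]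
  refine sum_congr rfl fun T hT => ?_
  rw [card_sdiff_of_subset (mem_powerset.1 hT)]

lemma percSum_const (p : ℝ) (P Q : Finset (Sym2 X)) (c : ℝ) :
    percSum p P Q (fun _ => c) = c * extCount P := by
  unfold percSum
  simp_rw [← sum_mul, sum_powerset_pow]
  simp [extCount, mul_comm]

lemma percSum_mul_left (p : ℝ) (P Q : Finset (Sym2 X)) (c : ℝ) (F : Finset (Sym2 X) → ℝ) :
    percSum p P Q (fun S => c * F S) = c * percSum p P Q F := by
  unfold percSum
  simp_rw [mul_sum]
  exact sum_congr rfl fun M _ => sum_congr rfl fun T _ => by ring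

lemma percSum_sum {ι : Type*} (s : Finset ι) (p : ℝ) (P Q : Finset (Sym2 X))
    (F : ι → Finset (Sym2 X) → ℝ) :
    percSum p P Q (fun S => ∑ i ∈ s, F i S) = ∑ i ∈ s, percSum p P Q (F i) := by
  unfold percSum
  simp_rw [mul_sum]
  rw [sum_comm (s := s)]
  refine sum_congr rfl fun M _ => ?_
  rw [sum_comm]

/-- Revealing the partner of `x` and the status of its edge. -/
lemma percSum_step (p : ℝ) (F : Finset (Sym2 X) → ℝ) {P : Finset (Sym2 X)}
    (Q : Finset (Sym2 X)) {x : X} (hx : x ∉ covered P) :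
    percSum p P Q F = ∑ y ∈ free P x,
      (p * percSum p (insert s(x, y) P) (insert s(x, y) Q) F +
        (1 - p) * percSum p (insert s(x, y) P) Q F) := by
  unfold percSum
  rw [sum_extensions_eq _ hx]
  refine sum_congr rfl fun y _ => ?_
  rw [mul_sum, mul_sum, ← sum_add_distrib]
  refine sum_congr rfl fun M hM => ?_
  have he : s(x, y) ∈ M := (mem_extensions.1 hM).2 (mem_insert_self _ _)
  have heP : s(x, y) ∉ P := notMem_of_notMem_covered hx
  have hMP : M \ P = insert s(x, y) (M \ insert s(x, y) P) := by
    ext e; simp only [mem_sdiff, mem_insert]; by_cases h : e = s(x, y)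
    · subst h; simp [he, heP]
    · simp [h]
  have hn : s(x, y) ∉ M \ insert s(x, y) P := by simp
  rw [hMP, sum_powerset_insert hn, add_comm, mul_sum, mul_sum]
  congr 1
  · refine sum_congr rfl fun T hT => ?_
    have hT' : s(x, y) ∉ T := fun h => hn (mem_powerset.1 hT h)
    have h1 : insert s(x, y) (M \ insert s(x, y) P) \ insert s(x, y) T =
        (M \ insert s(x, y) P) \ T := by
      rw [insert_sdiff_insert, sdiff_insert_of_notMem hn]
    rw [card_insert_of_notMem hT', h1, pow_succ, union_insert, insert_union]
    ring
  · refine sum_congr rfl fun T hT => ?_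
    have hT' : s(x, y) ∉ T := fun h => hn (mem_powerset.1 hT h)
    have hn' : s(x, y) ∉ (M \ insert s(x, y) P) \ T := fun h => hn (mem_sdiff.1 h).1
    rw [insert_sdiff_of_notMem _ hT', card_insert_of_notMem hn', pow_succ]
    ring

/-- One step of an exploration: bounds after the step give a bound before it. -/
lemma percSum_step_le {p : ℝ} (hp : 0 ≤ p) (hp1 : p ≤ 1) {F : Finset (Sym2 X) → ℝ}
    {P Q : Finset (Sym2 X)} {x : X} (hx : x ∉ covered P) {B : Finset X} {C α β η : ℝ}
    (hC : 0 ≤ C) (hα : 0 ≤ α) (hβ : 0 ≤ β)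
    (hB : ((B ∩ free P x).card : ℝ) ≤ η * (free P x).card)
    (hbad : ∀ y ∈ free P x, ∀ Q' ⊆ insert s(x, y) Q, percSum p (insert s(x, y) P) Q' F ≤
      C * extCount (insert s(x, y) P))
    (hkept : ∀ y ∈ free P x, y ∉ B → percSum p (insert s(x, y) P) (insert s(x, y) Q) F ≤
      C * extCount (insert s(x, y) P) * β)
    (hclosed : ∀ y ∈ free P x, y ∉ B → percSum p (insert s(x, y) P) Q F ≤
      C * extCount (insert s(x, y) P) * α) :
    percSum p P Q F ≤ C * extCount P * ((1 - p) * α + p * β + η) := by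
  have hq : 0 ≤ 1 - p := by linarith
  rw [percSum_step p F Q hx]
  -- A bad partner only gets the trivial bound; it is charged a full extra unit, whether or not its
  -- edge is kept.
  have h1 : ∀ y ∈ free P x,
      (p * percSum p (insert s(x, y) P) (insert s(x, y) Q) F +
        (1 - p) * percSum p (insert s(x, y) P) Q F) ≤
      C * extCount (insert s(x, y) P) * ((1 - p) * α + p * β + if y ∈ B then 1 else 0) := by
    intro y hy
    have hm := mul_nonneg hC (extCount_nonneg (insert s(x, y) P))
    split_ifs with hyB
    · have a1 := mul_le_mul_of_nonneg_left (hbad y hy (insert s(x, y) Q) Subset.rfl) hp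
      have a2 := mul_le_mul_of_nonneg_left (hbad y hy Q (subset_insert _ _)) hq
      have a3 := mul_nonneg hm (add_nonneg (mul_nonneg hq hα) (mul_nonneg hp hβ))
      nlinarith
    · have a1 := mul_le_mul_of_nonneg_left (hkept y hy hyB) hp
      have a2 := mul_le_mul_of_nonneg_left (hclosed y hy hyB) hq
      nlinarith
  refine (sum_le_sum h1).trans ?_
  have h2 : ∀ y ∈ free P x,
      C * extCount (insert s(x, y) P) * ((1 - p) * α + p * β + if y ∈ B then 1 else 0) =
      C * ((1 - p) * α + p * β) * extCount (insert s(x, y) P) +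
        if y ∈ B then C * extCount (insert s(x, y) P) else 0 := by
    intro y _
    split_ifs <;> ring
  rw [sum_congr rfl h2, sum_add_distrib, ← mul_sum, sum_extCount hx, ← sum_filter]
  -- All partners carry the same mass, so the bad ones carry at most the share `η`.
  have h3 : ∑ y ∈ (free P x).filter (· ∈ B), C * extCount (insert s(x, y) P) ≤
      C * extCount P * η := by
    rcases (free P x).eq_empty_or_nonempty with h0 | ⟨z, hz⟩
    · have : extCount P = 0 := by rw [← sum_extCount hx, h0, sum_empty]
      simp [h0, this]
    have hz' := card_free_mul_extCount hx hz
    have : ∀ y ∈ (free P x).filter (· ∈ B), C * extCount (insert s(x, y) P) ≤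
        C * extCount (insert s(x, z) P) := fun y hy =>
      mul_le_mul_of_nonneg_left (extCount_insert_le (mem_filter.1 hy).1 hz) hC
    refine (sum_le_card_nsmul _ _ _ this).trans ?_
    have hc : (free P x).filter (· ∈ B) = B ∩ free P x := by ext; simp [and_comm]
    rw [nsmul_eq_mul, hc, ← hz']
    calc _ ≤ (η * (free P x).card) * (C * extCount (insert s(x, z) P)) :=
          mul_le_mul_of_nonneg_right hB (mul_nonneg hC (extCount_nonneg _))
      _ = _ := by ring
  nlinarith

end Matching

/-! ### Exploring a component -/

section Exploration

variable {n d : ℕ}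

/-- `u` and `v` are joined by an edge of the multigraph obtained from `S`. -/
def Joined (S : Finset (Sym2 (Point n d))) (u v : Fin n) : Prop :=
  ∃ x y : Point n d, s(x, y) ∈ S ∧ x.1 = u ∧ y.1 = v

/-- `u` and `v` are in the same component. -/
def Reach (S : Finset (Sym2 (Point n d))) : Fin n → Fin n → Prop :=
  Relation.ReflTransGen (Joined S)

open Classical in
/-- The component of `v`. -/
noncomputable def comp (S : Finset (Sym2 (Point n d))) (v : Fin n) : Finset (Fin n) :=
  univ.filter (Reach S v)

lemma mem_comp {S : Finset (Sym2 (Point n d))} {v w : Fin n} : w ∈ comp S v ↔ Reach S v w := by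
  simp [comp]

lemma Joined.mono {S S' : Finset (Sym2 (Point n d))} (h : S ⊆ S') {u v : Fin n}
    (hj : Joined S u v) : Joined S' u v := by
  obtain ⟨x, y, hs, hx, hy⟩ := hj
  exact ⟨x, y, h hs, hx, hy⟩

lemma Joined.symm {S : Finset (Sym2 (Point n d))} {u v : Fin n} (hj : Joined S u v) :
    Joined S v u := by
  obtain ⟨x, y, hs, hx, hy⟩ := hj
  exact ⟨y, x, Sym2.eq_swap ▸ hs, hy, hx⟩

lemma Reach.mono {S S' : Finset (Sym2 (Point n d))} (h : S ⊆ S') {u v : Fin n}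
    (hr : Reach S u v) : Reach S' u v :=
  Relation.ReflTransGen.mono (r := Joined S) (p := Joined S') (fun _ _ hj => Joined.mono h hj) _ _ hr

lemma Reach.symm {S : Finset (Sym2 (Point n d))} {u v : Fin n} (hr : Reach S u v) :
    Reach S v u := by
  induction hr with
  | refl => exact Relation.ReflTransGen.refl
  | tail _ h ih => exact Relation.ReflTransGen.head h.symm ih

lemma Reach.mem_of_closed {S : Finset (Sym2 (Point n d))} {V : Finset (Fin n)}
    (hV : ∀ u v, Joined S u v → u ∈ V → v ∈ V) {u v : Fin n} (hr : Reach S u v) (hu : u ∈ V) :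
    v ∈ V := by
  induction hr with
  | refl => exact hu
  | tail _ h ih => exact hV _ _ h ih

/-- The points of the vertices in `V`. -/
def points (d : ℕ) (V : Finset (Fin n)) : Finset (Point n d) := univ.filter fun x => x.1 ∈ V

lemma mem_points {V : Finset (Fin n)} {x : Point n d} : x ∈ points d V ↔ x.1 ∈ V := by
  simp [points]

lemma card_points (V : Finset (Fin n)) : (points d V).card = d * V.card := by
  have : points d V = V ×ˢ (univ : Finset (Fin d)) := by ext; simp [mem_points]
  rw [this, card_product, card_univ, Fintype.card_fin, mul_comm]

/-- The state of an exploration from the vertex `v`: the edges in `P` have been revealed, those in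
`Q` are kept, and the vertices in `V` have been found. -/
structure Explored (v : Fin n) (P Q : Finset (Sym2 (Point n d))) (V : Finset (Fin n)) : Prop where
  subset : Q ⊆ P
  root : v ∈ V
  reach : ∀ w ∈ V, Reach Q v w
  closed : ∀ x y : Point n d, s(x, y) ∈ Q → x.1 ∈ V → y.1 ∈ V
  card_le : V.card ≤ P.card + 1

/-- The points of found vertices that have not been matched. -/
def active (P : Finset (Sym2 (Point n d))) (V : Finset (Fin n)) : Finset (Point n d) :=
  points d V \ covered P

/-- The points of vertices that have been found, or have a matched point. -/
def touched (P : Finset (Sym2 (Point n d))) (V : Finset (Fin n)) : Finset (Point n d) :=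
  points d (V ∪ (covered P).image Prod.fst)

lemma mem_active {P : Finset (Sym2 (Point n d))} {V : Finset (Fin n)} {x : Point n d} :
    x ∈ active P V ↔ x.1 ∈ V ∧ x ∉ covered P := by
  simp [active, mem_points]

lemma notMem_touched {P : Finset (Sym2 (Point n d))} {V : Finset (Fin n)} {y : Point n d} :
    y ∉ touched P V ↔ y.1 ∉ V ∧ ∀ z : Point n d, z.1 = y.1 → z ∉ covered P := by
  simp only [touched, mem_points, mem_union, mem_image, not_or, not_exists, not_and]
  exact and_congr_right fun _ => ⟨fun h z hz hc => h z hc hz, fun h z hc hz => h z hz hc⟩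

lemma card_touched_le (P : Finset (Sym2 (Point n d))) (V : Finset (Fin n)) :
    (touched P V).card ≤ d * (V.card + 2 * P.card) := by
  rw [touched, card_points]
  refine Nat.mul_le_mul_left _ ((card_union_le _ _).trans ?_)
  have := card_image_le (s := covered P) (f := Prod.fst)
  have := card_covered_le P
  omega

/-- Since `y` is untouched, its vertex is new and none of its points occurs in `P`; no earlier kept
edge can therefore lead out of the enlarged vertex set. -/
lemma Explored.kept {v : Fin n} {P Q : Finset (Sym2 (Point n d))} {V : Finset (Fin n)}
    (h : Explored v P Q V) {x y : Point n d} (hx : x ∈ active P V) (hy : y ∉ touched P V) :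
    Explored v (insert s(x, y) P) (insert s(x, y) Q) (insert y.1 V) := by
  rw [mem_active] at hx
  rw [notMem_touched] at hy
  refine ⟨insert_subset_insert _ h.subset, mem_insert_of_mem h.root, fun w hw => ?_,
    fun a b hab ha => ?_, ?_⟩
  · rcases mem_insert.1 hw with rfl | hw
    · exact Relation.ReflTransGen.tail ((h.reach _ hx.1).mono (subset_insert _ _))
        ⟨x, y, mem_insert_self _ _, rfl, rfl⟩
    · exact (h.reach _ hw).mono (subset_insert _ _)
  · rcases mem_insert.1 hab with hab | hab
    · rcases Sym2.eq_iff.1 hab with ⟨-, rfl⟩ | ⟨-, rfl⟩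
      · exact mem_insert_self _ _
      · exact mem_insert_of_mem hx.1
    · rcases mem_insert.1 ha with ha | ha
      · exact absurd (mem_covered.2 ⟨_, h.subset hab, Sym2.mem_mk_left _ _⟩) (hy.2 a ha)
      · exact mem_insert_of_mem (h.closed _ _ hab ha)
  · rw [card_insert_of_notMem hy.1, card_insert_of_notMem (notMem_of_notMem_covered hx.2)]
    have := h.card_le
    omega

lemma Explored.closed_edge {v : Fin n} {P Q : Finset (Sym2 (Point n d))} {V : Finset (Fin n)}
    (h : Explored v P Q V) (x y : Point n d) : Explored v (insert s(x, y) P) Q V :=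
  ⟨h.subset.trans (subset_insert _ _), h.root, h.reach, h.closed,
    h.card_le.trans (Nat.succ_le_succ (card_le_card (subset_insert _ _)))⟩

/-- The upward step of the walk: `x` is used up, and the new vertex brings all of its `d` points
except `y`. -/
lemma card_active_kept {P : Finset (Sym2 (Point n d))} {V : Finset (Fin n)} {x y : Point n d}
    (hx : x ∈ active P V) (hy : y ∉ touched P V) :
    (active (insert s(x, y) P) (insert y.1 V)).card = (active P V).card - 1 + (d - 1) := by
  have hx' := mem_active.1 hx
  rw [notMem_touched] at hy
  have : active (insert s(x, y) P) (insert y.1 V) =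
      (active P V).erase x ∪ (points d {y.1}).erase y := by
    ext z
    simp only [mem_active, covered_insert, mem_insert, mem_union, mem_erase, mem_points,
      mem_singleton]
    constructor
    · rintro ⟨h1 | h1, h2⟩ <;> tauto
    · rintro (⟨h1, h2, h3⟩ | ⟨h1, h2⟩)
      · refine ⟨Or.inr h2, ?_⟩
        rintro (h | rfl | h)
        · exact h1 h
        · exact hy.1 h2
        · exact h3 h
      · refine ⟨Or.inl h2, ?_⟩
        rintro (rfl | h | h)
        · exact hy.1 (h2 ▸ hx'.1)
        · exact h1 h
        · exact hy.2 z h2 h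
  rw [this, card_union_of_disjoint, card_erase_of_mem hx, card_erase_of_mem, card_points]
  · simp
  · simp [mem_points]
  · refine disjoint_left.2 fun z hz hz' => hy.1 ?_
    have h1 := (mem_active.1 (mem_of_mem_erase hz)).1
    have h2 := mem_points.1 (mem_of_mem_erase hz')
    rw [mem_singleton] at h2
    rwa [h2] at h1

lemma card_active_closed {P : Finset (Sym2 (Point n d))} {V : Finset (Fin n)} {x y : Point n d}
    (hx : x ∈ active P V) (hy : y ∉ touched P V) :
    (active (insert s(x, y) P) V).card = (active P V).card - 1 := by
  rw [notMem_touched] at hy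
  rw [← card_erase_of_mem hx]
  congr 1
  ext z
  simp only [mem_active, covered_insert, mem_insert, mem_erase]
  constructor
  · tauto
  · rintro ⟨h1, h2, h3⟩
    refine ⟨h2, ?_⟩
    rintro (h | rfl | h)
    · exact h1 h
    · exact hy.1 h2
    · exact h3 h

/-- This forces the found set to grow: `d * K` steps cover `d * K` points of found vertices, which
takes at least `K` vertices. -/
lemma card_covered_inter_step {P : Finset (Sym2 (Point n d))} {V V' : Finset (Fin n)}
    (hV : V ⊆ V') {x : Point n d} (y : Point n d) (hx : x ∈ active P V) :
    (covered P ∩ points d V).card + 1 ≤ (covered (insert s(x, y) P) ∩ points d V').card := by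
  rw [mem_active] at hx
  have h1 : x ∉ covered P ∩ points d V := fun h => hx.2 (mem_inter.1 h).1
  rw [← card_insert_of_notMem h1]
  refine card_le_card (insert_subset ?_ fun z hz => ?_)
  · simp [covered_insert, mem_points, hV hx.1]
  · rw [mem_inter, mem_points] at hz ⊢
    exact ⟨by simp [covered_insert, hz.1], hV hz.2⟩

/-- With at most `s` edges revealed, at most a share `η` of the free points is touched. -/
def Sparse (n d s : ℕ) (η : ℝ) : Prop :=
  (d : ℝ) * (3 * s + 1) ≤ η * ((n * d : ℕ) - 2 * s - 1)

/-- At most `s + 1` vertices are found and at most `2 * s` have a covered point, so `d * (3 * s +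
1)` bounds the touched points, while at least `n * d - 2 * s - 1` points are free. This is the error
per step of the comparison with the walk. -/
lemma card_touched_inter_free {s : ℕ} {η : ℝ} (hη : 0 ≤ η) (hs : Sparse n d s η)
    {P : Finset (Sym2 (Point n d))} {V : Finset (Fin n)} {x : Point n d} (hx : x ∉ covered P)
    (hV : V.card ≤ P.card + 1) (hP : P.card ≤ s) :
    ((touched P V ∩ free P x).card : ℝ) ≤ η * (free P x).card := by
  have h1 : (touched P V ∩ free P x).card ≤ d * (3 * s + 1) :=
    (card_le_card inter_subset_left).trans ((card_touched_le P V).trans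
      (Nat.mul_le_mul_left _ (by omega)))
  have h2 := card_free hx
  have h3 := card_covered_le P
  rw [Fintype.card_prod, Fintype.card_fin, Fintype.card_fin] at h2
  have h4 : ((n * d : ℕ) : ℝ) - 2 * s - 1 ≤ (free P x).card := by
    have : n * d ≤ (free P x).card + 2 * s + 1 := by omega
    have : ((n * d : ℕ) : ℝ) ≤ (free P x).card + 2 * s + 1 := by exact_mod_cast this
    linarith
  calc ((touched P V ∩ free P x).card : ℝ) ≤ (d * (3 * s + 1) : ℕ) := by exact_mod_cast h1
    _ = (d : ℝ) * (3 * s + 1) := by push_cast; ring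
    _ ≤ _ := hs.trans (mul_le_mul_of_nonneg_left h4 hη)

open Classical in
/-- Comparison of the exploration of a component with a random walk. -/
lemma explore {p : ℝ} (hp : 0 ≤ p) (hp1 : p ≤ 1) {u : ℕ → ℕ → ℝ} (hu : ∀ k a, 0 ≤ u k a)
    (hrec : ∀ k a, u (k + 1) (a + 1) = (1 - p) * u k a + p * u k (a + (d - 1)))
    {E : Finset (Sym2 (Point n d)) → Prop} {G : Finset (Sym2 (Point n d)) → ℝ}
    (hG : ∀ S, 0 ≤ G S) {C η : ℝ} (hC : 0 ≤ C) (hη : 0 ≤ η) {s : ℕ} (hs : Sparse n d s η)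
    (hGC : ∀ P Q, Q ⊆ P → P.card ≤ s → percSum p P Q G ≤ C * extCount P) {v : Fin n} {K₁ K₂ : ℕ}
    (hT : ∀ k P Q V, Explored v P Q V → d * K₁ ≤ k + (covered P ∩ points d V).card →
      V.card + k ≤ K₂ → (active P V = ∅ ∨ k = 0) → u k (active P V).card < 1 →
      ∀ M ∈ extensions P, ∀ T ⊆ M \ P, ¬ E (Q ∪ T)) (k : ℕ) :
    ∀ P Q V, Explored v P Q V → d * K₁ ≤ k + (covered P ∩ points d V).card →
      V.card + k ≤ K₂ → P.card + k ≤ s →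
      percSum p P Q (fun S => if E S then G S else 0) ≤
        C * extCount P * (u k (active P V).card + k * η) := by
  -- The trivial bound, used for bad partners and when `u` is at least 1: the indicator is dropped.
  have hle : ∀ P Q, Q ⊆ P → P.card ≤ s → percSum p P Q (fun S => if E S then G S else 0) ≤
      C * extCount P := fun P Q hQP hP => by
    refine (percSum_mono hp hp1 fun M _ T _ => ?_).trans (hGC P Q hQP hP)
    split_ifs
    · exact le_rfl
    · exact hG _
  -- When the exploration stops, either `u ≥ 1` and the trivial bound suffices, or `u < 1` and `hT`
  -- excludes the event. Thus `u` only needs the right boundary values.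
  have hterm : ∀ k P Q V, Explored v P Q V → d * K₁ ≤ k + (covered P ∩ points d V).card →
      V.card + k ≤ K₂ → P.card + k ≤ s → (active P V = ∅ ∨ k = 0) →
      percSum p P Q (fun S => if E S then G S else 0) ≤
        C * extCount P * (u k (active P V).card + k * η) := by
    intro k P Q V hE h1 h2 h3 h4
    have hm := mul_nonneg hC (extCount_nonneg P)
    have hk : 0 ≤ (k : ℝ) * η := by positivity
    by_cases h5 : u k (active P V).card < 1
    · refine (percSum_mono (G := fun _ => 0) hp hp1 fun M hM T hT' => ?_).trans ?_
      · rw [if_neg (hT k P Q V hE h1 h2 h4 h5 M hM T hT')]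
      · rw [percSum_const, zero_mul]
        exact mul_nonneg hm (add_nonneg (hu _ _) hk)
    · refine (hle P Q hE.subset (by omega)).trans ?_
      push Not at h5
      nlinarith
  induction k with
  | zero => exact fun P Q V hE h1 h2 h3 => hterm 0 P Q V hE h1 h2 h3 (Or.inr rfl)
  | succ k ih =>
    intro P Q V hE h1 h2 h3
    rcases (active P V).eq_empty_or_nonempty with h0 | ⟨x, hx⟩
    · exact hterm _ P Q V hE h1 h2 h3 (Or.inl h0)
    have hxc := (mem_active.1 hx).2
    obtain ⟨a, ha⟩ : ∃ a, (active P V).card = a + 1 :=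
      Nat.exists_eq_succ_of_ne_zero (card_ne_zero_of_mem hx)
    have hkη : 0 ≤ (k : ℝ) * η := by positivity
    have hcard : ∀ y, (insert s(x, y) P).card = P.card + 1 := fun y =>
      card_insert_of_notMem (notMem_of_notMem_covered hxc)
    -- Touched partners are the bad ones. For the others the number of active points moves exactly
    -- like the walk, and each step adds one `η` to the error.
    refine (percSum_step_le hp hp1 hxc (B := touched P V) (α := u k a + k * η)
      (β := u k (a + (d - 1)) + k * η) (η := η) hC (add_nonneg (hu _ _) hkη)
      (add_nonneg (hu _ _) hkη)
      (card_touched_inter_free hη hs hxc hE.card_le (by omega)) (fun y _ Q' hQ' => ?_)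
      (fun y _ hyB => ?_) (fun y _ hyB => ?_)).trans_eq ?_
    · exact hle _ _ (hQ'.trans (insert_subset_insert _ hE.subset)) (by rw [hcard]; omega)
    · have hc := card_active_kept hx hyB
      have := ih _ _ _ (hE.kept hx hyB)
        (by have := card_covered_inter_step (subset_insert y.1 V) y hx; omega)
        (by have := card_insert_le y.1 V; omega) (by rw [hcard]; omega)
      rwa [hc, ha, Nat.add_sub_cancel] at this
    · have hc := card_active_closed hx hyB
      have := ih _ _ _ (hE.closed_edge x y)
        (by have := card_covered_inter_step (Subset.refl V) y hx; omega)
        (by omega) (by rw [hcard]; omega)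
      rwa [hc, ha, Nat.add_sub_cancel] at this
    · rw [ha, hrec]
      push_cast
      ring

end Exploration

/-! ### Hitting probabilities of the walk -/

/-- The probability that the random walk which steps by `d - 2` with probability `p` and by `-1`
otherwise hits `0` within `k` steps from `a`. -/
noncomputable def walkProb (p : ℝ) (d : ℕ) : ℕ → ℕ → ℝ
  | _, 0 => 1
  | 0, _ + 1 => 0
  | k + 1, a + 1 => (1 - p) * walkProb p d k a + p * walkProb p d k (a + (d - 1))

lemma walkProb_zero_right (p : ℝ) (d k : ℕ) : walkProb p d k 0 = 1 := by
  cases k <;> rw [walkProb]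

lemma walkProb_nonneg {p : ℝ} (hp : 0 ≤ p) (hp1 : p ≤ 1) (d k a : ℕ) : 0 ≤ walkProb p d k a := by
  have hq : 0 ≤ 1 - p := by linarith
  induction k generalizing a with
  | zero => cases a <;> simp [walkProb]
  | succ k ih =>
    cases a with
    | zero => simp [walkProb]
    | succ a =>
      rw [walkProb]
      exact add_nonneg (mul_nonneg hq (ih _)) (mul_nonneg hp (ih _))

/-- Under `h`, the function `a ↦ y ^ a` is a supersolution of the recursion and dominates the
initial values of `walkProb` at time 0. -/
lemma walkProb_le_pow {p : ℝ} (hp : 0 ≤ p) (hp1 : p ≤ 1) {d : ℕ} {y : ℝ} (hy : 0 ≤ y)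
    (h : 1 - p + p * y ^ (d - 1) ≤ y) (k a : ℕ) : walkProb p d k a ≤ y ^ a := by
  have hq : 0 ≤ 1 - p := by linarith
  induction k generalizing a with
  | zero =>
    cases a
    · simp [walkProb]
    · rw [walkProb]; positivity
  | succ k ih =>
    cases a with
    | zero => simp [walkProb]
    | succ a =>
      rw [walkProb]
      calc _ ≤ (1 - p) * y ^ a + p * y ^ (a + (d - 1)) :=
            add_le_add (mul_le_mul_of_nonneg_left (ih _) hq) (mul_le_mul_of_nonneg_left (ih _) hp)
        _ = y ^ a * (1 - p + p * y ^ (d - 1)) := by ring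
        _ ≤ y ^ a * y := mul_le_mul_of_nonneg_left h (by positivity)
        _ = _ := by ring

lemma walkProb_le_one {p : ℝ} (hp : 0 ≤ p) (hp1 : p ≤ 1) (d k a : ℕ) : walkProb p d k a ≤ 1 := by
  simpa using walkProb_le_pow hp hp1 (y := 1) (d := d) zero_le_one (by simp) k a

/-! ### Local events, their moments and their tails -/

section Moments

variable {n d : ℕ}

lemma Sparse.anti {s s' : ℕ} {η : ℝ} (hη : 0 ≤ η) (h : Sparse n d s η) (hs : s' ≤ s) :
    Sparse n d s' η := by
  have hs' : (s' : ℝ) ≤ s := by exact_mod_cast hs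
  have hd : (0 : ℝ) ≤ d := Nat.cast_nonneg d
  unfold Sparse at h ⊢
  nlinarith [mul_le_mul_of_nonneg_left hs' hd, mul_le_mul_of_nonneg_left hs' hη]

open Classical in
/-- The conditional probability that the event `E` occurs at a point of an untouched vertex is at
most `q`, in the sense of expectations, as long as `k` of `s` edges may still be revealed. -/
def LocalBound (p : ℝ) (E : Finset (Sym2 (Point n d)) → Point n d → Prop) (k s : ℕ) (q : ℝ) :
    Prop :=
  ∀ s' ≤ s, ∀ G : Finset (Sym2 (Point n d)) → ℝ, (∀ S, 0 ≤ G S) → ∀ C : ℝ, 0 ≤ C →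
    (∀ P Q, Q ⊆ P → P.card ≤ s' → percSum p P Q G ≤ C * extCount P) →
    ∀ x P Q, Q ⊆ P → P.card + k ≤ s' → (∀ z : Point n d, z.1 = x.1 → z ∉ covered P) →
      percSum p P Q (fun S => if E S x then G S else 0) ≤ C * extCount P * q

lemma explored_singleton {P Q : Finset (Sym2 (Point n d))} {x : Point n d} (hQ : Q ⊆ P)
    (hx : ∀ z : Point n d, z.1 = x.1 → z ∉ covered P) : Explored x.1 P Q {x.1} where
  subset := hQ
  root := mem_singleton_self _
  reach w hw := by rw [mem_singleton.1 hw]; exact Relation.ReflTransGen.refl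
  closed a b hab ha := absurd (mem_covered.2 ⟨_, hQ hab, Sym2.mem_mk_left _ _⟩)
    (hx a (mem_singleton.1 ha))
  card_le := by simp

lemma active_singleton {P : Finset (Sym2 (Point n d))} {x : Point n d}
    (hx : ∀ z : Point n d, z.1 = x.1 → z ∉ covered P) : (active P {x.1}).card = d := by
  have : active P {x.1} = points d {x.1} := by
    ext z
    simp only [mem_active, mem_points, mem_singleton, and_iff_left_iff_imp]
    exact hx z
  rw [this, card_points, card_singleton, mul_one]

/-- The walk probability is 1 when no point is active, so a value below 1 means that the steps ran
out; by then `d * K₁` points of found vertices are covered. -/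
lemma Explored.not_small {v : Fin n} {P Q V k K₁} (h : Explored (d := d) v P Q V) (hd : 0 < d)
    (h1 : d * K₁ ≤ k + (covered P ∩ points d V).card) {p : ℝ}
    (h3 : active P V = ∅ ∨ k = 0) (h4 : walkProb p d k (active P V).card < 1)
    (T : Finset (Sym2 (Point n d))) : ¬ (comp (Q ∪ T) v).card < K₁ := by
  have hk : k = 0 := by
    rcases h3 with h3 | h3
    · rw [h3, card_empty, walkProb_zero_right] at h4
      exact absurd h4 (lt_irrefl _)
    · exact h3
  subst hk
  have h5 := h1.trans ((Nat.zero_add _).le.trans (card_le_card inter_subset_right))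
  rw [card_points] at h5
  have h6 := Nat.le_of_mul_le_mul_left h5 hd
  have h7 : V ⊆ comp (Q ∪ T) v := fun w hw =>
    mem_comp.2 ((h.reach w hw).mono subset_union_left)
  have := card_le_card h7
  omega

/-- The complementary probability is 1 if the steps run out with an active point left, so a value
below 1 means that no point is active. All edges at `V` are then revealed, and `V` contains the
whole component. -/
lemma Explored.not_large {v : Fin n} {P Q V k K₂} (h : Explored (d := d) v P Q V)
    (h2 : V.card + k ≤ K₂) {p : ℝ}
    (h3 : active P V = ∅ ∨ k = 0) (h4 : 1 - walkProb p d k (active P V).card < 1)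
    {M T : Finset (Sym2 (Point n d))} (hM : M ∈ extensions P) (hT : T ⊆ M \ P) :
    ¬ K₂ < (comp (Q ∪ T) v).card := by
  have h0 : active P V = ∅ := by
    by_contra hne
    have hk := h3.resolve_left hne
    obtain ⟨a, ha⟩ : ∃ a, (active P V).card = a + 1 :=
      Nat.exists_eq_succ_of_ne_zero (fun h => hne (card_eq_zero.1 h))
    rw [hk, ha, walkProb, sub_zero] at h4
    exact lt_irrefl _ h4
  have hsub : comp (Q ∪ T) v ⊆ V := by
    intro w hw
    refine (mem_comp.1 hw).mem_of_closed ?_ h.root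
    rintro _ _ ⟨x, y, hxy, rfl, rfl⟩ hx
    rcases mem_union.1 hxy with hxy | hxy
    · exact h.closed x y hxy hx
    · exfalso
      have hxc : x ∈ covered P := by
        by_contra hxc
        exact notMem_empty x (h0 ▸ mem_active.2 ⟨hx, hxc⟩)
      obtain ⟨e, he, hxe⟩ := mem_covered.1 hxc
      have hM' := mem_extensions.1 hM
      have hxy' := mem_sdiff.1 (hT hxy)
      have := hM'.1.eq_of_mem hxy'.1 (hM'.2 he) (Sym2.mem_mk_left _ _) hxe
      exact hxy'.2 (this ▸ he)
  have := card_le_card hsub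
  omega

lemma walk_rec_compl (p : ℝ) (d k a : ℕ) : 1 - walkProb p d (k + 1) (a + 1) =
    (1 - p) * (1 - walkProb p d k a) + p * (1 - walkProb p d k (a + (d - 1))) := by
  rw [walkProb]; ring

/-- The budget of `d * K` steps is what it takes to cover all points of `K` vertices, one point per
step at worst. -/
lemma localBound_small {p : ℝ} (hp : 0 ≤ p) (hp1 : p ≤ 1) (hd : 0 < d) (K : ℕ) {s : ℕ} {η : ℝ}
    (hη : 0 ≤ η) (hs : Sparse n d s η) :
    LocalBound (n := n) (d := d) p (fun S x => (comp S x.1).card < K) (d * K) s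
      (walkProb p d (d * K) d + (d * K : ℕ) * η) := by
  intro s' hs' G hG C hC hGC x P Q hQ hP hx
  have := explore hp hp1 (u := walkProb p d) (walkProb_nonneg hp hp1 d)
    (fun k a => by rw [walkProb]) (E := fun S => (comp S x.1).card < K) hG hC hη
    (hs.anti hη hs') hGC (v := x.1) (K₁ := K) (K₂ := d * K + 1)
    (fun k P Q V hE h1 h2 h3 h4 M _ T _ => hE.not_small hd h1 h3 h4 T) (d * K) P Q {x.1}
    (explored_singleton hQ hx) (by omega) (by rw [card_singleton]; omega) hP
  rwa [active_singleton hx] at this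

/-- Each step finds at most one vertex, so a component that is exhausted within `k` steps has at
most `k + 1` vertices. -/
lemma localBound_large {p : ℝ} (hp : 0 ≤ p) (hp1 : p ≤ 1) (k : ℕ) {s : ℕ} {η : ℝ}
    (hη : 0 ≤ η) (hs : Sparse n d s η) :
    LocalBound (n := n) (d := d) p (fun S x => k + 1 < (comp S x.1).card) k s
      (1 - walkProb p d k d + k * η) := by
  intro s' hs' G hG C hC hGC x P Q hQ hP hx
  have := explore hp hp1 (u := fun k a => 1 - walkProb p d k a)
    (fun k a => sub_nonneg.2 (walkProb_le_one hp hp1 d k a))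
    (walk_rec_compl p d) (E := fun S => k + 1 < (comp S x.1).card) hG hC hη
    (hs.anti hη hs') hGC (v := x.1) (K₁ := 0) (K₂ := k + 1)
    (fun k P Q V hE h1 h2 h3 h4 M hM T hT => hE.not_large h2 h3 h4 hM hT) k P Q {x.1}
    (explored_singleton hQ hx) (by omega) (by rw [card_singleton]; omega) hP
  simpa only [active_singleton hx] using this

lemma notMem_covered_closed {P Q T M : Finset (Sym2 (Point n d))} {x y : Point n d} (hQ : Q ⊆ P)
    (hx : x ∉ covered P) (hM : M ∈ extensions (insert s(x, y) P))
    (hT : T ⊆ M \ insert s(x, y) P) : x ∉ covered (Q ∪ T) := by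
  intro h
  obtain ⟨e, he, hxe⟩ := mem_covered.1 h
  rcases mem_union.1 he with he | he
  · exact hx (mem_covered.2 ⟨e, hQ he, hxe⟩)
  · have h1 := mem_sdiff.1 (hT he)
    have hM' := mem_extensions.1 hM
    have := hM'.1.eq_of_mem h1.1 (hM'.2 (mem_insert_self _ _)) hxe (Sym2.mem_mk_left _ _)
    exact h1.2 (this ▸ mem_insert_self _ _)

/-- For events that involve the edge at `x` itself, this edge is revealed first. If it is kept, the
two ends together have `2 * (d - 1)` active points, and the exploration goes on from there with `k`
further steps. -/
lemma localBound_edge_aux {p : ℝ} (hp : 0 ≤ p) (hp1 : p ≤ 1) {k s : ℕ} {α β η : ℝ} (hα : 0 ≤ α)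
    (hβ : 0 ≤ β) (hη : 0 ≤ η) (hs : Sparse n d s η)
    {G : Finset (Sym2 (Point n d)) → ℝ} {C : ℝ} (hC : 0 ≤ C)
    (hGC : ∀ P Q, Q ⊆ P → P.card ≤ s → percSum p P Q G ≤ C * extCount P) {x : Point n d}
    {P Q : Finset (Sym2 (Point n d))} (hQ : Q ⊆ P) (hP : P.card + (k + 1) ≤ s)
    (hx : ∀ z : Point n d, z.1 = x.1 → z ∉ covered P) {F : Finset (Sym2 (Point n d)) → ℝ}
    (hFG : ∀ S, F S ≤ G S)
    (hclosed : ∀ y ∈ free P x, y ∉ touched P {x.1} → percSum p (insert s(x, y) P) Q F ≤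
      C * extCount (insert s(x, y) P) * α)
    (hkept : ∀ y, Explored x.1 (insert s(x, y) P) (insert s(x, y) Q) (insert y.1 {x.1}) →
      (active (insert s(x, y) P) (insert y.1 {x.1})).card = d - 1 + (d - 1) →
      (insert y.1 ({x.1} : Finset (Fin n))).card ≤ 2 → (insert s(x, y) P).card = P.card + 1 →
      percSum p (insert s(x, y) P) (insert s(x, y) Q) F ≤
      C * extCount (insert s(x, y) P) * (β + k * η)) :
    percSum p P Q F ≤ C * extCount P * ((1 - p) * α + p * β + (k + 1 : ℕ) * η) := by
  have hxc := hx x rfl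
  have hE := explored_singleton hQ hx
  have hxa : x ∈ active P {x.1} := mem_active.2 ⟨mem_singleton_self _, hxc⟩
  have hcard : ∀ y, (insert s(x, y) P).card = P.card + 1 := fun y =>
      card_insert_of_notMem (notMem_of_notMem_covered hxc)
  have hkη : 0 ≤ (k : ℝ) * η := by positivity
  refine (percSum_step_le hp hp1 hxc (B := touched P {x.1}) (α := α) (β := β + k * η) (η := η) hC
    hα (add_nonneg hβ hkη) (card_touched_inter_free hη hs hxc hE.card_le (by omega))
    (fun y _ Q' hQ' => ?_) (fun y _ hyB => ?_) hclosed).trans ?_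
  · refine (percSum_mono hp hp1 fun M _ T _ => hFG _).trans
      (hGC _ _ (hQ'.trans (insert_subset_insert _ hQ)) ?_)
    rw [hcard]; omega
  · have := card_active_kept hxa hyB
    rw [active_singleton hx] at this
    exact hkept y (hE.kept hxa hyB) this ((card_insert_le _ _).trans (by simp)) (hcard y)
  · have hm := mul_nonneg hC (extCount_nonneg P)
    refine mul_le_mul_of_nonneg_left ?_ hm
    push_cast
    nlinarith [mul_le_mul_of_nonneg_right hp1 hkη]

/-- A deleted edge at `x` rules the event out, hence `α = 0`. In the limit the bound becomes p(1 -
φ²), the share of points matched inside large components. -/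
lemma localBound_kept_large {p : ℝ} (hp : 0 ≤ p) (hp1 : p ≤ 1) (k : ℕ) {s : ℕ} {η : ℝ}
    (hη : 0 ≤ η) (hs : Sparse n d s η) :
    LocalBound (n := n) (d := d) p (fun S x => x ∈ covered S ∧ k + 2 < (comp S x.1).card) (k + 1) s
      (p * (1 - walkProb p d k (d - 1 + (d - 1))) + (k + 1 : ℕ) * η) := by
  intro s' hs' G hG C hC hGC x P Q hQ hP hx
  have hw := sub_nonneg.2 (walkProb_le_one hp hp1 d k (d - 1 + (d - 1)))
  have := localBound_edge_aux hp hp1 (k := k) (α := 0)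
    (β := 1 - walkProb p d k (d - 1 + (d - 1))) le_rfl hw hη (hs.anti hη hs') hC hGC hQ hP hx
    (F := fun S => if x ∈ covered S ∧ k + 2 < (comp S x.1).card then G S else 0)
    (fun S => by
      split_ifs
      · exact le_rfl
      · exact hG S) (fun y _ _ => ?_) (fun y hE ha hc hc' => ?_)
  · rw [mul_zero, zero_add] at this
    convert this
  · refine (percSum_mono (G := fun _ => 0) hp hp1 fun M hM T hT => ?_).trans ?_
    · rw [if_neg]
      exact fun h => notMem_covered_closed hQ (hx x rfl) hM hT h.1
    · rw [percSum_const]; simp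
  · have := explore hp hp1 (u := fun k a => 1 - walkProb p d k a)
      (fun k a => sub_nonneg.2 (walkProb_le_one hp hp1 d k a))
      (walk_rec_compl p d) (E := fun S => k + 2 < (comp S x.1).card) hG hC hη
      (hs.anti hη hs') hGC (v := x.1) (K₁ := 0) (K₂ := k + 2)
      (fun k P Q V hE h1 h2 h3 h4 M hM T hT => hE.not_large h2 h3 h4 hM hT) k _ _ _
      hE (by omega) (by omega) (by omega)
    simp only [ha] at this
    refine (percSum_mono hp hp1 fun M hM T hT => ?_).trans this
    split_ifs with h1 h2
    · exact le_rfl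
    · exact absurd h1.2 h2
    · exact hG _
    · exact le_rfl

/-- The counterpart that bounds the matched points in large components from below. For a deleted
edge the event is certain, hence `α = 1`. -/
lemma localBound_closed_or_small {p : ℝ} (hp : 0 ≤ p) (hp1 : p ≤ 1) (hd : 0 < d) (K : ℕ)
    {s : ℕ} {η : ℝ} (hη : 0 ≤ η) (hs : Sparse n d s η) :
    LocalBound (n := n) (d := d) p (fun S x => x ∉ covered S ∨ (comp S x.1).card < K) (d * K + 1) s
      (1 - p + p * walkProb p d (d * K) (d - 1 + (d - 1)) + (d * K + 1 : ℕ) * η) := by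
  intro s' hs' G hG C hC hGC x P Q hQ hP hx
  have hle : ∀ S, (if x ∉ covered S ∨ (comp S x.1).card < K then G S else 0) ≤ G S := fun S => by
    split_ifs
    · exact le_rfl
    · exact hG S
  have hxc := hx x rfl
  have := localBound_edge_aux hp hp1 (k := d * K) (α := 1)
    (β := walkProb p d (d * K) (d - 1 + (d - 1))) zero_le_one (walkProb_nonneg hp hp1 d _ _) hη
    (hs.anti hη hs') hC hGC hQ hP hx
    (F := fun S => if x ∉ covered S ∨ (comp S x.1).card < K then G S else 0) hle
    (fun y _ _ => ?_) (fun y hE ha hc hc' => ?_)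
  · rw [mul_one] at this
    convert this
  · rw [mul_one]
    refine (percSum_mono hp hp1 fun M hM T hT => hle _).trans
      (hGC _ _ (hQ.trans (subset_insert _ _)) ?_)
    rw [card_insert_of_notMem (notMem_of_notMem_covered hxc)]
    omega
  · have := explore hp hp1 (u := walkProb p d) (walkProb_nonneg hp hp1 d)
      (fun k a => by rw [walkProb]) (E := fun S => (comp S x.1).card < K) hG hC hη
      (hs.anti hη hs') hGC (v := x.1) (K₁ := K) (K₂ := d * K + 2)
      (fun k P Q V hE h1 h2 h3 h4 M _ T _ => hE.not_small hd h1 h3 h4 T) (d * K) _ _ _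
      hE (by omega) (by omega) (by omega)
    rw [ha] at this
    refine (percSum_mono hp hp1 fun M hM T hT => ?_).trans this
    have hcov : x ∈ covered (insert s(x, y) Q ∪ T) :=
      mem_covered.2 ⟨s(x, y), mem_union_left _ (mem_insert_self _ _), Sym2.mem_mk_left _ _⟩
    split_ifs with h1 h2
    · exact le_rfl
    · exact absurd h1 (not_or.2 ⟨not_not.2 hcov, h2⟩)
    · exact hG _
    · exact le_rfl

open Classical in
/-- The number of points at which `E` occurs. -/
noncomputable def pointCount (E : Finset (Sym2 (Point n d)) → Point n d → Prop)
    (S : Finset (Sym2 (Point n d))) : ℕ := (univ.filter fun x => E S x).card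

lemma card_touched_points {s : ℕ} {η : ℝ} (hη : 0 ≤ η) (hs : Sparse n d s η)
    {P : Finset (Sym2 (Point n d))} (hP : P.card ≤ s) :
    ((touched P ∅).card : ℝ) ≤ η * (n * d : ℕ) := by
  have h1 : (touched P ∅).card ≤ d * (3 * s + 1) :=
    (card_touched_le P ∅).trans (Nat.mul_le_mul_left _ (by rw [card_empty]; omega))
  have h2 : ((touched P ∅).card : ℝ) ≤ d * (3 * s + 1) := by exact_mod_cast h1
  have h3 : (0 : ℝ) ≤ s := Nat.cast_nonneg s
  unfold Sparse at hs
  nlinarith [mul_nonneg hη h3]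

/-- One factor of the power is written as a sum of indicators over the points, and `LocalBound` is
applied with the remaining power as the weight `G`, which the induction hypothesis controls. Points
that `P` touches get the trivial bound; they are a share `η` of all points and turn `q` into `q +
η`. Each factor uses up `k` of the `s` edges. -/
lemma moment_le {p : ℝ} (hp : 0 ≤ p) (hp1 : p ≤ 1)
    {E : Finset (Sym2 (Point n d)) → Point n d → Prop} {k s : ℕ} {q η : ℝ} (hq : 0 ≤ q)
    (hη : 0 ≤ η) (hs : Sparse n d s η) (hE : LocalBound p E k s q) (r : ℕ) :
    ∀ P Q, Q ⊆ P → P.card + k * r ≤ s →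
      percSum p P Q (fun S => (pointCount E S : ℝ) ^ r) ≤
        ((q + η) * (n * d : ℕ)) ^ r * extCount P := by
  classical
  induction r with
  | zero => intro P Q _ _; simp [percSum_const]
  | succ r ih =>
    intro P Q hQ hP
    have hC : 0 ≤ ((q + η) * (n * d : ℕ)) ^ r := by positivity
    have h1 : (fun S => (pointCount E S : ℝ) ^ (r + 1)) =
        fun S => ∑ x, if E S x then (pointCount E S : ℝ) ^ r else 0 := by
      funext S
      rw [← sum_filter, sum_const, nsmul_eq_mul, pow_succ, mul_comm]
      congr!
    rw [h1, percSum_sum]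
    have hk : k * (r + 1) = k * r + k := by ring
    have hG : ∀ S : Finset (Sym2 (Point n d)), 0 ≤ (pointCount E S : ℝ) ^ r := fun S => by
      positivity
    have hGC : ∀ P Q : Finset (Sym2 (Point n d)), Q ⊆ P → P.card ≤ s - k * r →
        percSum p P Q (fun S => (pointCount E S : ℝ) ^ r) ≤
        ((q + η) * (n * d : ℕ)) ^ r * extCount P := fun P Q hQP h => ih P Q hQP (by omega)
    have hm := mul_nonneg hC (extCount_nonneg P)
    have h2 : ∀ x ∈ (univ : Finset (Point n d)),
        percSum p P Q (fun S => if E S x then (pointCount E S : ℝ) ^ r else 0) ≤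
        ((q + η) * (n * d : ℕ)) ^ r * extCount P * q +
          if x ∈ touched P ∅ then ((q + η) * (n * d : ℕ)) ^ r * extCount P else 0 := by
      intro x _
      split_ifs with hx
      · refine (percSum_mono hp hp1 fun M _ T _ => ?_).trans ((hGC P Q hQ (by omega)).trans
          (le_add_of_nonneg_left (mul_nonneg hm hq)))
        split_ifs
        · exact le_rfl
        · exact hG _
      · rw [add_zero]
        refine hE (s - k * r) (Nat.sub_le _ _) _ hG _ hC hGC x P Q hQ (by omega)
          (notMem_touched.1 hx).2
    refine (sum_le_sum h2).trans ?_
    rw [sum_add_distrib, sum_const, ← sum_filter, sum_const, nsmul_eq_mul, nsmul_eq_mul,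
      filter_mem_eq_inter, univ_inter, card_univ, Fintype.card_prod, Fintype.card_fin,
      Fintype.card_fin]
    have := mul_le_mul_of_nonneg_right (card_touched_points hη hs (P := P) (by omega)) hm
    calc _ ≤ ((n * d : ℕ) : ℝ) * (((q + η) * (n * d : ℕ)) ^ r * extCount P * q) +
          η * (n * d : ℕ) * (((q + η) * (n * d : ℕ)) ^ r * extCount P) := by linarith
      _ = _ := by ring

open Classical in
-- Markov's inequality for the `r`-th power; the gap between `q + η` and `q + 2 * η` gives a
-- geometric factor.
lemma tail_le {p : ℝ} (hp : 0 ≤ p) (hp1 : p ≤ 1)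
    {E : Finset (Sym2 (Point n d)) → Point n d → Prop} {k s : ℕ} {q η : ℝ} (hq : 0 ≤ q)
    (hη : 0 < η) (hs : Sparse n d s η) (hE : LocalBound p E k s q) {r : ℕ} (hr : k * r ≤ s)
    (hN : 0 < n * d) :
    percSum p ∅ ∅ (fun S => if (q + 2 * η) * (n * d : ℕ) ≤ pointCount E S then 1 else 0) ≤
      ((q + η) / (q + 2 * η)) ^ r * extCount (∅ : Finset (Sym2 (Point n d))) := by
  have hN' : (0 : ℝ) < (n * d : ℕ) := by exact_mod_cast hN
  have ha : 0 < (q + 2 * η) * (n * d : ℕ) := by positivity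
  have h := moment_le hp hp1 hq hη.le hs hE r ∅ ∅ Subset.rfl (by simpa using hr)
  calc _ ≤ percSum p ∅ ∅ (fun S => (1 / ((q + 2 * η) * (n * d : ℕ)) ^ r) *
        (pointCount E S : ℝ) ^ r) := by
        refine percSum_mono hp hp1 fun M _ T _ => ?_
        split_ifs with h
        · rw [one_div, inv_mul_eq_div, ← div_pow]
          exact one_le_pow₀ ((one_le_div ha).2 h)
        · positivity
    _ ≤ (1 / ((q + 2 * η) * (n * d : ℕ)) ^ r) *
        (((q + η) * (n * d : ℕ)) ^ r * extCount (∅ : Finset (Sym2 (Point n d)))) := by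
        rw [percSum_mul_left]
        exact mul_le_mul_of_nonneg_left h (by positivity)
    _ = _ := by
        rw [← mul_assoc, mul_pow, mul_pow, div_pow]
        field_simp

end Moments

open Classical in
/-- Exponential tail bound for the number of points at which a local event occurs. -/
theorem exists_tail_bound {d : ℕ} (hd : 0 < d) {p : ℝ} (hp : 0 ≤ p) (hp1 : p ≤ 1)
    (E : ∀ n, Finset (Sym2 (Point n d)) → Point n d → Prop) {k : ℕ} {q : ℝ} (hq : 0 ≤ q)
    (hE : ∀ n s η, 0 ≤ η → Sparse n d s η → LocalBound p (E n) k s (q + k * η)) {ε : ℝ}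
    (hε : 0 < ε) :
    ∃ c : ℝ, 0 < c ∧ ∃ n₀ : ℕ, ∀ n ≥ n₀,
      percSum p ∅ ∅ (fun S => if (q + ε) * (n * d : ℕ) ≤ pointCount (E n) S then 1 else 0) ≤
        Real.exp (-c * n) * extCount (∅ : Finset (Sym2 (Point n d))) := by
  have hd' : (0 : ℝ) < d := by exact_mod_cast hd
  -- The error of the local bound is `k * η` and the tail bound needs `2 * η` more, which makes `ε`
  -- in total.
  set η : ℝ := ε / (k + 2) with hηdef
  have hk : (0 : ℝ) < k + 2 := by positivity
  have hη : 0 < η := by positivity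
  have hηε : (k + 2) * η = ε := by rw [hηdef]; field_simp
  -- With `s = k * r`, the coefficient of `r` in `Sparse`, plus 1 for positivity. The choice of `ρ`
  -- gives half of `η * d * n` to this term, and large `n` absorbs the constant terms in the other
  -- half.
  set D : ℝ := 3 * d * k + 2 * k * η + 1 with hD
  have hDpos : 0 < D := by positivity
  set ρ : ℝ := η * d / (2 * D) with hρdef
  have hρ : 0 < ρ := by positivity
  have hρD : ρ * D = η * d / 2 := by rw [hρdef]; field_simp
  set R : ℝ := (q + k * η + η) / (q + k * η + 2 * η) with hR
  have hR0 : 0 < R := by positivity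
  have hR1 : R < 1 := by rw [hR, div_lt_one (by positivity)]; linarith
  have hlog : Real.log R < 0 := Real.log_neg hR0 hR1
  refine ⟨-(ρ / 2) * Real.log R, by nlinarith, ⌈2 / ρ⌉₊ + ⌈2 * (d + η) / (η * d)⌉₊ + 1,
    fun n hn => ?_⟩
  have hn1 : 2 / ρ ≤ n := (Nat.le_ceil _).trans (by exact_mod_cast (by omega))
  have hn2 : 2 * (d + η) / (η * d) ≤ n := (Nat.le_ceil _).trans (by exact_mod_cast (by omega))
  rw [div_le_iff₀ (by positivity)] at hn1 hn2
  -- The order of the moment is linear in `n`, so the geometric factor is exponential in `n`.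
  set r : ℕ := ⌊ρ * n⌋₊ with hr
  have hr1 : (r : ℝ) ≤ ρ * n := Nat.floor_le (by positivity)
  have hr2 : ρ / 2 * n ≤ r := by
    have := (Nat.lt_floor_add_one (ρ * n)).le
    rw [← hr] at this
    linarith
  have hs : Sparse n d (k * r) η := by
    unfold Sparse
    push_cast
    have h1 : (r : ℝ) * D ≤ ρ * n * D := mul_le_mul_of_nonneg_right hr1 hDpos.le
    have h2 : ρ * n * D = η * d / 2 * n := by rw [← hρD]; ring
    have h3 : (0 : ℝ) ≤ r := Nat.cast_nonneg r
    rw [h2, hD] at h1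
    nlinarith
  have hN : 0 < n * d := Nat.mul_pos (by omega) hd
  have h := tail_le hp hp1 (by positivity) hη hs (hE n _ η hη.le hs) le_rfl hN
  have h1 : q + k * η + 2 * η = q + ε := by rw [← hηε]; ring
  rw [h1] at h
  refine h.trans (mul_le_mul_of_nonneg_right ?_ (extCount_nonneg _))
  rw [← h1, ← hR, ← Real.exp_log (pow_pos hR0 r), Real.log_pow]
  refine Real.exp_le_exp.2 ?_
  nlinarith

/-! ### Crossing edges and sprinkling -/

section Matching

variable {X : Type*} [Fintype X] [DecidableEq X]

lemma IsPerfect.two_mul_card {M : Finset (Sym2 X)} (hM : IsPerfect M) :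
    2 * M.card = Fintype.card X := by
  have h1 : (univ : Finset X) = M.biUnion fun e => e.toFinset := by
    ext x
    obtain ⟨e, ⟨he, hx⟩, -⟩ := hM.2 x
    simp only [mem_univ, mem_biUnion, Sym2.mem_toFinset, true_iff]
    exact ⟨e, he, hx⟩
  rw [← card_univ, h1, card_biUnion, sum_const_nat (m := 2), mul_comm]
  · intro e he
    exact Sym2.card_toFinset_of_not_isDiag e (hM.1 e he)
  · intro e he f hf hef
    refine disjoint_left.2 fun x hx hx' => hef ?_
    exact hM.eq_of_mem he hf (Sym2.mem_toFinset.1 hx) (Sym2.mem_toFinset.1 hx')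

/-- The edges in `A` between `U` and `W`. -/
def crossing (U W : Finset X) (A : Finset (Sym2 X)) : Finset (Sym2 X) :=
  A.filter fun e => ∃ x ∈ U, ∃ y ∈ W, e = s(x, y)

lemma card_crossing_insert_le {U W : Finset X} {A : Finset (Sym2 X)} {x y : X} (hx : x ∈ U)
    (hy : y ∈ W) (hA : s(x, y) ∉ A) :
    (crossing U W A).card + 1 ≤ (crossing U W (insert s(x, y) A)).card := by
  have : s(x, y) ∉ crossing U W A := fun h => hA (mem_filter.1 h).1
  rw [← card_insert_of_notMem this]
  refine card_le_card (insert_subset ?_ (filter_subset_filter _ (subset_insert _ _)))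
  exact mem_filter.2 ⟨mem_insert_self _ _, x, hx, y, hy, rfl⟩

/-- A random matching has few crossing edges only with exponentially small probability. -/
lemma sum_pow_crossing_le {z : ℝ} (hz : 0 ≤ z) (hz1 : z ≤ 1) {U W : Finset X}
    (hUW : Disjoint U W) {w : ℕ} (j : ℕ) : ∀ P : Finset (Sym2 X),
    2 * j ≤ (U \ covered P).card → w + j ≤ (W \ covered P).card →
    ∑ M ∈ extensions P, z ^ (crossing U W (M \ P)).card ≤
      (1 - (1 - z) * (w / Fintype.card X)) ^ j * extCount P := by
  induction j with
  | zero =>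
    intro P _ _
    rw [pow_zero, one_mul, extCount, ← nsmul_one, ← sum_const]
    exact sum_le_sum fun M _ => pow_le_one₀ hz hz1
  | succ j ih =>
    intro P hU hW
    have hN : 0 < (Fintype.card X : ℝ) := by
      have : (U \ covered P).card ≤ Fintype.card X := card_le_univ _
      exact_mod_cast (by omega)
    set κ : ℝ := 1 - (1 - z) * (w / Fintype.card X) with hκ
    have hκ0 : 0 ≤ κ := by
      have h1 : (w : ℝ) / Fintype.card X ≤ 1 := by
        rw [div_le_one hN]
        have : (W \ covered P).card ≤ Fintype.card X := card_le_univ _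
        exact_mod_cast (by omega)
      have h2 : (0 : ℝ) ≤ w / Fintype.card X := by positivity
      nlinarith
    -- The partner of one unmatched point of `U` is revealed: if it lies in `W`, a factor `z` is
    -- gained.
    obtain ⟨x, hx⟩ : (U \ covered P).Nonempty := card_pos.1 (by omega)
    obtain ⟨hxU, hxP⟩ := mem_sdiff.1 hx
    rw [sum_extensions_eq _ hxP]
    have h1 : ∀ y ∈ free P x, ∑ M ∈ extensions (insert s(x, y) P),
        z ^ (crossing U W (M \ P)).card ≤ (if y ∈ W then z else 1) *
          (κ ^ j * extCount (insert s(x, y) P)) := by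
      intro y hy
      have h2 : ∀ V : Finset X, V \ covered P ⊆
          insert x (insert y (V \ covered (insert s(x, y) P))) := by
        intro V v hv
        rw [mem_sdiff] at hv
        simp only [covered_insert, mem_insert, mem_sdiff, not_or]
        tauto
      have h3 := (card_le_card (h2 U)).trans ((card_insert_le _ _).trans
        (Nat.add_le_add_right (card_insert_le _ _) 1))
      -- A step takes at most two points from `U`, but only `y` can be lost from `W`; hence the
      -- requirements `2 * j` and `w + j`.
      have h4 : W \ covered P ⊆ insert y (W \ covered (insert s(x, y) P)) := by
        intro v hv
        rcases mem_insert.1 (h2 W hv) with rfl | h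
        · exact absurd (mem_sdiff.1 hv).1 (disjoint_left.1 hUW hxU)
        · exact h
      have h5 := (card_le_card h4).trans (card_insert_le _ _)
      refine le_trans ?_ (mul_le_mul_of_nonneg_left
        (ih (insert s(x, y) P) (by omega) (by omega)) (by split_ifs <;> linarith))
      rw [mul_sum]
      refine sum_le_sum fun M hM => ?_
      have he : s(x, y) ∈ M := (mem_extensions.1 hM).2 (mem_insert_self _ _)
      have heP : s(x, y) ∉ P := notMem_of_notMem_covered hxP
      have hMP : M \ P = insert s(x, y) (M \ insert s(x, y) P) := by
        ext e; simp only [mem_sdiff, mem_insert]; by_cases h : e = s(x, y)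
        · subst h; simp [he, heP]
        · simp [h]
      rw [hMP]
      split_ifs with hyW
      · rw [← pow_succ']
        exact pow_le_pow_of_le_one hz hz1 (card_crossing_insert_le hxU hyW (by simp))
      · rw [one_mul]
        exact pow_le_pow_of_le_one hz hz1
          (card_le_card (filter_subset_filter _ (subset_insert _ _)))
    refine (sum_le_sum h1).trans ?_
    rcases (free P x).eq_empty_or_nonempty with h0 | ⟨y₀, hy₀⟩
    · rw [h0, sum_empty]
      exact mul_nonneg (pow_nonneg hκ0 _) (extCount_nonneg _)
    set m := extCount (insert s(x, y₀) P) with hm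
    have hm0 : 0 ≤ m := extCount_nonneg _
    have h6 : ∀ y ∈ free P x, (if y ∈ W then z else 1) *
          (κ ^ j * extCount (insert s(x, y) P)) =
          κ ^ j * m - if y ∈ W then (1 - z) * (κ ^ j * m) else 0 := by
      intro y hy
      rw [le_antisymm (extCount_insert_le hy hy₀) (extCount_insert_le hy₀ hy)]
      split_ifs <;> ring
    rw [sum_congr rfl h6, sum_sub_distrib, ← sum_filter, sum_const, sum_const, nsmul_eq_mul,
      nsmul_eq_mul, ← card_free_mul_extCount hxP hy₀, ← hm]
    have h7 : W \ covered P ⊆ (free P x).filter (· ∈ W) := by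
      intro v hv
      rw [mem_sdiff] at hv
      refine mem_filter.2 ⟨mem_free.2 ⟨hv.2, ?_⟩, hv.1⟩
      rintro rfl
      exact disjoint_left.1 hUW hxU hv.1
    have h8 : (w : ℝ) ≤ ((free P x).filter (· ∈ W)).card := by
      have := card_le_card h7
      exact_mod_cast (by omega)
    have h9 : ((free P x).card : ℝ) ≤ Fintype.card X := by exact_mod_cast card_le_univ _
    -- The partner falls into `W` with probability at least `w` over the number of points, so one
    -- step costs the factor `κ`.
    have h10 : (w : ℝ) / Fintype.card X * (free P x).card ≤ ((free P x).filter (· ∈ W)).card := by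
      rw [div_mul_eq_mul_div, div_le_iff₀ hN]
      exact mul_le_mul h8 h9 (Nat.cast_nonneg _) (Nat.cast_nonneg _)
    have h11 : 0 ≤ (1 - z) * (κ ^ j * m) :=
      mul_nonneg (by linarith) (mul_nonneg (pow_nonneg hκ0 _) hm0)
    have h12 := mul_le_mul_of_nonneg_right h10 h11
    rw [pow_succ]
    calc _ ≤ (free P x).card * (κ ^ j * m) -
          (w : ℝ) / Fintype.card X * (free P x).card * ((1 - z) * (κ ^ j * m)) := by linarith
      _ = _ := by rw [hκ]; ring

/-- The percolated edges avoid the crossing ones. -/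
lemma sum_powerset_crossing_eq_empty {a b : ℝ} (hab : a + b ≠ 0) (U W : Finset X)
    (A : Finset (Sym2 X)) :
    ∑ T ∈ A.powerset with crossing U W T = ∅, a ^ T.card * b ^ (A \ T).card =
      (a + b) ^ A.card * (b / (a + b)) ^ (crossing U W A).card := by
  have h1 : A.powerset.filter (fun T => crossing U W T = ∅) = (A \ crossing U W A).powerset := by
    ext T
    simp only [mem_filter, mem_powerset]
    constructor
    · rintro ⟨hT, h0⟩ e he
      refine mem_sdiff.2 ⟨hT he, fun hc => ?_⟩
      have : e ∈ crossing U W T := mem_filter.2 ⟨he, (mem_filter.1 hc).2⟩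
      simp [h0] at this
    · refine fun h => ⟨h.trans sdiff_subset, eq_empty_of_forall_notMem fun e he => ?_⟩
      have h2 := mem_filter.1 he
      exact (mem_sdiff.1 (h h2.1)).2 (mem_filter.2 ⟨(mem_sdiff.1 (h h2.1)).1, h2.2⟩)
  have hsub : crossing U W A ⊆ A := filter_subset _ _
  have h2 : ∀ T ∈ (A \ crossing U W A).powerset, a ^ T.card * b ^ (A \ T).card =
      b ^ (crossing U W A).card * (a ^ T.card * b ^ ((A \ crossing U W A) \ T).card) := by
    intro T hT
    rw [mem_powerset] at hT
    have hc := card_le_card hT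
    have hc' := card_le_card hsub
    rw [card_sdiff_of_subset hsub] at hc
    rw [card_sdiff_of_subset hT, card_sdiff_of_subset (hT.trans sdiff_subset),
      card_sdiff_of_subset hsub]
    have : A.card - T.card = (crossing U W A).card + (A.card - (crossing U W A).card - T.card) := by
      omega
    rw [this, pow_add]
    ring
  rw [h1, sum_congr rfl h2, ← mul_sum, sum_powerset_pow, div_pow,
    ← card_sdiff_add_card_eq_card hsub, pow_add]
  field_simp

/-- Summing over the sets between `A` and `M`. -/
lemma sum_powerset_superset {A M : Finset (Sym2 X)} (hA : A ⊆ M) (F : Finset (Sym2 X) → ℝ) :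
    ∑ S ∈ M.powerset with A ⊆ S, F S = ∑ T ∈ (M \ A).powerset, F (A ∪ T) := by
  refine sum_nbij' (fun S => S \ A) (fun T => A ∪ T) ?_ ?_ ?_ ?_ ?_
  · intro S hS
    rw [mem_filter, mem_powerset] at hS
    exact mem_powerset.2 (sdiff_subset_sdiff hS.1 Subset.rfl)
  · intro T hT
    rw [mem_powerset] at hT
    exact mem_filter.2 ⟨mem_powerset.2 (union_subset hA (hT.trans sdiff_subset)), subset_union_left⟩
  · intro S hS
    exact union_sdiff_of_subset (mem_filter.1 hS).2
  · intro T hT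
    rw [mem_powerset] at hT
    rw [union_sdiff_left, Finset.sdiff_eq_self_iff_disjoint]
    exact (disjoint_of_subset_left hT sdiff_disjoint)
  · intro S hS
    rw [union_sdiff_of_subset (mem_filter.1 hS).2]

lemma sum_superset_pow {p : ℝ} {A M : Finset (Sym2 X)} (hA : A ⊆ M) :
    ∑ S ∈ M.powerset with A ⊆ S, p ^ S.card * (1 - p) ^ (M \ S).card = p ^ A.card := by
  rw [sum_powerset_superset hA]
  have : ∀ T ∈ (M \ A).powerset, p ^ (A ∪ T).card * (1 - p) ^ (M \ (A ∪ T)).card =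
      p ^ A.card * (p ^ T.card * (1 - p) ^ ((M \ A) \ T).card) := by
    intro T hT
    have hd : Disjoint A T :=
      disjoint_of_subset_right (mem_powerset.1 hT) disjoint_sdiff
    rw [card_union_of_disjoint hd, sdiff_sdiff_left, pow_add, mul_assoc]
    rfl
  rw [sum_congr rfl this, ← mul_sum, sum_powerset_pow]
  simp

lemma percSum_empty (p : ℝ) (F : Finset (Sym2 X) → ℝ) : percSum p ∅ ∅ F =
    ∑ M ∈ extensions ∅, ∑ S ∈ M.powerset, p ^ S.card * (1 - p) ^ (M \ S).card * F S := by
  simp [percSum]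

lemma sum_extensions_powerset (f : Finset (Sym2 X) → Finset (Sym2 X) → ℝ) :
    ∑ M ∈ extensions (∅ : Finset (Sym2 X)), ∑ S ∈ M.powerset, f M S =
      ∑ S, ∑ M ∈ extensions S, f M S := by
  refine sum_comm' fun M S => ?_
  simp [mem_extensions]

/-- Percolation with probability `p` as percolation with probability `p'`, followed by
sprinkling. -/
lemma percSum_sprinkle {p p' : ℝ} (hp' : 0 ≤ p') (hpp : p' ≤ p) (hp1 : p ≤ 1)
    {F F₁ F₂ : Finset (Sym2 X) → ℝ} {F₃ : Finset (Sym2 X) → Finset (Sym2 X) → ℝ}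
    (hF : ∀ M ∈ extensions (∅ : Finset (Sym2 X)), ∀ S ⊆ M, ∀ S' ⊆ S,
      F S ≤ F₁ S + F₂ S' + F₃ S' (S \ S')) :
    percSum p ∅ ∅ F ≤ percSum p ∅ ∅ F₁ + percSum p' ∅ ∅ F₂ +
      ∑ S', p' ^ S'.card * ∑ M ∈ extensions S', ∑ T ∈ (M \ S').powerset,
        (p - p') ^ T.card * (1 - p) ^ ((M \ S') \ T).card * F₃ S' T := by
  have hq : 0 ≤ 1 - p := by linarith
  have hr : 0 ≤ p - p' := by linarith
  -- Each kept edge is kept either at the first level, with weight `p'`, or by sprinkling, with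
  -- weight `p - p'`.
  have hsplit : ∀ S : Finset (Sym2 X),
      p ^ S.card = ∑ S' ∈ S.powerset, p' ^ S'.card * (p - p') ^ (S \ S').card := fun S => by
    rw [sum_powerset_pow]; ring
  have hswap : ∀ (M : Finset (Sym2 X)) (g : Finset (Sym2 X) → Finset (Sym2 X) → ℝ),
      ∑ S ∈ M.powerset, ∑ S' ∈ S.powerset,
        p' ^ S'.card * (p - p') ^ (S \ S').card * (1 - p) ^ (M \ S).card * g S' (S \ S') =
      ∑ S' ∈ M.powerset, ∑ T ∈ (M \ S').powerset,
        p' ^ S'.card * ((p - p') ^ T.card * (1 - p) ^ ((M \ S') \ T).card * g S' T) := by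
    intro M g
    rw [sum_comm' (s' := fun S' => M.powerset.filter (S' ⊆ ·)) (t' := M.powerset)]
    · refine sum_congr rfl fun S' hS' => ?_
      rw [sum_powerset_superset (mem_powerset.1 hS')]
      refine sum_congr rfl fun T hT => ?_
      have hd : Disjoint T S' :=
        disjoint_of_subset_left (mem_powerset.1 hT) sdiff_disjoint
      have h1 : (S' ∪ T) \ S' = T := by
        rw [union_sdiff_left, Finset.sdiff_eq_self_iff_disjoint]; exact hd
      have h2 : M \ (S' ∪ T) = (M \ S') \ T := by rw [sdiff_sdiff_left]; rfl
      rw [h1, h2]; ring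
    · intro S S'
      simp only [mem_powerset, mem_filter]
      exact ⟨fun ⟨h1, h2⟩ => ⟨⟨h1, h2⟩, h2.trans h1⟩, fun ⟨h, _⟩ => h⟩
  have e1 : percSum p ∅ ∅ F₁ = ∑ M ∈ extensions ∅, ∑ S ∈ M.powerset, ∑ S' ∈ S.powerset,
      p' ^ S'.card * (p - p') ^ (S \ S').card * (1 - p) ^ (M \ S).card * F₁ S := by
    rw [percSum_empty]
    refine sum_congr rfl fun M _ => sum_congr rfl fun S _ => ?_
    rw [hsplit S]
    simp_rw [sum_mul]
  have e2 : percSum p' ∅ ∅ F₂ = ∑ M ∈ extensions ∅, ∑ S ∈ M.powerset, ∑ S' ∈ S.powerset,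
      p' ^ S'.card * (p - p') ^ (S \ S').card * (1 - p) ^ (M \ S).card * F₂ S' := by
    rw [percSum_empty]
    refine sum_congr rfl fun M _ => ?_
    rw [hswap M fun S' _ => F₂ S']
    refine sum_congr rfl fun S' _ => ?_
    rw [← mul_sum, ← sum_mul, sum_powerset_pow]
    ring
  -- The first-level edges are summed on the outside: given `S'`, the matching runs over all
  -- extensions of `S'`, so the partners of the points outside `S'` are still random.
  have e3 : ∑ S', p' ^ S'.card * ∑ M ∈ extensions S', ∑ T ∈ (M \ S').powerset,
        (p - p') ^ T.card * (1 - p) ^ ((M \ S') \ T).card * F₃ S' T =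
      ∑ M ∈ extensions ∅, ∑ S ∈ M.powerset, ∑ S' ∈ S.powerset,
      p' ^ S'.card * (p - p') ^ (S \ S').card * (1 - p) ^ (M \ S).card * F₃ S' (S \ S') := by
    simp_rw [hswap, mul_sum]
    rw [sum_extensions_powerset]
  rw [e1, e2, e3, percSum_empty, ← sum_add_distrib, ← sum_add_distrib]
  refine sum_le_sum fun M hM => ?_
  rw [← sum_add_distrib, ← sum_add_distrib]
  refine sum_le_sum fun S hS => ?_
  rw [hsplit S, sum_mul, sum_mul, ← sum_add_distrib, ← sum_add_distrib]
  refine sum_le_sum fun S' hS' => ?_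
  rw [← mul_add, ← mul_add]
  exact mul_le_mul_of_nonneg_left (hF M hM S (mem_powerset.1 hS) S' (mem_powerset.1 hS'))
    (by positivity)

end Matching

/-! ### Unions of large components without connecting edges -/

section Cuts

variable {n d : ℕ}

/-- `U` is a union of components with at least `K` vertices. -/
def BigClosed (K : ℕ) (S : Finset (Sym2 (Point n d))) (U : Finset (Fin n)) : Prop :=
  (∀ u v, Joined S u v → u ∈ U → v ∈ U) ∧ ∀ v ∈ U, K ≤ (comp S v).card

lemma self_mem_comp (S : Finset (Sym2 (Point n d))) (v : Fin n) : v ∈ comp S v :=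
  mem_comp.2 Relation.ReflTransGen.refl

lemma comp_eq_of_reach {S : Finset (Sym2 (Point n d))} {v w : Fin n} (h : Reach S v w) :
    comp S v = comp S w := by
  ext u
  rw [mem_comp, mem_comp]
  exact ⟨fun hu => h.symm.trans hu, fun hu => h.trans hu⟩

lemma comp_mono {S S' : Finset (Sym2 (Point n d))} (h : S ⊆ S') (v : Fin n) :
    comp S v ⊆ comp S' v := fun _ hw => mem_comp.2 ((mem_comp.1 hw).mono h)

open Classical in
-- Such a set is determined by the components of size at least `K` that it contains, and there are
-- at most `n / K` of those.
lemma card_bigClosed_le {K : ℕ} (hK : 0 < K) (S : Finset (Sym2 (Point n d))) :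
    (univ.filter (BigClosed K S)).card ≤ 2 ^ (n / K) := by
  set B : Finset (Finset (Fin n)) :=
    (univ.filter fun v => K ≤ (comp S v).card).image (comp S) with hB
  have hcard : B.card ≤ n / K := by
    rw [Nat.le_div_iff_mul_le hK]
    have hdisj : (B : Set (Finset (Fin n))).PairwiseDisjoint id := by
      intro c hc c' hc' hne
      obtain ⟨v, -, rfl⟩ := mem_image.1 (mem_coe.1 hc)
      obtain ⟨v', -, rfl⟩ := mem_image.1 (mem_coe.1 hc')
      refine disjoint_left.2 fun u hu hu' => hne ?_
      rw [comp_eq_of_reach (mem_comp.1 hu), comp_eq_of_reach (mem_comp.1 hu')]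
    have h1 := card_biUnion hdisj
    have h2 : (B.biUnion id).card ≤ n := (card_le_univ _).trans_eq (Fintype.card_fin n)
    refine le_trans ?_ (h1.symm.le.trans h2)
    rw [← smul_eq_mul]
    refine card_nsmul_le_sum _ _ _ fun c hc => ?_
    obtain ⟨v, hv, rfl⟩ := mem_image.1 hc
    exact (mem_filter.1 hv).2
  refine le_trans ?_ (Nat.pow_le_pow_right (by norm_num) hcard)
  rw [← card_powerset]
  refine card_le_card_of_injOn (fun U => U.image (comp S)) (fun U hU => ?_) ?_
  · have hU' := (mem_filter.1 (mem_coe.1 hU)).2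
    refine mem_coe.2 (mem_powerset.2 fun c hc => ?_)
    obtain ⟨v, hv, rfl⟩ := mem_image.1 hc
    exact mem_image.2 ⟨v, mem_filter.2 ⟨mem_univ _, hU'.2 v hv⟩, rfl⟩
  · have key : ∀ U U' : Finset (Fin n), BigClosed K S U' → U.image (comp S) = U'.image (comp S) →
        U ⊆ U' := by
      intro U U' hU' h v hv
      obtain ⟨w, hw, hwv⟩ := mem_image.1 (h ▸ mem_image_of_mem (comp S) hv)
      have : v ∈ comp S w := hwv ▸ self_mem_comp S v
      exact (mem_comp.1 this).mem_of_closed hU'.1 hw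
    intro U hU U' hU' h
    exact Subset.antisymm (key U U' (mem_filter.1 (mem_coe.1 hU')).2 h)
      (key U' U (mem_filter.1 (mem_coe.1 hU)).2 h.symm)

/-- There are `L` vertices in large components with at most `g` unmatched points. -/
def Saturated (K L g : ℕ) (S : Finset (Sym2 (Point n d))) : Prop :=
  ∃ U, BigClosed K S U ∧ L ≤ U.card ∧ (active S U).card ≤ g

/-- The edges with an end in `U`. -/
def edgesAt (U : Finset (Fin n)) (A : Finset (Sym2 (Point n d))) : Finset (Sym2 (Point n d)) :=
  A.filter fun e => ∃ x ∈ points d U, x ∈ e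

lemma mem_edgesAt {U : Finset (Fin n)} {A : Finset (Sym2 (Point n d))} {e} :
    e ∈ edgesAt U A ↔ e ∈ A ∧ ∃ x ∈ points d U, x ∈ e := by simp [edgesAt]

/-- Each deleted edge at `U` has an end in `U` that no kept edge covers, and different edges have
different ends. -/
lemma card_edgesAt_sdiff_le {M S : Finset (Sym2 (Point n d))} (hM : IsPerfect M) (hS : S ⊆ M)
    (U : Finset (Fin n)) : (edgesAt U (M \ S)).card ≤ (active S U).card := by
  have h : ∀ e ∈ edgesAt U (M \ S), ∃ x ∈ points d U, x ∈ e := fun e he => (mem_edgesAt.1 he).2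
  rcases (edgesAt U (M \ S)).eq_empty_or_nonempty with h0 | ⟨e₀, he₀⟩
  · simp [h0]
  have : Nonempty (Point n d) := ⟨(h e₀ he₀).choose⟩
  choose! f hf using h
  refine card_le_card_of_injOn f (fun e he => ?_) (fun e he e' he' hee' => ?_)
  · have h1 := hf e he
    have h2 := mem_sdiff.1 (mem_edgesAt.1 he).1
    refine mem_coe.2 (mem_sdiff.2 ⟨h1.1, fun hc => ?_⟩)
    obtain ⟨e', he', hx⟩ := mem_covered.1 hc
    exact h2.2 (hM.eq_of_mem h2.1 (hS he') h1.2 hx ▸ he')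
  · have h1 := mem_sdiff.1 (mem_edgesAt.1 he).1
    have h2 := mem_sdiff.1 (mem_edgesAt.1 he').1
    exact hM.eq_of_mem h1.1 h2.1 (hf e he).2 (hee' ▸ (hf e' he').2)

lemma mul_card_le_edgesAt {M : Finset (Sym2 (Point n d))} (hM : IsPerfect M)
    (U : Finset (Fin n)) : d * U.card ≤ 2 * (edgesAt U M).card := by
  rw [← card_points]
  refine le_trans (card_le_card fun x hx => ?_) (card_covered_le (edgesAt U M))
  obtain ⟨e, ⟨he, hxe⟩, -⟩ := hM.2 x
  exact mem_covered.2 ⟨e, mem_edgesAt.2 ⟨he, x, hx, hxe⟩, hxe⟩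

open Classical in
-- The matching is fixed, and the union bound runs over the set `T` of deleted edges at `U` and then
-- over `U`. Given `T`, the set `U` is a union of large components of `M \ T`, which does not depend
-- on the percolation, so there are only `2 ^ (n / K)` choices. At least `j` edges at `U` outside
-- `T` must all be kept. The factors with `z` bound the number of sets `T`.
lemma sum_saturated_le {p z : ℝ} (hp : 0 ≤ p) (hp1 : p ≤ 1) (hz : 0 < z) (hz1 : z ≤ 1)
    {K L g j : ℕ} (hK : 0 < K) (hj : 2 * j + 2 * g ≤ d * L) {M : Finset (Sym2 (Point n d))}
    (hM : IsPerfect M) :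
    ∑ S ∈ M.powerset, p ^ S.card * (1 - p) ^ (M \ S).card * (if Saturated K L g S then 1 else 0) ≤
      z⁻¹ ^ g * (1 + z) ^ M.card * (2 ^ (n / K) * p ^ j) := by
  have hq : 0 ≤ 1 - p := by linarith
  set 𝒯 := M.powerset.filter fun T => T.card ≤ g with h𝒯
  set 𝒰 := fun T : Finset (Sym2 (Point n d)) =>
    (univ.filter (BigClosed K (M \ T))).filter fun U => L ≤ U.card with h𝒰
  have h1 : ∀ S ∈ M.powerset, (if Saturated K L g S then (1 : ℝ) else 0) ≤
      ∑ T ∈ 𝒯, ∑ U ∈ 𝒰 T, if edgesAt U (M \ T) ⊆ S then 1 else 0 := by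
    intro S hS
    rw [mem_powerset] at hS
    have hnn : ∀ T ∈ 𝒯, (0 : ℝ) ≤ ∑ U ∈ 𝒰 T, if edgesAt U (M \ T) ⊆ S then 1 else 0 :=
      fun T _ => sum_nonneg fun U _ => by split_ifs <;> norm_num
    split_ifs with h
    · obtain ⟨U, hU, hL, hg⟩ := h
      set T := edgesAt U (M \ S) with hT
      have hTM : T ⊆ M \ S := filter_subset _ _
      have hST : S ⊆ M \ T := fun e he =>
        mem_sdiff.2 ⟨hS he, fun h => (mem_sdiff.1 (hTM h)).2 he⟩
      have hsub : edgesAt U (M \ T) ⊆ S := by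
        intro e he
        obtain ⟨he1, he2⟩ := mem_edgesAt.1 he
        obtain ⟨he3, he4⟩ := mem_sdiff.1 he1
        by_contra heS
        exact he4 (mem_edgesAt.2 ⟨mem_sdiff.2 ⟨he3, heS⟩, he2⟩)
      have hT' : T ∈ 𝒯 := mem_filter.2 ⟨mem_powerset.2 (hTM.trans sdiff_subset),
        (card_edgesAt_sdiff_le hM hS U).trans hg⟩
      -- Passing from `S` to `M \ T` adds no edge at `U` and can only enlarge components.
      have hU' : U ∈ 𝒰 T := by
        refine mem_filter.2 ⟨mem_filter.2 ⟨mem_univ _, ?_, fun v hv => ?_⟩, hL⟩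
        · rintro _ _ ⟨x, y, hxy, rfl, rfl⟩ hx
          refine hU.1 _ _ ⟨x, y, hsub (mem_edgesAt.2 ⟨hxy, x, ?_, Sym2.mem_mk_left _ _⟩), rfl, rfl⟩
            hx
          exact mem_points.2 hx
        · exact (hU.2 v hv).trans (card_le_card (comp_mono hST v))
      refine le_trans ?_ (single_le_sum hnn hT')
      refine le_trans ?_ (single_le_sum (f := fun U => if edgesAt U (M \ T) ⊆ S then (1 : ℝ) else 0)
        (fun U _ => by split_ifs <;> norm_num) hU')
      exact (if_pos hsub).ge
    · exact sum_nonneg hnn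
  have h2 : ∀ T ∈ 𝒯, ∀ U ∈ 𝒰 T, ∑ S ∈ M.powerset, p ^ S.card * (1 - p) ^ (M \ S).card *
      (if edgesAt U (M \ T) ⊆ S then 1 else 0) ≤ p ^ j := by
    intro T hT U hU
    have hL := (mem_filter.1 hU).2
    have hTg := (mem_filter.1 hT).2
    simp_rw [mul_ite, mul_one, mul_zero]
    have h7 : edgesAt U (M \ T) ⊆ M := (filter_subset _ _).trans sdiff_subset
    have h8 := sum_superset_pow (p := p) h7
    rw [sum_filter] at h8
    refine (le_of_eq (Eq.trans (by congr!) h8)).trans ?_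
    refine pow_le_pow_of_le_one hp hp1 ?_
    have h3 := mul_card_le_edgesAt hM U
    have h4 : edgesAt U M ⊆ edgesAt U (M \ T) ∪ T := by
      intro e he
      by_cases heT : e ∈ T
      · exact mem_union_right _ heT
      · exact mem_union_left _ (mem_edgesAt.2 ⟨mem_sdiff.2 ⟨(mem_edgesAt.1 he).1, heT⟩,
          (mem_edgesAt.1 he).2⟩)
    have h5 := (card_le_card h4).trans (card_union_le _ _)
    have h6 := Nat.mul_le_mul_left d hL
    omega
  calc _ ≤ ∑ S ∈ M.powerset, p ^ S.card * (1 - p) ^ (M \ S).card *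
        ∑ T ∈ 𝒯, ∑ U ∈ 𝒰 T, (if edgesAt U (M \ T) ⊆ S then (1 : ℝ) else 0) :=
        sum_le_sum fun S hS => mul_le_mul_of_nonneg_left (h1 S hS) (by positivity)
    _ = ∑ T ∈ 𝒯, ∑ U ∈ 𝒰 T, ∑ S ∈ M.powerset, p ^ S.card * (1 - p) ^ (M \ S).card *
        (if edgesAt U (M \ T) ⊆ S then (1 : ℝ) else 0) := by
        simp_rw [mul_sum]
        rw [sum_comm]
        exact sum_congr rfl fun T _ => sum_comm
    _ ≤ ∑ T ∈ 𝒯, 2 ^ (n / K) * p ^ j := by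
        refine sum_le_sum fun T hT => (sum_le_sum (h2 T hT)).trans ?_
        rw [sum_const, nsmul_eq_mul]
        refine mul_le_mul_of_nonneg_right ?_ (pow_nonneg hp _)
        have := (card_le_card (filter_subset (fun U : Finset (Fin n) => L ≤ U.card) _)).trans
          (card_bigClosed_le hK (M \ T))
        exact_mod_cast this
    _ = (𝒯.card : ℝ) * (2 ^ (n / K) * p ^ j) := by rw [sum_const, nsmul_eq_mul]
    _ ≤ _ := by
        refine mul_le_mul_of_nonneg_right ?_ (by positivity)
        -- An exponential Markov bound for counting the sets with at most `g` elements.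
        have h3 : ∀ T ∈ 𝒯, (1 : ℝ) ≤ z⁻¹ ^ g * z ^ T.card := by
          intro T hT
          have hTg := (mem_filter.1 hT).2
          rw [inv_pow, inv_mul_eq_div, one_le_div (pow_pos hz g)]
          exact pow_le_pow_of_le_one hz.le hz1 hTg
        calc (𝒯.card : ℝ) = ∑ T ∈ 𝒯, (1 : ℝ) := by simp
          _ ≤ ∑ T ∈ 𝒯, z⁻¹ ^ g * z ^ T.card := sum_le_sum h3
          _ ≤ ∑ T ∈ M.powerset, z⁻¹ ^ g * z ^ T.card :=
              sum_le_sum_of_subset_of_nonneg (filter_subset _ _) fun T _ _ => by positivity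
          _ = _ := by
              have := sum_powerset_pow z 1 M
              simp only [one_pow, mul_one] at this
              rw [← mul_sum, this, add_comm z 1]

/-- There are two unions of large components of `S` with many unmatched points, between which `T`
has no edge. -/
def Separated (K g : ℕ) (S T : Finset (Sym2 (Point n d))) : Prop :=
  ∃ U W, BigClosed K S U ∧ BigClosed K S W ∧ Disjoint U W ∧ g ≤ (active S U).card ∧
    g ≤ (active S W).card ∧ crossing (active S U) (active S W) T = ∅

lemma disjoint_active {U W : Finset (Fin n)} (h : Disjoint U W) (S : Finset (Sym2 (Point n d))) :
    Disjoint (active S U) (active S W) :=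
  disjoint_left.2 fun _ hx hx' => disjoint_left.1 h (mem_active.1 hx).1 (mem_active.1 hx').1

open Classical in
-- Given `S`, there are at most `4 ^ (n / K)` pairs of unions of large components. An edge not kept
-- at the first level stays unsprinkled with conditional probability `z = (1 - p) / (1 - p')`, so
-- the chance that no crossing edge is sprinkled is the mean of `z` to the number of crossing edges
-- of the remaining random matching, and `sum_pow_crossing_le` applies.
lemma sum_separated_le {p p' : ℝ} (hp' : 0 ≤ p') (hpp : p' < p) (hp1 : p ≤ 1)
    {K g w j : ℕ} (hK : 0 < K) (hj : 2 * j ≤ g) (hw : w + j ≤ g) (hwN : w ≤ n * d) :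
    ∑ S : Finset (Sym2 (Point n d)), p' ^ S.card * ∑ M ∈ extensions S, ∑ T ∈ (M \ S).powerset,
      (p - p') ^ T.card * (1 - p) ^ ((M \ S) \ T).card * (if Separated K g S T then 1 else 0) ≤
      4 ^ (n / K) * (1 - (1 - (1 - p) / (1 - p')) * (w / (n * d : ℕ))) ^ j *
        extCount (∅ : Finset (Sym2 (Point n d))) := by
  have hq : 0 ≤ 1 - p := by linarith
  have hr : 0 ≤ p - p' := by linarith
  have hq' : 0 < 1 - p' := by linarith
  set z := (1 - p) / (1 - p') with hz
  have hz0 : 0 ≤ z := div_nonneg hq hq'.le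
  have hz1 : z ≤ 1 := by rw [hz, div_le_one hq']; linarith
  set κ := 1 - (1 - z) * (w / (n * d : ℕ)) with hκ
  have hN : (Fintype.card (Point n d) : ℝ) = (n * d : ℕ) := by simp
  set 𝒜 := fun S : Finset (Sym2 (Point n d)) =>
    ((univ.filter (BigClosed K S)) ×ˢ (univ.filter (BigClosed K S))).filter fun A =>
      Disjoint A.1 A.2 ∧ g ≤ (active S A.1).card ∧ g ≤ (active S A.2).card with h𝒜
  have h𝒜card : ∀ S, ((𝒜 S).card : ℝ) ≤ 4 ^ (n / K) := by
    intro S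
    have h1 := card_bigClosed_le hK S
    have h2 : (𝒜 S).card ≤ 2 ^ (n / K) * 2 ^ (n / K) := by
      refine (card_filter_le _ _).trans ?_
      rw [card_product]
      exact Nat.mul_le_mul h1 h1
    rw [← mul_pow] at h2
    exact_mod_cast h2
  have h1 : ∀ S T : Finset (Sym2 (Point n d)), (if Separated K g S T then (1 : ℝ) else 0) ≤
      ∑ A ∈ 𝒜 S, if crossing (active S A.1) (active S A.2) T = ∅ then 1 else 0 := by
    intro S T
    split_ifs with h
    · obtain ⟨U, W, hU, hW, hUW, h1, h2, h3⟩ := h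
      have hA : (U, W) ∈ 𝒜 S := by
        simp only [h𝒜, mem_filter, mem_product, mem_univ, true_and]
        exact ⟨⟨hU, hW⟩, hUW, h1, h2⟩
      refine le_trans ?_ (single_le_sum (f := fun A : Finset (Fin n) × Finset (Fin n) =>
        if crossing (active S A.1) (active S A.2) T = ∅ then (1 : ℝ) else 0)
        (fun U _ => by split_ifs <;> norm_num) hA)
      exact (if_pos h3).ge
    · exact sum_nonneg fun U _ => by split_ifs <;> norm_num
  have hb : ∀ S : Finset (Sym2 (Point n d)), ∑ M ∈ extensions S, ∑ T ∈ (M \ S).powerset,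
      (p - p') ^ T.card * (1 - p) ^ ((M \ S) \ T).card * (if Separated K g S T then 1 else 0) ≤
      ∑ M ∈ extensions S, 4 ^ (n / K) * κ ^ j * (1 - p') ^ (M \ S).card := by
    intro S
    -- All perfect matchings have the same size, so the power of `1 - p'` factors out of the sum
    -- over them.
    have hcard : ∀ M ∈ extensions S, (M \ S).card = n * d / 2 - S.card := by
      intro M hM
      have h2 := mem_extensions.1 hM
      have h3 := h2.1.two_mul_card
      rw [Fintype.card_prod, Fintype.card_fin, Fintype.card_fin] at h3
      rw [card_sdiff_of_subset h2.2]
      omega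
    calc _ ≤ ∑ M ∈ extensions S, ∑ T ∈ (M \ S).powerset,
          (p - p') ^ T.card * (1 - p) ^ ((M \ S) \ T).card *
            ∑ A ∈ 𝒜 S, (if crossing (active S A.1) (active S A.2) T = ∅ then (1 : ℝ) else 0) :=
          sum_le_sum fun M _ => sum_le_sum fun T _ =>
            mul_le_mul_of_nonneg_left (h1 S T) (by positivity)
      _ = ∑ A ∈ 𝒜 S, ∑ M ∈ extensions S, (1 - p') ^ (n * d / 2 - S.card) *
            z ^ (crossing (active S A.1) (active S A.2) (M \ S)).card := by
          simp_rw [mul_sum]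
          rw [sum_comm (s := 𝒜 S)]
          refine sum_congr rfl fun M hM => ?_
          rw [sum_comm]
          refine sum_congr rfl fun A _ => ?_
          have h2 := sum_powerset_crossing_eq_empty (a := p - p') (b := 1 - p)
            (by rw [sub_add_sub_cancel']; linarith) (active S A.1) (active S A.2) (M \ S)
          rw [sub_add_sub_cancel', hcard M hM] at h2
          simp_rw [mul_ite, mul_one, mul_zero]
          rw [← sum_filter, h2]
      _ ≤ ∑ A ∈ 𝒜 S, (1 - p') ^ (n * d / 2 - S.card) * (κ ^ j * extCount S) := by
          refine sum_le_sum fun A hA => ?_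
          simp only [h𝒜, mem_filter] at hA
          obtain ⟨-, h2, h3, h4⟩ := hA
          rw [← mul_sum]
          refine mul_le_mul_of_nonneg_left ?_ (by positivity)
          have hself : ∀ V, active S V \ covered S = active S V := fun V => by
            rw [active, sdiff_sdiff_left]; simp
          have := sum_pow_crossing_le hz0 hz1 (disjoint_active h2 S) (w := w) j S
            (by rw [hself]; omega) (by rw [hself]; omega)
          rwa [hN] at this
      _ ≤ ∑ M ∈ extensions S, 4 ^ (n / K) * κ ^ j * (1 - p') ^ (M \ S).card := by
          have hsum : ∑ M ∈ extensions S, 4 ^ (n / K) * κ ^ j * (1 - p') ^ (M \ S).card =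
              extCount S * (4 ^ (n / K) * κ ^ j * (1 - p') ^ (n * d / 2 - S.card)) := by
            rw [extCount, ← nsmul_eq_mul, ← sum_const]
            exact sum_congr rfl fun M hM => by rw [hcard M hM]
          rw [hsum, sum_const, nsmul_eq_mul]
          have hκ0 : 0 ≤ κ := by
            rcases Nat.eq_zero_or_pos (n * d) with h0 | h0
            · simp [hκ, h0]
            have h0' : (0 : ℝ) < (n * d : ℕ) := by exact_mod_cast h0
            have h2 : (w : ℝ) / (n * d : ℕ) ≤ 1 := by
              rw [div_le_one h0']
              exact_mod_cast hwN
            have h3 : (0 : ℝ) ≤ w / (n * d : ℕ) := by positivity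
            nlinarith
          have h4 := mul_le_mul_of_nonneg_right (h𝒜card S) (a := (1 - p') ^ (n * d / 2 - S.card) *
            (κ ^ j * extCount S))
            (mul_nonneg (by positivity) (mul_nonneg (pow_nonneg hκ0 _) (extCount_nonneg _)))
          exact h4.trans_eq (by ring)
  calc _ ≤ ∑ S : Finset (Sym2 (Point n d)), p' ^ S.card *
        ∑ M ∈ extensions S, 4 ^ (n / K) * κ ^ j * (1 - p') ^ (M \ S).card :=
        sum_le_sum fun S _ => mul_le_mul_of_nonneg_left (hb S) (by positivity)
    _ = 4 ^ (n / K) * κ ^ j * percSum (X := Point n d) p' ∅ ∅ fun _ => 1 := by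
        rw [percSum_empty, sum_extensions_powerset]
        simp_rw [mul_sum]
        exact sum_congr rfl fun S _ => sum_congr rfl fun M _ => by ring
    _ = _ := by rw [percSum_const, one_mul]

end Cuts

/-! ### From component statistics to the largest component -/

section Giant

variable {n d : ℕ}

lemma adj_project {S : Finset (Sym2 (Point n d))} {u v : Fin n} :
    (project S).Adj u v ↔ Joined S u v := by
  constructor
  · rintro ⟨e, he, h⟩
    induction e with
    | _ x y =>
      rw [Sym2.map_mk, Sym2.eq_iff] at h
      rcases h with ⟨h1, h2⟩ | ⟨h1, h2⟩
      · exact ⟨x, y, he, h1, h2⟩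
      · exact ⟨y, x, Sym2.eq_swap ▸ he, h2, h1⟩
  · rintro ⟨x, y, h, rfl, rfl⟩
    exact ⟨s(x, y), h, Sym2.map_mk ..⟩

lemma coe_comp (S : Finset (Sym2 (Point n d))) (v : Fin n) :
    (comp S v : Set (Fin n)) = {w | Relation.ReflTransGen (project S).Adj v w} := by
  have : (project S).Adj = Joined S := by
    funext u w
    exact propext adj_project
  ext w
  rw [mem_coe, mem_comp, this]
  rfl

lemma isComponent_iff {S : Finset (Sym2 (Point n d))} {C : Set (Fin n)} :
    IsComponent (project S) C ↔ ∃ v, C = comp S v := by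
  simp_rw [IsComponent, coe_comp]
  exact ⟨fun ⟨v, _, h⟩ => ⟨v, h⟩, fun ⟨v, h⟩ => ⟨v, Set.mem_univ _, h⟩⟩

lemma edgesWithin_comp (S : Finset (Sym2 (Point n d))) (v : Fin n) :
    edgesWithin (project S) (comp S v) = (edgesAt (comp S v) S : Set (Sym2 (Point n d))) := by
  ext e
  rw [mem_coe, mem_edgesAt]
  constructor
  · rintro ⟨he, h⟩
    refine ⟨he, ?_⟩
    induction e with
    | _ x y => exact ⟨x, mem_points.2 (h x.1 ⟨y.1, he, Sym2.map_mk ..⟩), Sym2.mem_mk_left _ _⟩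
  · rintro ⟨he, x, hx, y, rfl⟩
    refine ⟨he, ?_⟩
    rintro u ⟨w, -, h⟩
    rw [mem_points, mem_comp] at hx
    rw [Sym2.map_mk, Sym2.eq_iff] at h
    rcases h with ⟨rfl, -⟩ | ⟨-, rfl⟩
    · exact mem_comp.2 hx
    · exact mem_comp.2 (hx.tail ⟨x, y, he, rfl, rfl⟩)

/-- Both ends of a kept edge lie in the same component, so these edges pair up its covered points.
Counting edges is thereby reduced to counting points. -/
lemma two_mul_card_edgesAt {M S : Finset (Sym2 (Point n d))} (hM : IsPerfect M) (hS : S ⊆ M)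
    (v : Fin n) : 2 * (edgesAt (comp S v) S).card = (covered S ∩ points d (comp S v)).card := by
  have h1 : covered S ∩ points d (comp S v) =
      (edgesAt (comp S v) S).biUnion fun e => e.toFinset := by
    ext x
    simp only [mem_inter, mem_biUnion, Sym2.mem_toFinset, mem_edgesAt, mem_covered]
    constructor
    · rintro ⟨⟨e, he, hxe⟩, hx⟩
      exact ⟨e, ⟨he, x, hx, hxe⟩, hxe⟩
    · rintro ⟨e, ⟨he, y, hy, hye⟩, hxe⟩
      refine ⟨⟨e, he, hxe⟩, ?_⟩
      obtain ⟨z, rfl⟩ := hye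
      rw [mem_points, mem_comp] at hy ⊢
      rcases Sym2.mem_iff.1 hxe with rfl | rfl
      · exact hy
      · exact hy.tail ⟨y, x, he, rfl, rfl⟩
  rw [h1, card_biUnion, sum_const_nat (m := 2), mul_comm]
  · intro e he
    exact Sym2.card_toFinset_of_not_isDiag e (hM.1 e (hS (mem_edgesAt.1 he).1))
  · intro e he f hf hef
    refine disjoint_left.2 fun x hx hx' => hef ?_
    exact hM.eq_of_mem (hS (mem_edgesAt.1 he).1) (hS (mem_edgesAt.1 hf).1)
      (Sym2.mem_toFinset.1 hx) (Sym2.mem_toFinset.1 hx')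

/-- The vertices in components with at least `K` vertices. -/
noncomputable def bigVertices (K : ℕ) (S : Finset (Sym2 (Point n d))) : Finset (Fin n) :=
  univ.filter fun v => K ≤ (comp S v).card

lemma mem_bigVertices {K : ℕ} {S : Finset (Sym2 (Point n d))} {v : Fin n} :
    v ∈ bigVertices K S ↔ K ≤ (comp S v).card := by simp [bigVertices]

/-- The matched points of the vertices in components with at least `K` vertices. -/
noncomputable def bigPoints (K : ℕ) (S : Finset (Sym2 (Point n d))) : Finset (Point n d) :=
  covered S ∩ points d (bigVertices K S)

/-- If the vertices in large components cannot be split into two large separated parts, then nearly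
all of them are in one component. -/
lemma exists_comp_of_no_cut {S S' : Finset (Sym2 (Point n d))} (hS : S' ⊆ S) {K : ℕ} {L : ℝ}
    (hL : 0 < L) (hB : 3 * L ≤ (bigVertices K S').card)
    (hcut : ∀ U W, BigClosed K S' U → BigClosed K S' W → Disjoint U W →
      (∀ u ∈ U, ∀ w ∈ W, ¬ Joined S u w) → (U.card : ℝ) < L ∨ (W.card : ℝ) < L) :
    ∃ u ∈ bigVertices K S', ((bigVertices K S').card : ℝ) - L ≤ (comp S u).card := by
  classical
  set B := bigVertices K S' with hBdef
  have hbig : ∀ U ⊆ B, (∀ u ∈ U, ∀ v ∈ B, Reach S u v → v ∈ U) → BigClosed K S' U := by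
    refine fun U hU h => ⟨fun u v huv hu => ?_, fun v hv => mem_bigVertices.1 (hU hv)⟩
    have hr : Reach S' u v := Relation.ReflTransGen.single huv
    refine h u hu v ?_ (hr.mono hS)
    rw [hBdef, mem_bigVertices, ← comp_eq_of_reach hr]
    exact mem_bigVertices.1 (hU hu)
  -- A smallest set that is closed under `S`-connection within `B` and has at least `L` elements.
  -- Its complement in `B` is small because there is no large cut.
  set 𝒰 : Finset (Finset (Fin n)) := B.powerset.filter fun U =>
    (∀ u ∈ U, ∀ v ∈ B, Reach S u v → v ∈ U) ∧ L ≤ U.card with h𝒰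
  have hne : 𝒰.Nonempty := ⟨B, mem_filter.2 ⟨mem_powerset_self _, fun _ _ _ h _ => h,
    by linarith⟩⟩
  obtain ⟨U, hU, hmin⟩ := exists_min_image 𝒰 card hne
  obtain ⟨hUB, hsat, hUL⟩ := mem_filter.1 hU
  rw [mem_powerset] at hUB
  have hW : ((B \ U).card : ℝ) < L := by
    refine (hcut U (B \ U) (hbig U hUB hsat) (hbig _ sdiff_subset fun u hu v hv huv => ?_)
      disjoint_sdiff fun u hu w hw huw => ?_).resolve_left (not_lt.2 hUL)
    · exact mem_sdiff.2 ⟨hv, fun hvU =>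
        (mem_sdiff.1 hu).2 (hsat v hvU u (mem_sdiff.1 hu).1 huv.symm)⟩
    · exact (mem_sdiff.1 hw).2 (hsat u hu w (mem_sdiff.1 hw).1 (Relation.ReflTransGen.single huw))
  have hcard : ((B \ U).card : ℝ) + U.card = B.card := by
    exact_mod_cast card_sdiff_add_card_eq_card hUB
  obtain ⟨u, hu⟩ : U.Nonempty := card_pos.1 (by
    have : (0 : ℝ) < U.card := hL.trans_le hUL
    exact_mod_cast this)
  refine ⟨u, hUB hu, ?_⟩
  have hsub : U ⊆ comp S u := by
    by_contra hns
    obtain ⟨v, hvU, hvC⟩ := not_subset.1 hns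
    -- If `U` met several components of `S`, it would split into two proper closed parts, each below
    -- `L` by minimality; then `B` would have fewer than `3 * L` elements.
    have h1 : ∀ V ⊆ U, (∀ u ∈ V, ∀ v ∈ B, Reach S u v → v ∈ V) → V ≠ U → (V.card : ℝ) < L := by
      intro V hV hVs hVU
      by_contra hVL
      have := hmin V (mem_filter.2 ⟨mem_powerset.2 (hV.trans hUB), hVs, not_lt.1 hVL⟩)
      exact hVU (eq_of_subset_of_card_le hV this)
    have h2 := h1 (U ∩ comp S u) inter_subset_left (fun a ha b hb hab => ?_) (fun h => ?_)
    · have h3 := h1 (U \ comp S u) sdiff_subset (fun a ha b hb hab => ?_) (fun h => ?_)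
      · have h4 : ((U \ comp S u).card : ℝ) + (U ∩ comp S u).card = U.card := by
          exact_mod_cast card_sdiff_add_card_inter U (comp S u)
        linarith
      · rw [mem_sdiff] at ha ⊢
        exact ⟨hsat a ha.1 b hb hab, fun h => ha.2 (mem_comp.2 ((mem_comp.1 h).trans hab.symm))⟩
      · have h5 := h.symm ▸ hu
        exact (mem_sdiff.1 h5).2 (self_mem_comp S u)
    · rw [mem_inter] at ha ⊢
      exact ⟨hsat a ha.1 b hb hab, mem_comp.2 ((mem_comp.1 ha.2).trans hab)⟩
    · have h5 := h.symm ▸ hvU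
      exact hvC (mem_inter.1 h5).2
  have h6 : (U.card : ℝ) ≤ (comp S u).card := by exact_mod_cast card_le_card hsub
  linarith

/-- Component statistics and the absence of cuts determine the largest component. -/
lemma largest_component_bounds {M S S' : Finset (Sym2 (Point n d))} (hM : IsPerfect M)
    (hSM : S ⊆ M) (hS : S' ⊆ S) {K : ℕ} {χ κ η : ℝ} (hη : 0 < η) (hχ : 8 * η ≤ χ) (hn : 0 < n)
    (h1 : ((bigVertices K S).card : ℝ) ≤ (χ + η) * n)
    (h2 : (χ - 2 * η) * n ≤ (bigVertices K S').card)
    (h3 : ((bigPoints K S).card : ℝ) ≤ (κ + η) * (n * d : ℕ))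
    (h4 : (κ - η) * (n * d : ℕ) ≤ (bigPoints K S).card)
    (hcut : ∀ U W, BigClosed K S' U → BigClosed K S' W → Disjoint U W →
      (∀ u ∈ U, ∀ w ∈ W, ¬ Joined S u w) → (U.card : ℝ) < η * n ∨ (W.card : ℝ) < η * n)
    {C : Set (Fin n)} (hC : IsLargestComponent (project S) C) :
    |(C.ncard : ℝ) - χ * n| ≤ 3 * η * n ∧
      |2 * ((edgesWithin (project S) C).ncard : ℝ) - κ * (n * d : ℕ)| ≤ 5 * η * (n * d : ℕ) := by
  have hn' : (0 : ℝ) < n := by exact_mod_cast hn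
  have hηn : 0 < η * n := by positivity
  have hχn := mul_le_mul_of_nonneg_right hχ hn'.le
  obtain ⟨u, hu, hCu⟩ := exists_comp_of_no_cut hS hηn (by linarith) hcut
  obtain ⟨⟨v, rfl⟩, hmax⟩ := And.imp_left isComponent_iff.1 hC
  have hKu : K ≤ (comp S u).card := (mem_bigVertices.1 hu).trans (card_le_card (comp_mono hS u))
  have huv := hmax _ (isComponent_iff.2 ⟨u, rfl⟩)
  rw [Set.ncard_coe_finset, Set.ncard_coe_finset] at huv
  have hsub : ∀ w, K ≤ (comp S w).card → comp S w ⊆ bigVertices K S := fun w hw a ha =>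
    mem_bigVertices.2 (by rwa [← comp_eq_of_reach (mem_comp.1 ha)])
  -- Two distinct components of this size would need 2(χ - 3η)n ≤ (χ + η)n, against 8η ≤ χ.
  have hv : comp S v = comp S u := by
    by_contra hne
    have hd : Disjoint (comp S v) (comp S u) := disjoint_left.2 fun a ha ha' =>
      hne ((comp_eq_of_reach (mem_comp.1 ha)).trans (comp_eq_of_reach (mem_comp.1 ha')).symm)
    have h5 := card_le_card (union_subset (hsub v (hKu.trans huv)) (hsub u hKu))
    rw [card_union_of_disjoint hd] at h5
    have h6 : 2 * ((comp S u).card : ℝ) ≤ (bigVertices K S).card := by exact_mod_cast (by omega)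
    linarith
  have h5 : ((comp S v).card : ℝ) ≤ (bigVertices K S).card := by
    exact_mod_cast card_le_card (hsub v (hKu.trans huv))
  have h6 : (χ - 3 * η) * n ≤ (comp S v).card := by rw [hv]; linarith
  rw [edgesWithin_comp, Set.ncard_coe_finset, Set.ncard_coe_finset]
  have h7 : 2 * ((edgesAt (comp S v) S).card : ℝ) = (covered S ∩ points d (comp S v)).card := by
    exact_mod_cast two_mul_card_edgesAt hM hSM v
  have h8 : ((covered S ∩ points d (comp S v)).card : ℝ) ≤ (bigPoints K S).card := by
    have : points d (comp S v) ⊆ points d (bigVertices K S) := fun x hx =>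
      mem_points.2 (hsub v (hKu.trans huv) (mem_points.1 hx))
    exact_mod_cast card_le_card (inter_subset_inter_left this)
  -- Large vertices outside the component number at most `4 * η * n`, and each contributes at most
  -- `d` points.
  have h9 : ((bigPoints K S).card : ℝ) ≤ (covered S ∩ points d (comp S v)).card +
      d * ((bigVertices K S).card - (comp S v).card) := by
    have h10 : bigPoints K S ⊆ (covered S ∩ points d (comp S v)) ∪
        points d (bigVertices K S \ comp S v) := by
      intro x hx
      obtain ⟨hx1, hx2⟩ := mem_inter.1 hx
      by_cases h : x.1 ∈ comp S v
      · exact mem_union_left _ (mem_inter.2 ⟨hx1, mem_points.2 h⟩)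
      · exact mem_union_right _ (mem_points.2 (mem_sdiff.2 ⟨mem_points.1 hx2, h⟩))
    have h11 := (card_le_card h10).trans (card_union_le _ _)
    rw [card_points] at h11
    have h12 : ((bigVertices K S \ comp S v).card : ℝ) + (comp S v).card =
        (bigVertices K S).card := by
      exact_mod_cast card_sdiff_add_card_eq_card (hsub v (hKu.trans huv))
    rw [← h12, add_sub_cancel_right]
    exact_mod_cast h11
  have hd : (0 : ℝ) ≤ d := Nat.cast_nonneg d
  have h13 : (d : ℝ) * ((bigVertices K S).card - (comp S v).card) ≤ 4 * η * (n * d : ℕ) := by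
    push_cast
    calc _ ≤ (d : ℝ) * (4 * η * n) := mul_le_mul_of_nonneg_left (by linarith) hd
      _ = _ := by ring
  have h14 : 0 ≤ η * (n * d : ℕ) := by positivity
  refine ⟨abs_le.2 ⟨by linarith, by linarith⟩, ?_⟩
  rw [h7]
  exact abs_le.2 ⟨by linarith, by linarith⟩

end Giant

/-! ### The branching process and its generating function -/

section Branching

open MeasureTheory ProbabilityTheory
open scoped ENNReal

/-- The probability generating function of the offspring distribution. -/
noncomputable def offspringGen (d : ℕ) (p s : ℝ) : ℝ := (p * s + 1 - p) ^ (d - 1)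

/-- The law of the offspring numbers. -/
noncomputable def offspringLaw (d : ℕ) (p : unitInterval) : Measure (ℕ × ℕ → ℕ) :=
  Measure.infinitePi fun _ : ℕ × ℕ => binomial (d - 1) p

instance (d : ℕ) (p : unitInterval) : IsProbabilityMeasure (offspringLaw d p) := by
  unfold offspringLaw; infer_instance

lemma lintegral_binomial_pow (m : ℕ) (p : unitInterval) {s : ℝ} (hs : 0 ≤ s) :
    ∫⁻ k, ENNReal.ofReal s ^ k ∂(binomial m p) =
      ENNReal.ofReal (((p : ℝ) * s + 1 - p) ^ m) := by
  have hp0 : (0 : ℝ) ≤ p := p.2.1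
  have hp1 : (0 : ℝ) ≤ 1 - p := sub_nonneg.2 p.2.2
  rw [binomial_eq_sum_dirac, lintegral_finsetSum_measure]
  simp_rw [lintegral_smul_measure, lintegral_dirac, smul_eq_mul, ← ENNReal.ofReal_pow hs]
  have : ∀ k ∈ Finset.Iic m, ENNReal.ofReal ((m.choose k) * (p : ℝ) ^ k * (1 - p) ^ (m - k)) *
      ENNReal.ofReal (s ^ k) =
      ENNReal.ofReal ((m.choose k) * (p : ℝ) ^ k * (1 - p) ^ (m - k) * s ^ k) := fun k _ =>
    (ENNReal.ofReal_mul (by positivity)).symm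
  rw [sum_congr rfl this, ← ENNReal.ofReal_sum_of_nonneg fun k _ => by positivity]
  congr 1
  have h2 : (p : ℝ) * s + 1 - p = p * s + (1 - p) := by ring
  rw [h2, add_pow]
  have h3 : Finset.Iic m = range (m + 1) := by ext; simp
  rw [h3]
  refine sum_congr rfl fun k _ => ?_
  rw [mul_pow]; ring

lemma iIndepFun_eval (d : ℕ) (p : unitInterval) :
    iIndepFun (fun (i : ℕ × ℕ) (ξ : ℕ × ℕ → ℕ) => ξ i) (offspringLaw d p) :=
  iIndepFun_infinitePi (P := fun _ : ℕ × ℕ => binomial (d - 1) p) (X := fun _ k => k)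
    fun _ => measurable_id

lemma lintegral_eval_pow (d : ℕ) (p : unitInterval) {s : ℝ} (hs : 0 ≤ s) (i : ℕ × ℕ) :
    ∫⁻ ξ, ENNReal.ofReal s ^ (ξ i) ∂(offspringLaw d p) =
      ENNReal.ofReal (offspringGen d p s) := by
  have h := lintegral_map (μ := offspringLaw d p) (f := fun k : ℕ => ENNReal.ofReal s ^ k)
    (g := fun ξ : ℕ × ℕ → ℕ => ξ i) (by fun_prop) (measurable_pi_apply i)
  rw [← h, offspringLaw]
  have h2 : Measure.map (fun ξ : ℕ × ℕ → ℕ => ξ i)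
      (Measure.infinitePi fun _ : ℕ × ℕ => binomial (d - 1) p) = binomial (d - 1) p :=
    Measure.infinitePi_map_eval (fun _ : ℕ × ℕ => binomial (d - 1) p) i
  change ∫⁻ k, ENNReal.ofReal s ^ k ∂(Measure.map (fun ξ : ℕ × ℕ → ℕ => ξ i) _) = _
  rw [h2, lintegral_binomial_pow _ _ hs, offspringGen]

lemma lintegral_prod_row (d : ℕ) (p : unitInterval) {s : ℝ} (hs : 0 ≤ s) (k m : ℕ) :
    ∫⁻ ξ, ∏ i ∈ range m, ENNReal.ofReal s ^ (ξ (k, i)) ∂(offspringLaw d p) =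
      ENNReal.ofReal (offspringGen d p s) ^ m := by
  have hind : iIndepFun (fun (i : ℕ) (ξ : ℕ × ℕ → ℕ) => ENNReal.ofReal s ^ (ξ (k, i)))
      (offspringLaw d p) :=
    ((iIndepFun_eval d p).precomp (g := fun i : ℕ => (k, i))
      (fun a b h => (Prod.mk.inj h).2)).comp (fun _ j => ENNReal.ofReal s ^ j)
      (fun _ => by fun_prop)
  have h := lintegral_prod_eq_prod_lintegral_of_indepFun (range m) _ hind (fun i => by fun_prop)
  simp only [lintegral_eval_pow d p hs, prod_const, card_range] at h
  exact h

/-- The information in the rows indexed by `s`. -/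
abbrev rowsAlgebra (s : Set ℕ) : MeasurableSpace (ℕ × ℕ → ℕ) :=
  ⨆ i ∈ {i : ℕ × ℕ | i.1 ∈ s}, MeasurableSpace.comap (fun ξ : ℕ × ℕ → ℕ => ξ i) ⊤

lemma measurable_rows {s : Set ℕ} {i : ℕ × ℕ} (hi : i.1 ∈ s) :
    Measurable[rowsAlgebra s] (fun ξ : ℕ × ℕ → ℕ => ξ i) := by
  refine Measurable.of_comap_le ?_
  exact le_iSup₂_of_le (f := fun (i : ℕ × ℕ) (_ : i ∈ {i : ℕ × ℕ | i.1 ∈ s}) =>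
    MeasurableSpace.comap (fun ξ : ℕ × ℕ → ℕ => ξ i) ⊤) i hi le_rfl

lemma measurable_generation (k : ℕ) :
    Measurable[rowsAlgebra (Set.Iio k)] (fun ξ : ℕ × ℕ → ℕ => generation ξ k) := by
  have : ∀ j ≤ k, Measurable[rowsAlgebra (Set.Iio k)] (fun ξ : ℕ × ℕ → ℕ => generation ξ j) := by
    intro j
    induction j with
    | zero => intro _; exact measurable_const
    | succ j ih =>
      intro hj
      have h1 := ih (by omega)
      have h2 : ∀ m, Measurable[rowsAlgebra (Set.Iio k)]
          (fun ξ : ℕ × ℕ → ℕ => ∑ i ∈ range m, ξ (j, i)) := fun m =>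
        Finset.measurable_fun_sum _ fun i _ => measurable_rows (Set.mem_Iio.2 (by simpa using hj))
      intro t _
      have h3 : (fun ξ : ℕ × ℕ → ℕ => generation ξ (j + 1)) ⁻¹' t =
          ⋃ m, ((fun ξ : ℕ × ℕ → ℕ => generation ξ j) ⁻¹' {m} ∩
            (fun ξ : ℕ × ℕ → ℕ => ∑ i ∈ range m, ξ (j, i)) ⁻¹' t) := by
        ext ξ
        simp [generation]
      rw [h3]
      exact MeasurableSet.iUnion fun m => (h1 (measurableSet_singleton m)).inter
        (h2 m (MeasurableSet.of_discrete))
  exact this k le_rfl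

lemma rowsAlgebra_le (s : Set ℕ) : rowsAlgebra s ≤ MeasurableSpace.pi :=
  iSup₂_le fun i _ => (measurable_pi_apply i).comap_le

/-- Condition on the size of generation `k`: it depends only on earlier rows, which are independent
of row `k`, so each of its individuals contributes one factor `offspringGen d p s`. -/
lemma lintegral_pow_generation (d : ℕ) (p : unitInterval) (k : ℕ) {s : ℝ} (hs : 0 ≤ s) :
    ∫⁻ ξ, ENNReal.ofReal s ^ generation ξ k ∂(offspringLaw d p) =
      ENNReal.ofReal ((offspringGen d p)^[k] s) := by
  induction k generalizing s with
  | zero => simp [generation]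
  | succ k ih =>
    have hp0 : (0 : ℝ) ≤ p := p.2.1
    have hp1 : (p : ℝ) ≤ 1 := p.2.2
    have hF : 0 ≤ offspringGen d p s := pow_nonneg (by nlinarith [mul_nonneg hp0 hs]) _
    rw [Function.iterate_succ_apply, ← ih hF]
    have hI : ∀ m, Measurable[rowsAlgebra (Set.Iio k)] (fun ξ : ℕ × ℕ → ℕ =>
        if generation ξ k = m then (1 : ℝ≥0∞) else 0) := fun m =>
      Measurable.ite (measurable_generation k (measurableSet_singleton m)) measurable_const
        measurable_const
    have hI' : ∀ m, Measurable (fun ξ : ℕ × ℕ → ℕ =>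
        if generation ξ k = m then (1 : ℝ≥0∞) else 0) := fun m =>
      (hI m).mono (rowsAlgebra_le _) le_rfl
    have hR : ∀ m, Measurable[rowsAlgebra {k}] (fun ξ : ℕ × ℕ → ℕ =>
        ∏ i ∈ range m, ENNReal.ofReal s ^ (ξ (k, i))) := fun m =>
      Finset.measurable_fun_prod _ fun i _ => (measurable_from_top (f := fun j : ℕ =>
        ENNReal.ofReal s ^ j)).comp (measurable_rows (Set.mem_singleton k))
    have hind : Indep (rowsAlgebra (Set.Iio k)) (rowsAlgebra {k}) (offspringLaw d p) := by
      refine indep_iSup_of_disjoint (fun i => (measurable_pi_apply i).comap_le)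
        (iIndepFun_eval d p) (Set.disjoint_left.2 fun i hi hi' => ?_)
      simp only [Set.mem_ofPred_eq, Set.mem_Iio, Set.mem_singleton_iff] at hi hi'
      omega
    have e1 : ∀ ξ : ℕ × ℕ → ℕ, ENNReal.ofReal s ^ generation ξ (k + 1) =
        ∑' m, (if generation ξ k = m then (1 : ℝ≥0∞) else 0) *
          ∏ i ∈ range m, ENNReal.ofReal s ^ (ξ (k, i)) := by
      intro ξ
      rw [tsum_eq_single (generation ξ k)]
      · rw [if_pos rfl, one_mul, prod_pow_eq_pow_sum]; rfl
      · intro m hm; rw [if_neg hm.symm, zero_mul]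
    have e2 : ∀ ξ : ℕ × ℕ → ℕ, ENNReal.ofReal (offspringGen d p s) ^ generation ξ k =
        ∑' m, (if generation ξ k = m then (1 : ℝ≥0∞) else 0) *
          ENNReal.ofReal (offspringGen d p s) ^ m := by
      intro ξ
      rw [tsum_eq_single (generation ξ k)]
      · rw [if_pos rfl, one_mul]
      · intro m hm; rw [if_neg hm.symm, zero_mul]
    simp_rw [e1, e2]
    have m1 : ∀ m, AEMeasurable (fun ξ : ℕ × ℕ → ℕ => (if generation ξ k = m then (1 : ℝ≥0∞) else 0) *
        ∏ i ∈ range m, ENNReal.ofReal s ^ (ξ (k, i))) (offspringLaw d p) := fun m =>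
      ((hI' m).mul ((hR m).mono (rowsAlgebra_le _) le_rfl)).aemeasurable
    have m2 : ∀ m, AEMeasurable (fun ξ : ℕ × ℕ → ℕ => (if generation ξ k = m then (1 : ℝ≥0∞) else 0) *
        ENNReal.ofReal (offspringGen d p s) ^ m) (offspringLaw d p) := fun m =>
      ((hI' m).mul measurable_const).aemeasurable
    rw [lintegral_tsum m1, lintegral_tsum m2]
    refine tsum_congr fun m => ?_
    rw [lintegral_mul_eq_lintegral_mul_lintegral_of_independent_measurableSpace
      (rowsAlgebra_le _) (rowsAlgebra_le _) hind (hI m) (hR m), lintegral_prod_row d p hs,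
      lintegral_mul_const _ (hI' m)]

lemma generation_eq_zero_mono (ξ : ℕ × ℕ → ℕ) : Monotone fun k => generation ξ k = 0 :=
  monotone_nat_of_le_succ fun k h => by
    change generation ξ k = 0 at h
    rw [generation, h, range_zero, sum_empty]

/-- At `s = 0` the power `0 ^ generation ξ k` is the indicator of extinction by generation `k`, and
these events increase to extinction. -/
lemma tendsto_iterate_extinctionProb (d : ℕ) (p : unitInterval) :
    Filter.Tendsto (fun k => (offspringGen d p)^[k] 0) Filter.atTop
      (nhds (extinctionProb d p)) := by
  have hp0 : (0 : ℝ) ≤ p := p.2.1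
  have hp1 : (p : ℝ) ≤ 1 := p.2.2
  have hF : ∀ s, 0 ≤ s → 0 ≤ offspringGen d p s := fun s hs =>
    pow_nonneg (by nlinarith [mul_nonneg hp0 hs]) _
  have hnn : ∀ k, 0 ≤ (offspringGen d p)^[k] 0 := fun k => by
    induction k with
    | zero => exact le_rfl
    | succ k ih => rw [Function.iterate_succ_apply']; exact hF _ ih
  have hmeas : ∀ k, MeasurableSet {ξ : ℕ × ℕ → ℕ | generation ξ k = 0} := fun k =>
    (measurable_generation k).mono (rowsAlgebra_le _) le_rfl (measurableSet_singleton 0)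
  have hk : ∀ k, (offspringLaw d p) {ξ | generation ξ k = 0} =
      ENNReal.ofReal ((offspringGen d p)^[k] 0) := by
    intro k
    rw [← lintegral_pow_generation d p k le_rfl, ← lintegral_indicator_one (hmeas k)]
    refine lintegral_congr fun ξ => ?_
    by_cases h : generation ξ k = 0
    · simp [h]
    · simp [h]
  have hU : {ξ : ℕ × ℕ → ℕ | ∃ k, generation ξ k = 0} = ⋃ k, {ξ | generation ξ k = 0} := by
    ext; simp
  have hmono : Monotone fun k => {ξ : ℕ × ℕ → ℕ | generation ξ k = 0} :=
    fun i j hij ξ h => generation_eq_zero_mono ξ hij h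
  have h := tendsto_measure_iUnion_atTop (μ := offspringLaw d p) hmono
  rw [← hU] at h
  have h2 := (ENNReal.tendsto_toReal (measure_ne_top _ _)).comp h
  refine h2.congr fun k => ?_
  simp only [Function.comp_apply]
  rw [hk, ENNReal.toReal_ofReal (hnn k)]

end Branching

/-! ### Fixed points and limits of hitting probabilities -/

section Analysis

open Filter Topology

lemma walkProb_mono {p : ℝ} (hp : 0 ≤ p) (hp1 : p ≤ 1) (d a : ℕ) :
    Monotone fun k => walkProb p d k a := by
  have hq : 0 ≤ 1 - p := by linarith
  have h : ∀ k a, walkProb p d k a ≤ walkProb p d (k + 1) a := by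
    intro k
    induction k with
    | zero =>
      intro a
      cases a with
      | zero => simp [walkProb]
      | succ a => rw [walkProb]; exact walkProb_nonneg hp hp1 _ _ _
    | succ k ih =>
      intro a
      cases a with
      | zero => simp [walkProb]
      | succ a =>
        rw [walkProb, walkProb]
        exact add_le_add (mul_le_mul_of_nonneg_left (ih _) hq)
          (mul_le_mul_of_nonneg_left (ih _) hp)
  exact monotone_nat_of_le_succ fun k => h k a

/-- The hitting probabilities of the random walk, if `θ = p φ + 1 - p` for the limit `φ` of the
extinction probabilities of the generations. -/
lemma tendsto_walkProb {p φ : ℝ} (hp : 0 ≤ p) (hp1 : p ≤ 1) {d : ℕ} (hφ0 : 0 ≤ φ)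
    (hφ : offspringGen d p φ = φ)
    (hlim : Tendsto (fun k => (offspringGen d p)^[k] 0) atTop (𝓝 φ)) (a : ℕ) :
    Tendsto (fun k => walkProb p d k a) atTop (𝓝 ((p * φ + 1 - p) ^ a)) := by
  have hq : 0 ≤ 1 - p := by linarith
  -- The probability of ever hitting 0. It is at most `θ ^ a` since `θ` solves the recursion; the
  -- lower bound is `hτ`.
  set W : ℕ → ℝ := fun a => ⨆ k, walkProb p d k a with hW
  have hbdd : ∀ a, BddAbove (Set.range fun k => walkProb p d k a) := fun a =>
    ⟨1, by rintro _ ⟨k, rfl⟩; exact walkProb_le_one hp hp1 d k a⟩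
  have hWlim : ∀ a, Tendsto (fun k => walkProb p d k a) atTop (𝓝 (W a)) := fun a =>
    tendsto_atTop_ciSup (walkProb_mono hp hp1 d a) (hbdd a)
  have hW0 : ∀ a, 0 ≤ W a := fun a =>
    (walkProb_nonneg hp hp1 d 0 a).trans (le_ciSup (hbdd a) 0)
  have hWrec : ∀ a, W (a + 1) = (1 - p) * W a + p * W (a + (d - 1)) := by
    intro a
    refine tendsto_nhds_unique ((hWlim (a + 1)).comp (tendsto_add_atTop_nat 1)) ?_
    have h := ((hWlim a).const_mul (1 - p)).add ((hWlim (a + (d - 1))).const_mul p)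
    refine h.congr fun k => ?_
    simp [walkProb]
  have hnn : ∀ k, 0 ≤ (offspringGen d p)^[k] 0 := fun k => by
    cases k with
    | zero => exact le_rfl
    | succ k =>
      induction k with
      | zero => exact pow_nonneg (by simpa using hq) _
      | succ k ih =>
        rw [Function.iterate_succ_apply']
        exact pow_nonneg (by nlinarith [mul_nonneg hp ih]) _
  -- The prefactor bounds from below the probability of ever descending one level. For `j = 0` only
  -- an immediate down step counts. After an up step, `d - 1` levels must be descended in turn, and
  -- the `(d - 1)`-st power of the prefactor is the next iterate of the generating function.
  have hτ : ∀ j a, (p * (offspringGen d p)^[j] 0 + 1 - p) * W a ≤ W (a + 1) := by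
    intro j
    induction j with
    | zero =>
      intro a
      rw [hWrec, Function.iterate_zero, id]
      nlinarith [mul_nonneg hp (hW0 (a + (d - 1)))]
    | succ j ih =>
      intro a
      have hτ0 : 0 ≤ p * (offspringGen d p)^[j] 0 + 1 - p := by nlinarith [mul_nonneg hp (hnn j)]
      have hpow : ∀ b a, (p * (offspringGen d p)^[j] 0 + 1 - p) ^ b * W a ≤ W (a + b) := by
        intro b
        induction b with
        | zero => intro a; simp
        | succ b ihb =>
          intro a
          calc _ = (p * (offspringGen d p)^[j] 0 + 1 - p) *
                ((p * (offspringGen d p)^[j] 0 + 1 - p) ^ b * W a) := by ring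
            _ ≤ (p * (offspringGen d p)^[j] 0 + 1 - p) * W (a + b) :=
              mul_le_mul_of_nonneg_left (ihb a) hτ0
            _ ≤ _ := ih (a + b)
      have h1 := hpow (d - 1) a
      rw [hWrec, Function.iterate_succ_apply', offspringGen]
      nlinarith [mul_le_mul_of_nonneg_left h1 hp]
  set θ := p * φ + 1 - p with hθ
  have hθ0 : 0 ≤ θ := by rw [hθ]; nlinarith [mul_nonneg hp hφ0]
  have hτlim : Tendsto (fun j => p * (offspringGen d p)^[j] 0 + 1 - p) atTop (𝓝 θ) :=
    ((hlim.const_mul p).add_const 1).sub_const p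
  have hstep : ∀ a, θ * W a ≤ W (a + 1) := fun a =>
    le_of_tendsto' (hτlim.mul_const (W a)) fun j => hτ j a
  have hWge : θ ^ a ≤ W a := by
    induction a with
    | zero => exact (walkProb_zero_right p d 0).symm.le.trans (le_ciSup (hbdd 0) 0)
    | succ a ih =>
      rw [pow_succ']
      exact (mul_le_mul_of_nonneg_left ih hθ0).trans (hstep a)
  have hsup : 1 - p + p * θ ^ (d - 1) ≤ θ := by
    have : θ ^ (d - 1) = φ := hφ
    rw [this, hθ]; linarith
  have hWle : W a ≤ θ ^ a := ciSup_le fun k => walkProb_le_pow hp hp1 hθ0 hsup k a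
  rw [le_antisymm hWge hWle]
  exact hWlim a

/-- Both `a` and 1 are fixed points of `x ↦ 1 - p + p * x ^ m`. By strict convexity its graph lies
below the diagonal between them. -/
lemma fixedPoint_lt {p a b : ℝ} (hp : 0 < p) {m : ℕ} (hm : 2 ≤ m) (ha : 0 ≤ a) (hab : a < b)
    (hb : b < 1) (h : 1 - p + p * a ^ m = a) : 1 - p + p * b ^ m < b := by
  have ha1 : 0 < 1 - a := by linarith
  have hconv : ((1 - b) / (1 - a) * a + (b - a) / (1 - a) * 1) ^ m <
      (1 - b) / (1 - a) * a ^ m + (b - a) / (1 - a) * 1 ^ m := by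
    have hc := strictConvexOn_pow hm
    exact hc.2 (Set.mem_Ici.2 ha) (Set.mem_Ici.2 zero_le_one) (by linarith)
      (div_pos (by linarith) ha1) (div_pos (by linarith) ha1) (by field_simp; ring)
  have h1 : (1 - b) / (1 - a) * a + (b - a) / (1 - a) * 1 = b := by field_simp; ring
  rw [h1, one_pow] at hconv
  have h2 := mul_lt_mul_of_pos_left hconv hp
  have h3 : p * a ^ m = a - 1 + p := by linarith
  have h4 : p * ((1 - b) / (1 - a) * a ^ m + (b - a) / (1 - a) * 1) = b - 1 + p := by
    have : p * ((1 - b) / (1 - a) * a ^ m + (b - a) / (1 - a) * 1) =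
      (1 - b) / (1 - a) * (p * a ^ m) + p * ((b - a) / (1 - a)) := by ring
    rw [this, h3]
    field_simp
    ring
  linarith

/-- A supercritical process has a point below the diagonal. -/
lemma exists_offspringGen_le {d : ℕ} (hd : 3 ≤ d) {p : ℝ} (hp0 : 0 < p) (hp1 : p < 1)
    (hp : 1 / ((d : ℝ) - 1) < p) : ∃ y, 0 ≤ y ∧ y < 1 ∧ offspringGen d p y ≤ y := by
  have hm : ((d - 1 : ℕ) : ℝ) = (d : ℝ) - 1 := by
    rw [Nat.cast_sub (by omega)]; simp
  have hd1 : (0 : ℝ) < (d : ℝ) - 1 := by rw [← hm]; exact_mod_cast (by omega)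
  set q := ((d : ℝ) - 1) * p with hq
  have hq1 : 1 < q := by
    rw [div_lt_iff₀ hd1] at hp
    linarith
  -- Chosen so that `1 + q * t = q` and `1 - t = 1 / q`. Bernoulli's inequality gives (1 + pt)^(d-1)
  -- ≥ q, hence (1 - pt)^(d-1) ≤ 1/q.
  set t := (q - 1) / q with ht
  have hqt : q * t = q - 1 := by rw [ht]; field_simp
  have ht0 : 0 < t := div_pos (by linarith) (by linarith)
  have ht1 : t < 1 := by rw [ht, div_lt_one (by linarith)]; linarith
  refine ⟨1 - t, by linarith, by linarith, ?_⟩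
  have hbase : p * (1 - t) + 1 - p = 1 - p * t := by ring
  rw [offspringGen, hbase]
  have hpt : 0 ≤ p * t := by positivity
  have hpt1 : p * t ≤ 1 := by nlinarith
  have h1 : 1 + q * t ≤ (1 + p * t) ^ (d - 1) := by
    have := one_add_mul_le_pow (a := p * t) (by linarith) (d - 1)
    rw [hm] at this
    calc 1 + q * t = 1 + ((d : ℝ) - 1) * (p * t) := by rw [hq]; ring
      _ ≤ _ := this
  have h2 : (1 - p * t) ^ (d - 1) * (1 + p * t) ^ (d - 1) ≤ 1 := by
    rw [← mul_pow]
    exact pow_le_one₀ (by nlinarith) (by nlinarith)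
  have h3 : 0 ≤ (1 - p * t) ^ (d - 1) := pow_nonneg (by linarith) _
  have h4 := mul_le_mul_of_nonneg_left h1 h3
  have h5 : (1 - p * t) ^ (d - 1) * q ≤ 1 := by
    rw [hqt] at h4
    linarith
  have h6 : (1 - t) * q = 1 := by linarith
  nlinarith

lemma offspringGen_mono {d : ℕ} {p x y : ℝ} (hp : 0 ≤ p) (hp1 : p ≤ 1) (hx : 0 ≤ x)
    (hxy : x ≤ y) : offspringGen d p x ≤ offspringGen d p y :=
  pow_le_pow_left₀ (by nlinarith [mul_nonneg hp hx])
    (by nlinarith [mul_le_mul_of_nonneg_left hxy hp]) _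

lemma offspringGen_extinctionProb (d : ℕ) (p : unitInterval) :
    offspringGen d p (extinctionProb d p) = extinctionProb d p :=
  isFixedPt_of_tendsto_iterate (tendsto_iterate_extinctionProb d p)
    (by unfold offspringGen; fun_prop)

lemma extinctionProb_nonneg (d : ℕ) (p : unitInterval) : 0 ≤ extinctionProb d p :=
  MeasureTheory.measureReal_nonneg

lemma extinctionProb_pos (d : ℕ) (p : unitInterval) (hp1 : (p : ℝ) < 1) :
    0 < extinctionProb d p := by
  rw [← offspringGen_extinctionProb]
  exact pow_pos (by nlinarith [mul_nonneg p.2.1 (extinctionProb_nonneg d p)]) _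

lemma extinctionProb_lt_one {d : ℕ} (hd : 3 ≤ d) {p : unitInterval}
    (hp : 1 / ((d : ℝ) - 1) < (p : ℝ)) (hp0 : 0 < (p : ℝ)) (hp1 : (p : ℝ) < 1) :
    extinctionProb d p < 1 := by
  obtain ⟨y, hy0, hy1, hy⟩ := exists_offspringGen_le hd hp0 hp1 hp
  refine lt_of_le_of_lt (le_of_tendsto' (tendsto_iterate_extinctionProb d p) fun k => ?_) hy1
  have : 0 ≤ (offspringGen d p)^[k] 0 ∧ (offspringGen d p)^[k] 0 ≤ y := by
    induction k with
    | zero => exact ⟨le_rfl, hy0⟩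
    | succ k ih =>
      rw [Function.iterate_succ_apply']
      exact ⟨pow_nonneg (by nlinarith [mul_nonneg hp0.le ih.1]) _,
        (offspringGen_mono hp0.le hp1.le ih.1 ih.2).trans hy⟩
  exact this.2

/-- The substitution `x ↦ p * x + 1 - p` turns fixed points of `offspringGen` into those of
`fixedPoint_lt`, which forbids two of them below 1. -/
lemma eq_extinctionProb {d : ℕ} (hd : 3 ≤ d) {p : unitInterval}
    (hp : 1 / ((d : ℝ) - 1) < (p : ℝ)) (hp0 : 0 < (p : ℝ)) (hp1 : (p : ℝ) < 1) {y : ℝ}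
    (hy0 : 0 < y) (hy1 : y < 1) (hy : offspringGen d p y = y) : y = extinctionProb d p := by
  have key : ∀ a b : ℝ, 0 ≤ a → b < 1 → offspringGen d p a = a → offspringGen d p b = b →
      ¬ a < b := by
    intro a b ha hb hfa hfb hab
    unfold offspringGen at hfa hfb
    have h1 : (p : ℝ) * a < p * b := mul_lt_mul_of_pos_left hab hp0
    have h := fixedPoint_lt hp0 (m := d - 1) (by omega) (a := p * a + 1 - p) (b := p * b + 1 - p)
      (by nlinarith [mul_nonneg hp0.le ha]) (by linarith)
      (by nlinarith [mul_lt_mul_of_pos_left hb hp0]) (by rw [hfa]; ring)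
    rw [hfb] at h
    linarith
  rcases lt_trichotomy y (extinctionProb d p) with h | h | h
  · exact absurd h (key _ _ hy0.le (extinctionProb_lt_one hd hp hp0 hp1) hy
      (offspringGen_extinctionProb d p))
  · exact h
  · exact absurd h (key _ _ (extinctionProb_nonneg d p) hy1 (offspringGen_extinctionProb d p) hy)

/-- The hitting probabilities are nearly the same for a slightly smaller edge probability. -/
lemma exists_supersolution {p θ : ℝ} (hp : 0 < p) {d : ℕ} (hd : 3 ≤ d) (hθ : 0 ≤ θ)
    (hθ1 : θ < 1) (h : 1 - p + p * θ ^ (d - 1) = θ) {η : ℝ} (hη : 0 < η) :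
    ∃ y p', 0 ≤ y ∧ y ^ d ≤ θ ^ d + η ∧ 0 < p' ∧ p' < p ∧ 1 - p' + p' * y ^ (d - 1) ≤ y := by
  have hc : ∀ᶠ y in 𝓝[>] θ, y ^ d < θ ^ d + η :=
    ((continuous_pow d).continuousAt.tendsto.mono_left nhdsWithin_le_nhds).eventually
      (gt_mem_nhds (by linarith))
  obtain ⟨y, hyd, hyθ, hy1⟩ := (hc.and (Ioo_mem_nhdsGT hθ1)).exists
  have hlt := fixedPoint_lt hp (m := d - 1) (by omega) hθ hyθ hy1 h
  set r := min (p / 2) (y - (1 - p + p * y ^ (d - 1))) with hr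
  have hr0 : 0 < r := lt_min (by linarith) (by linarith)
  have hr1 : r ≤ p / 2 := min_le_left _ _
  have hr2 : r ≤ y - (1 - p + p * y ^ (d - 1)) := min_le_right _ _
  have hy0 : 0 ≤ y := by linarith
  have hym : 0 ≤ y ^ (d - 1) := pow_nonneg hy0 _
  -- Lowering `p` by `r` raises the left side by r(1 - y^(d-1)) ≤ r, and `r` is at most the gap at
  -- `y`.
  refine ⟨y, p - r, hy0, hyd.le, by linarith, by linarith, ?_⟩
  nlinarith [mul_nonneg hr0.le hym]

end Analysis

/-! ### Exponential rates and the choice of constants -/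

section Rates

/-- The sums `f n` over the matchings of `[n] × [d]` are exponentially smaller than the number of
these matchings. -/
def ExpSmall (d : ℕ) (f : ℕ → ℝ) : Prop :=
  ∃ c : ℝ, 0 < c ∧ ∃ n₀ : ℕ, ∀ n ≥ n₀,
    f n ≤ Real.exp (-c * n) * extCount (∅ : Finset (Sym2 (Point n d)))

lemma ExpSmall.mono {d : ℕ} {f g : ℕ → ℝ} (hg : ExpSmall d g) {n₁ : ℕ}
    (h : ∀ n ≥ n₁, f n ≤ g n) : ExpSmall d f := by
  obtain ⟨c, hc, n₀, hn⟩ := hg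
  exact ⟨c, hc, max n₀ n₁, fun n hn' => (h n (le_of_max_le_right hn')).trans
    (hn n (le_of_max_le_left hn'))⟩

lemma ExpSmall.add {d : ℕ} {f g : ℕ → ℝ} (hf : ExpSmall d f) (hg : ExpSmall d g) :
    ExpSmall d fun n => f n + g n := by
  obtain ⟨c, hc, n₀, hn⟩ := hf
  obtain ⟨c', hc', n₁, hn'⟩ := hg
  set a := min c c' with ha
  have ha0 : 0 < a := lt_min hc hc'
  refine ⟨a / 2, by positivity, max (max n₀ n₁) ⌈2 / a⌉₊, fun n h => ?_⟩
  have h1 := hn n (le_of_max_le_left (le_of_max_le_left h))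
  have h2 := hn' n (le_of_max_le_right (le_of_max_le_left h))
  have h3 : 2 / a ≤ n := (Nat.le_ceil _).trans (by exact_mod_cast le_of_max_le_right h)
  rw [div_le_iff₀ ha0] at h3
  have hnn : (0 : ℝ) ≤ n := Nat.cast_nonneg n
  have h4 : Real.exp (-c * n) ≤ Real.exp (-a * n) := Real.exp_le_exp.2
    (mul_le_mul_of_nonneg_right (neg_le_neg (min_le_left _ _)) hnn)
  have h5 : Real.exp (-c' * n) ≤ Real.exp (-a * n) := Real.exp_le_exp.2
    (mul_le_mul_of_nonneg_right (neg_le_neg (min_le_right _ _)) hnn)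
  have h6 : 2 * Real.exp (-a * n) ≤ Real.exp (-(a / 2) * n) := by
    have e1 : Real.exp (-(a / 2) * n) = Real.exp (a * n / 2) * Real.exp (-a * n) := by
      rw [← Real.exp_add]; congr 1; ring
    rw [e1]
    refine mul_le_mul_of_nonneg_right ?_ (Real.exp_pos _).le
    have := Real.add_one_le_exp (a * n / 2)
    linarith
  have he := extCount_nonneg (∅ : Finset (Sym2 (Point n d)))
  nlinarith [mul_le_mul_of_nonneg_right h4 he, mul_le_mul_of_nonneg_right h5 he,
    mul_le_mul_of_nonneg_right h6 he]

/-- With `a = log 2` or `a = log 4`, this makes the number of unions of large components at most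
`exp (b * n)` for large `K`. -/
lemma natDiv_mul_le {K n : ℕ} {a b : ℝ} (ha : 0 ≤ a) (hb : 0 < b) (hK : a / b ≤ K) (hK0 : 0 < K) :
    ((n / K : ℕ) : ℝ) * a ≤ b * n := by
  have hK' : (0 : ℝ) < K := by exact_mod_cast hK0
  have h1 : ((n / K : ℕ) : ℝ) ≤ n / K := Nat.cast_div_le
  rw [div_le_iff₀ hb] at hK
  calc _ ≤ (n : ℝ) / K * a := mul_le_mul_of_nonneg_right h1 ha
    _ ≤ (n : ℝ) / K * (K * b) := mul_le_mul_of_nonneg_left hK (by positivity)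
    _ = _ := by field_simp

open Classical in
-- In `sum_saturated_le` the constants `z`, `γ` and `K` are chosen in this order so that each of the
-- three counting factors is at most `exp (b * n)`, while `p ^ j ≤ exp (-4 * b * n)`.
lemma expSmall_saturated {d : ℕ} (hd : 0 < d) {p η : ℝ} (hp : 0 < p) (hp1 : p < 1) (hη : 0 < η) :
    ∃ γ : ℝ, 0 < γ ∧ γ ≤ 1 ∧ ∃ K₀ : ℕ, ∀ K ≥ K₀, ExpSmall d fun n =>
      percSum (X := Point n d) p ∅ ∅ fun S =>
        if Saturated K ⌈η * n⌉₊ ⌊γ * n⌋₊ S then 1 else 0 := by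
  have hd' : (0 : ℝ) < d := by exact_mod_cast hd
  set l := -Real.log p with hl
  have hl0 : 0 < l := neg_pos.2 (Real.log_neg hp hp1)
  set b := η * l * d / 16 with hb
  have hb0 : 0 < b := by positivity
  set z := min 1 (η * l / 16) with hz
  have hz0 : 0 < z := lt_min one_pos (by positivity)
  have hz1 : z ≤ 1 := min_le_left _ _
  have hzd : z * d ≤ b := by
    have : z ≤ η * l / 16 := min_le_right _ _
    calc z * d ≤ η * l / 16 * d := mul_le_mul_of_nonneg_right this hd'.le
      _ = b := by rw [hb]; ring
  set lz := -Real.log z with hlz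
  have hlz0 : 0 ≤ lz := neg_nonneg.2 (Real.log_nonpos hz0.le hz1)
  set γ := min 1 (min (η * d / 8) (b / (lz + 1))) with hγ
  have hγ0 : 0 < γ := lt_min one_pos (lt_min (by positivity) (by positivity))
  have hγ1 : γ ≤ η * d / 8 := (min_le_right _ _).trans (min_le_left _ _)
  have hγ2 : γ * lz ≤ b := by
    have h1 : γ ≤ b / (lz + 1) := (min_le_right _ _).trans (min_le_right _ _)
    rw [le_div_iff₀ (by positivity)] at h1
    nlinarith
  refine ⟨γ, hγ0, min_le_left _ _, ⌈Real.log 2 / b⌉₊ + 1, fun K hK => ?_⟩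
  have hK0 : 0 < K := by omega
  have hKb : Real.log 2 / b ≤ K := (Nat.le_ceil _).trans (by exact_mod_cast (by omega))
  refine ⟨b, hb0, ⌈8 / (η * d)⌉₊, fun n hn => ?_⟩
  have hn1 : 8 / (η * d) ≤ n := (Nat.le_ceil _).trans (by exact_mod_cast hn)
  rw [div_le_iff₀ (by positivity)] at hn1
  set g := ⌊γ * n⌋₊ with hg
  set L := ⌈η * n⌉₊ with hL
  have hg1 : (g : ℝ) ≤ γ * n := Nat.floor_le (by positivity)
  have hL1 : η * n ≤ L := Nat.le_ceil _
  have hnn : (0 : ℝ) ≤ n := Nat.cast_nonneg n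
  have hgη : (g : ℝ) ≤ η * d / 8 * n := hg1.trans (mul_le_mul_of_nonneg_right hγ1 hnn)
  have hdL : d * (η * n) ≤ d * L := mul_le_mul_of_nonneg_left hL1 hd'.le
  have hgL : 2 * g ≤ d * L := by
    have : (2 * g : ℝ) ≤ d * L := by nlinarith
    exact_mod_cast this
  set j := (d * L - 2 * g) / 2 with hj
  have hj1 : 2 * j + 2 * g ≤ d * L := by omega
  -- The factor `4 * b / l` is `η * d / 4`: of the at least `η * d * n / 2` edges at the set, half
  -- remain after the loss to `g` and rounding.
  have hj2 : (4 * b / l) * n ≤ j := by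
    have h1 : d * L ≤ 2 * j + 2 * g + 1 := by omega
    have h2 : (d * L : ℝ) ≤ 2 * j + 2 * g + 1 := by exact_mod_cast h1
    have h3 : 4 * b / l = η * d / 4 := by rw [hb]; field_simp; ring
    rw [h3]
    nlinarith
  have hM : ∀ M ∈ extensions (∅ : Finset (Sym2 (Point n d))), ∑ S ∈ M.powerset,
      p ^ S.card * (1 - p) ^ (M \ S).card * (if Saturated K L g S then 1 else 0) ≤
        Real.exp (-b * n) := by
    intro M hM
    have hM' := (mem_extensions.1 hM).1
    have hcard : (M.card : ℝ) ≤ n * d := by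
      have := hM'.two_mul_card
      rw [Fintype.card_prod, Fintype.card_fin, Fintype.card_fin] at this
      exact_mod_cast (by omega)
    refine (sum_saturated_le hp.le hp1.le hz0 hz1 hK0 hj1 hM').trans ?_
    have e1 : z⁻¹ ^ g ≤ Real.exp (b * n) := by
      rw [← Real.exp_log (pow_pos (inv_pos.2 hz0) g), Real.log_pow, Real.log_inv, ← hlz]
      refine Real.exp_le_exp.2 ?_
      calc (g : ℝ) * lz ≤ γ * n * lz := mul_le_mul_of_nonneg_right hg1 hlz0
        _ = γ * lz * n := by ring
        _ ≤ _ := mul_le_mul_of_nonneg_right hγ2 hnn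
    have e2 : (1 + z) ^ M.card ≤ Real.exp (b * n) := by
      have h1 : 1 + z ≤ Real.exp z := by rw [add_comm]; exact Real.add_one_le_exp z
      refine (pow_le_pow_left₀ (by positivity) h1 _).trans ?_
      rw [← Real.exp_nat_mul]
      refine Real.exp_le_exp.2 ?_
      calc (M.card : ℝ) * z ≤ n * d * z := mul_le_mul_of_nonneg_right hcard hz0.le
        _ = z * d * n := by ring
        _ ≤ _ := mul_le_mul_of_nonneg_right hzd hnn
    have e3 : (2 : ℝ) ^ (n / K) ≤ Real.exp (b * n) := by
      rw [← Real.exp_log (pow_pos (two_pos : (0 : ℝ) < 2) (n / K)), Real.log_pow]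
      exact Real.exp_le_exp.2 (natDiv_mul_le (Real.log_nonneg one_le_two) hb0 hKb hK0)
    have e4 : p ^ j ≤ Real.exp (-(4 * b) * n) := by
      rw [← Real.exp_log (pow_pos hp j), Real.log_pow]
      refine Real.exp_le_exp.2 ?_
      have h1 := mul_le_mul_of_nonneg_right hj2 hl0.le
      have h2 : 4 * b / l * n * l = 4 * b * n := by field_simp
      have h3 : Real.log p = -l := by rw [hl, neg_neg]
      rw [h3]
      linarith
    calc _ ≤ Real.exp (b * n) * Real.exp (b * n) *
          (Real.exp (b * n) * Real.exp (-(4 * b) * n)) := by gcongr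
      _ = Real.exp (-b * n) := by
        rw [← Real.exp_add, ← Real.exp_add, ← Real.exp_add]
        congr 1; ring
  change percSum p ∅ ∅ (fun S => if Saturated K L g S then 1 else 0) ≤ _
  rw [percSum_empty]
  refine (sum_le_sum hM).trans_eq ?_
  rw [sum_const, nsmul_eq_mul, extCount, mul_comm]

open Classical in
-- With `w = j`, about half of `γ * n`, the crossing bound is at most `exp (-2 * b * n)`, and `K` is
-- taken so large that the number of pairs costs only `exp (b * n)`.
lemma expSmall_separated {d : ℕ} (hd : 0 < d) {p p' γ : ℝ} (hp' : 0 ≤ p') (hpp : p' < p)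
    (hp1 : p ≤ 1) (hγ : 0 < γ) (hγ1 : γ ≤ 1) :
    ∃ K₀ : ℕ, ∀ K ≥ K₀, ExpSmall d fun n =>
      ∑ S : Finset (Sym2 (Point n d)), p' ^ S.card * ∑ M ∈ extensions S, ∑ T ∈ (M \ S).powerset,
      (p - p') ^ T.card * (1 - p) ^ ((M \ S) \ T).card *
        (if Separated K ⌊γ * n⌋₊ S T then 1 else 0) := by
  have hd' : (0 : ℝ) < d := by exact_mod_cast hd
  have hq' : 0 < 1 - p' := by linarith
  set a := 1 - (1 - p) / (1 - p') with ha
  have ha0 : 0 < a := by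
    rw [ha, sub_pos, div_lt_one hq']; linarith
  have ha1 : a ≤ 1 := by
    rw [ha]; have : 0 ≤ (1 - p) / (1 - p') := div_nonneg (by linarith) hq'.le
    linarith
  set x := a * (γ / (4 * d)) with hx
  have hx0 : 0 < x := by positivity
  set b := x * γ / 8 with hb
  have hb0 : 0 < b := by positivity
  refine ⟨⌈Real.log 4 / b⌉₊ + 1, fun K hK => ?_⟩
  have hK0 : 0 < K := by omega
  have hKb : Real.log 4 / b ≤ K := (Nat.le_ceil _).trans (by exact_mod_cast (by omega))
  refine ⟨b, hb0, ⌈8 / γ⌉₊ + 1, fun n hn => ?_⟩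
  have hn1 : 8 / γ ≤ n := (Nat.le_ceil _).trans (by exact_mod_cast (by omega))
  rw [div_le_iff₀ hγ] at hn1
  have hn0 : (0 : ℝ) < n := by exact_mod_cast (by omega)
  set g := ⌊γ * n⌋₊ with hg
  set j := g / 2 with hj
  have hg1 : (g : ℝ) ≤ γ * n := Nat.floor_le (by positivity)
  have hg2 : γ * n < g + 1 := Nat.lt_floor_add_one _
  have hj1 : γ / 4 * n ≤ j := by
    have h1 : (g : ℝ) ≤ 2 * j + 1 := by exact_mod_cast (by omega)
    linarith
  have hgn : g ≤ n := by
    have : (g : ℝ) ≤ n := hg1.trans (by nlinarith)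
    exact_mod_cast this
  have hjn : j ≤ n * d := by nlinarith [Nat.div_le_self g 2]
  refine (sum_separated_le hp' hpp hp1 (g := g) (w := j) (j := j) hK0 (by omega) (by omega)
    hjn).trans ?_
  rw [← ha]
  refine mul_le_mul_of_nonneg_right ?_ (extCount_nonneg _)
  have hw : γ / (4 * d) ≤ j / (n * d : ℕ) := by
    push_cast
    rw [div_le_div_iff₀ (by positivity) (by positivity)]
    nlinarith [mul_le_mul_of_nonneg_right hj1 hd'.le]
  have hw1 : (j : ℝ) / (n * d : ℕ) ≤ 1 := by
    rw [div_le_one (by push_cast; positivity)]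
    exact_mod_cast hjn
  have hκ0 : 0 ≤ 1 - a * (j / (n * d : ℕ)) := by
    have : (0 : ℝ) ≤ j / (n * d : ℕ) := by positivity
    nlinarith
  have hκ1 : 1 - a * (j / (n * d : ℕ)) ≤ Real.exp (-x) := by
    have h1 := Real.add_one_le_exp (-x)
    have h2 := mul_le_mul_of_nonneg_left hw ha0.le
    linarith
  have e1 : (1 - a * (j / (n * d : ℕ))) ^ j ≤ Real.exp (-(2 * b) * n) := by
    refine (pow_le_pow_left₀ hκ0 hκ1 _).trans ?_
    rw [← Real.exp_nat_mul]
    refine Real.exp_le_exp.2 ?_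
    have := mul_le_mul_of_nonneg_right hj1 hx0.le
    have h2 : 2 * b * n = γ / 4 * n * x := by rw [hb]; ring
    linarith
  have e2 : (4 : ℝ) ^ (n / K) ≤ Real.exp (b * n) := by
    rw [← Real.exp_log (pow_pos (by norm_num : (0 : ℝ) < 4) (n / K)), Real.log_pow]
    exact Real.exp_le_exp.2 (natDiv_mul_le (Real.log_nonneg (by norm_num)) hb0 hKb hK0)
  calc _ ≤ Real.exp (b * n) * Real.exp (-(2 * b) * n) := by gcongr
    _ = _ := by rw [← Real.exp_add]; congr 1; ring

end Rates

/-! ### The binomial-edge model -/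

section Combination

lemma percSum_add {X : Type*} [Fintype X] [DecidableEq X] (p : ℝ) (P Q : Finset (Sym2 X))
    (F G : Finset (Sym2 X) → ℝ) :
    percSum p P Q (fun S => F S + G S) = percSum p P Q F + percSum p P Q G := by
  simp only [percSum, mul_add, sum_add_distrib]

open Classical in
lemma card_le_pointCount {n d : ℕ} {E : Finset (Sym2 (Point n d)) → Point n d → Prop}
    {S : Finset (Sym2 (Point n d))} {A : Finset (Point n d)} (h : ∀ x ∈ A, E S x) :
    A.card ≤ pointCount E S :=
  card_le_card fun x hx => mem_filter.2 ⟨mem_univ _, h x hx⟩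

lemma le_card_add_pointCount {n d : ℕ} {E : Finset (Sym2 (Point n d)) → Point n d → Prop}
    {S : Finset (Sym2 (Point n d))} {A : Finset (Point n d)} (h : ∀ x ∉ A, E S x) :
    n * d ≤ A.card + pointCount E S := by
  classical
  have h1 : (univ : Finset (Point n d)) ⊆ A ∪ univ.filter fun x => E S x := fun x _ => by
    by_cases hx : x ∈ A
    · exact mem_union_left _ hx
    · exact mem_union_right _ (mem_filter.2 ⟨mem_univ _, h x hx⟩)
  have h2 := (card_le_card h1).trans (card_union_le _ _)
  simp only [card_univ, Fintype.card_prod, Fintype.card_fin] at h2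
  unfold pointCount
  convert h2

open Classical in
/-- A union bound over both levels of the percolation. -/
lemma percSum_indicator_le {X : Type*} [Fintype X] [DecidableEq X] {p p' : ℝ} (hp' : 0 ≤ p')
    (hpp : p' ≤ p) (hp1 : p ≤ 1) {G A₁ A₂ A₃ A₄ A₅ : Finset (Sym2 X) → Prop}
    {A₆ : Finset (Sym2 X) → Finset (Sym2 X) → Prop}
    (h : ∀ M ∈ extensions (∅ : Finset (Sym2 X)), ∀ S ⊆ M, ∀ S' ⊆ S,
      ¬ A₁ S → ¬ A₂ S → ¬ A₃ S → ¬ A₄ S' → ¬ A₅ S' → ¬ A₆ S' (S \ S') → G S) :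
    percSum p ∅ ∅ (fun S => if G S then 0 else 1) ≤
      percSum p ∅ ∅ (fun S => if A₁ S then 1 else 0) +
      percSum p ∅ ∅ (fun S => if A₂ S then 1 else 0) +
      percSum p ∅ ∅ (fun S => if A₃ S then 1 else 0) +
      (percSum p' ∅ ∅ (fun S => if A₄ S then 1 else 0) +
      percSum p' ∅ ∅ (fun S => if A₅ S then 1 else 0)) +
      ∑ S', p' ^ S'.card * ∑ M ∈ extensions S', ∑ T ∈ (M \ S').powerset,
        (p - p') ^ T.card * (1 - p) ^ ((M \ S') \ T).card * (if A₆ S' T then 1 else 0) := by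
  rw [← percSum_add, ← percSum_add, ← percSum_add]
  refine percSum_sprinkle hp' hpp hp1 (F₃ := fun S T => if A₆ S T then 1 else 0)
    fun M hM S hSM S' hS => ?_
  have hnn : ∀ P : Prop, (0 : ℝ) ≤ if P then 1 else 0 := fun P => by split_ifs <;> norm_num
  have n₁ := hnn (A₁ S)
  have n₂ := hnn (A₂ S)
  have n₃ := hnn (A₃ S)
  have n₄ := hnn (A₄ S')
  have n₅ := hnn (A₅ S')
  have n₆ := hnn (A₆ S' (S \ S'))
  by_cases hG : G S
  · rw [if_pos hG]; linarith
  rw [if_neg hG]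
  by_contra hlt
  rw [not_le] at hlt
  refine hG (h M hM S hSM S' hS ?_ ?_ ?_ ?_ ?_ ?_) <;> intro h' <;> rw [if_pos h'] at hlt <;>
    linarith

/-- The component statistics that are off their typical values with exponentially small
probability. -/
lemma giant_of_statistics {n d K : ℕ} (hd : 0 < d) (hn : 0 < n)
    {M S S' : Finset (Sym2 (Point n d))} (hM : IsPerfect M) (hSM : S ⊆ M) (hS : S' ⊆ S)
    {χ κ η q₁ q₂ q₃ q₄ : ℝ} (hη : 0 < η) (hχ : 8 * η ≤ χ) {k₁ k₂ g : ℕ} (hk₁ : k₁ + 1 < K)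
    (hk₂ : k₂ + 2 < K)
    (h₁ : ¬ q₁ * (n * d : ℕ) ≤ pointCount (fun (S : Finset (Sym2 (Point n d))) x =>
      k₁ + 1 < (comp S x.1).card) S)
    (h₂ : ¬ q₂ * (n * d : ℕ) ≤ pointCount (fun (S : Finset (Sym2 (Point n d))) x =>
      x ∈ covered S ∧ k₂ + 2 < (comp S x.1).card) S)
    (h₃ : ¬ q₃ * (n * d : ℕ) ≤ pointCount (fun (S : Finset (Sym2 (Point n d))) x =>
      x ∉ covered S ∨ (comp S x.1).card < K) S)
    (h₄ : ¬ q₄ * (n * d : ℕ) ≤ pointCount (fun (S : Finset (Sym2 (Point n d))) x =>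
      (comp S x.1).card < K) S')
    (hq₁ : q₁ ≤ χ + η) (hq₂ : q₂ ≤ κ + η) (hq₃ : 1 - q₃ ≥ κ - η) (hq₄ : 1 - q₄ ≥ χ - 2 * η)
    (h₅ : ¬ Saturated K ⌈η * n⌉₊ g S') (h₆ : ¬ Separated K g S' (S \ S'))
    {C : Set (Fin n)} (hC : IsLargestComponent (project S) C) :
    |(C.ncard : ℝ) - χ * n| ≤ 3 * η * n ∧
      |2 * ((edgesWithin (project S) C).ncard : ℝ) - κ * (n * d : ℕ)| ≤ 5 * η * (n * d : ℕ) := by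
  classical
  have hd' : (0 : ℝ) < d := by exact_mod_cast hd
  have hN : (0 : ℝ) < (n * d : ℕ) := by exact_mod_cast Nat.mul_pos hn hd
  rw [not_le] at h₁ h₂ h₃ h₄
  refine largest_component_bounds hM hSM hS (K := K) hη hχ hn ?_ ?_ ?_ ?_ ?_ hC
  · have h1 := (card_le_pointCount (A := points d (bigVertices K S)) (S := S)
      (E := fun S x => k₁ + 1 < (comp S x.1).card)
      fun x hx => hk₁.trans_le (mem_bigVertices.1 (mem_points.1 hx)))
    rw [card_points] at h1
    have h2 : (d : ℝ) * (bigVertices K S).card ≤ (χ + η) * (n * d : ℕ) :=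
      le_trans (by exact_mod_cast h1) (h₁.le.trans (mul_le_mul_of_nonneg_right hq₁ hN.le))
    push_cast at h2
    refine le_of_mul_le_mul_left ?_ hd'
    linarith
  · have h1 := (le_card_add_pointCount (A := points d (bigVertices K S')) (S := S')
      (E := fun S x => (comp S x.1).card < K)
      fun x hx => not_le.1 fun h => hx (mem_points.2 (mem_bigVertices.2 h)))
    rw [card_points] at h1
    have h4 : ((n * d : ℕ) : ℝ) ≤ d * (bigVertices K S').card + pointCount
        (fun (S : Finset (Sym2 (Point n d))) x => (comp S x.1).card < K) S' := by
      exact_mod_cast h1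
    have h5 := mul_le_mul_of_nonneg_right hq₄ hN.le
    have h6 : (χ - 2 * η) * (n * d : ℕ) ≤ d * (bigVertices K S').card := by linarith
    push_cast at h6
    refine le_of_mul_le_mul_left ?_ hd'
    linarith
  · have h1 := (card_le_pointCount (A := bigPoints K S) (S := S)
      (E := fun S x => x ∈ covered S ∧ k₂ + 2 < (comp S x.1).card)
      fun x hx => ⟨(mem_inter.1 hx).1,
        hk₂.trans_le (mem_bigVertices.1 (mem_points.1 (mem_inter.1 hx).2))⟩)
    exact le_trans (by exact_mod_cast h1) (h₂.le.trans (mul_le_mul_of_nonneg_right hq₂ hN.le))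
  · have h1 := (le_card_add_pointCount (A := bigPoints K S) (S := S)
      (E := fun S x => x ∉ covered S ∨ (comp S x.1).card < K)
      fun x hx => by
        by_contra h
        rw [not_or, not_not, not_lt] at h
        exact hx (mem_inter.2 ⟨h.1, mem_points.2 (mem_bigVertices.2 h.2)⟩))
    have h4 : ((n * d : ℕ) : ℝ) ≤ (bigPoints K S).card + pointCount
        (fun (S : Finset (Sym2 (Point n d))) x => x ∉ covered S ∨ (comp S x.1).card < K) S := by
      exact_mod_cast h1
    have h5 := mul_le_mul_of_nonneg_right hq₃ hN.le
    linarith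
  · intro U W hU hW hUW hJ
    by_contra hlt
    rw [not_or, not_lt, not_lt] at hlt
    -- As `S'` is not saturated, every large part has at least `g` points left for sprinkling.
    have hact : ∀ V, BigClosed K S' V → η * n ≤ V.card → g ≤ (active S' V).card := by
      intro V hV hVn
      by_contra hg
      exact h₅ ⟨V, hV, Nat.ceil_le.2 hVn, (not_le.1 hg).le⟩
    refine h₆ ⟨U, W, hU, hW, hUW, hact U hU hlt.1, hact W hW hlt.2, ?_⟩
    refine eq_empty_of_forall_notMem fun e he => ?_
    obtain ⟨he, x, hx, y, hy, rfl⟩ := mem_filter.1 he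
    exact hJ _ (mem_active.1 hx).1 _ (mem_active.1 hy).1 ⟨x, y, (mem_sdiff.1 he).1, rfl, rfl⟩

lemma bounds_of_scaled_bounds {n d : ℕ} {η δ χ κ c e : ℝ} (hd : (3 : ℝ) ≤ d) (hη : 0 ≤ η)
    (h : 5 * η * d ≤ δ) (h₁ : |c - χ * n| ≤ 3 * η * n)
    (h₂ : |2 * e - κ * (n * d : ℕ)| ≤ 5 * η * (n * d : ℕ)) :
    |c - χ * n| ≤ δ * n ∧ |e - 1 / 2 * d * κ * n| ≤ δ * n := by
  have hn : (0 : ℝ) ≤ n := Nat.cast_nonneg n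
  have h₃ := mul_le_mul_of_nonneg_right h hn
  have h₄ : 3 * η ≤ δ := by nlinarith
  have h₅ : 0 ≤ δ * n := mul_nonneg (by linarith) hn
  refine ⟨h₁.trans (mul_le_mul_of_nonneg_right h₄ hn), ?_⟩
  push_cast at h₂
  rw [abs_le] at h₂ ⊢
  constructor <;> linarith [h₂.1, h₂.2]

open Classical in
/-- The giant component in the binomial-edge model. -/
theorem expSmall_not_giantEvent {d : ℕ} (hd : 3 ≤ d) {p : unitInterval}
    (hp : 1 / ((d : ℝ) - 1) < (p : ℝ)) (hp0 : 0 < (p : ℝ)) (hp1 : (p : ℝ) < 1) {δ : ℝ}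
    (hδ : 0 < δ) :
    ExpSmall d fun n => percSum (X := Point n d) p ∅ ∅ fun S =>
      if GiantEvent d p δ (project S) then 0 else 1 := by
  have hd' : (0 : ℝ) < d := by exact_mod_cast (by omega)
  have hd0 : 0 < d := by omega
  set φ := extinctionProb d p with hφ
  have hφ0 : 0 ≤ φ := extinctionProb_nonneg d p
  have hφ1 : φ < 1 := extinctionProb_lt_one hd hp hp0 hp1
  have hfix : offspringGen d p φ = φ := offspringGen_extinctionProb d p
  set θ := (p : ℝ) * φ + 1 - p with hθ
  have hθφ : θ ^ (d - 1) = φ := hfix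
  have hθ0 : 0 ≤ θ := by rw [hθ]; nlinarith [mul_nonneg hp0.le hφ0]
  have hθ1 : θ < 1 := by rw [hθ]; nlinarith [mul_lt_mul_of_pos_left hφ1 hp0]
  have hθfix : 1 - p + p * θ ^ (d - 1) = θ := by rw [hθφ, hθ]; ring
  have hlim := tendsto_walkProb hp0.le hp1.le hφ0 hfix (tendsto_iterate_extinctionProb d p)
  rw [← hθ] at hlim
  set χ := chi d p with hχ
  have hχθ : χ = 1 - θ ^ d := rfl
  have hχ0 : 0 < χ := by
    rw [hχθ, sub_pos]; exact pow_lt_one₀ hθ0 hθ1 (by omega)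
  set κ := (p : ℝ) * (1 - φ ^ 2) with hκ
  have hθκ : θ ^ (d - 1 + (d - 1)) = φ ^ 2 := by rw [pow_add, hθφ]; ring
  -- The first bound makes the giant unique; the second turns the error `5 * η * (n * d)` in the
  -- matched points into at most `δ * n`.
  set η := min (χ / 8) (δ / (5 * d)) with hη
  have hη0 : 0 < η := lt_min (by positivity) (by positivity)
  have hηχ : 8 * η ≤ χ := by
    have : η ≤ χ / 8 := min_le_left _ _
    linarith
  have hηδ : 5 * η * d ≤ δ := by
    have : η ≤ δ / (5 * d) := min_le_right _ _
    rw [le_div_iff₀ (by positivity)] at this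
    linarith
  obtain ⟨y, p', hy0, hyd, hp'0, hpp, hsup⟩ := exists_supersolution hp0 hd hθ0 hθ1 hθfix hη0
  have hp'1 : p' < 1 := hpp.trans hp1
  -- Finitely many steps bring the walk within `η / 2` of its limit; the other `η / 2` is left for
  -- the tail bound. `k₁` and `k₂` do not depend on `K`.
  obtain ⟨k₁, hk₁⟩ := ((hlim d).eventually (lt_mem_nhds
    (show θ ^ d - η / 2 < θ ^ d by linarith))).exists
  obtain ⟨k₂, hk₂⟩ := ((hlim (d - 1 + (d - 1))).eventually (lt_mem_nhds
    (show θ ^ (d - 1 + (d - 1)) - η / 2 < θ ^ (d - 1 + (d - 1)) by linarith))).exists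
  rw [hθκ] at hk₂
  obtain ⟨γ, hγ0, hγ1, K₁, hK₁⟩ := expSmall_saturated hd0 hp'0 hp'1 hη0
  obtain ⟨K₂, hK₂⟩ := expSmall_separated hd0 hp'0.le hpp hp1.le hγ0 hγ1
  -- Besides beating the counting factors, `K` exceeds the component sizes in the upper statistics.
  -- The lower bounds hold for any `K`, since `walkProb_le_pow` is uniform in the number of steps.
  set K := max (max K₁ K₂) (max (k₁ + 2) (k₂ + 3)) with hK
  have hKk₁ : k₁ + 1 < K := by omega
  have hKk₂ : k₂ + 2 < K := by omega
  have t₁ := exists_tail_bound hd0 hp0.le hp1.le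
    (fun n (S : Finset (Sym2 (Point n d))) x => k₁ + 1 < (comp S x.1).card)
    (sub_nonneg.2 (walkProb_le_one hp0.le hp1.le d k₁ d))
    (fun n s η hη hs => localBound_large hp0.le hp1.le k₁ hη hs) (half_pos hη0)
  have t₂ := exists_tail_bound hd0 hp0.le hp1.le
    (fun n (S : Finset (Sym2 (Point n d))) x => x ∈ covered S ∧ k₂ + 2 < (comp S x.1).card)
    (mul_nonneg hp0.le (sub_nonneg.2 (walkProb_le_one hp0.le hp1.le d k₂ (d - 1 + (d - 1)))))
    (fun n s η hη hs => localBound_kept_large hp0.le hp1.le k₂ hη hs) (half_pos hη0)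
  have t₃ := exists_tail_bound hd0 hp0.le hp1.le
    (fun n (S : Finset (Sym2 (Point n d))) x => x ∉ covered S ∨ (comp S x.1).card < K)
    (add_nonneg (sub_nonneg.2 hp1.le) (mul_nonneg hp0.le
      (walkProb_nonneg hp0.le hp1.le d (d * K) (d - 1 + (d - 1)))))
    (fun n s η hη hs => localBound_closed_or_small hp0.le hp1.le hd0 K hη hs) hη0
  have t₄ := exists_tail_bound hd0 hp'0.le hp'1.le
    (fun n (S : Finset (Sym2 (Point n d))) x => (comp S x.1).card < K)
    (walkProb_nonneg hp'0.le hp'1.le d (d * K) d)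
    (fun n s η hη hs => localBound_small hp'0.le hp'1.le hd0 K hη hs) hη0
  set q₁ := 1 - walkProb p d k₁ d + η / 2 with hq₁
  set q₂ := (p : ℝ) * (1 - walkProb p d k₂ (d - 1 + (d - 1))) + η / 2 with hq₂
  set q₃ := 1 - (p : ℝ) + p * walkProb p d (d * K) (d - 1 + (d - 1)) + η with hq₃
  set q₄ := walkProb p' d (d * K) d + η with hq₄
  have b₁ : q₁ ≤ χ + η := by rw [hq₁, hχθ]; linarith
  have b₂ : q₂ ≤ κ + η := by
    rw [hq₂, hκ]
    nlinarith
  have b₃ : 1 - q₃ ≥ κ - η := by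
    have := walkProb_le_pow hp0.le hp1.le hθ0 hθfix.le (d * K) (d - 1 + (d - 1))
    rw [hθκ] at this
    have := mul_le_mul_of_nonneg_left this hp0.le
    rw [hq₃, hκ]
    linarith
  have b₄ : 1 - q₄ ≥ χ - 2 * η := by
    have := walkProb_le_pow hp'0.le hp'1.le hy0 hsup (d * K) d
    rw [hq₄, hχθ]
    linarith
  refine ((((ExpSmall.add t₁ t₂).add t₃).add (ExpSmall.add t₄ (hK₁ K (by omega)))).add
    (hK₂ K (by omega))).mono (n₁ := 1) fun n hn => ?_
  refine percSum_indicator_le hp'0.le hpp.le hp1.le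
    fun M hM S hSM S' hS h₁ h₂ h₃ h₄ h₅ h₆ C hC => ?_
  obtain ⟨r₁, r₂⟩ := giant_of_statistics hd0 hn (mem_extensions.1 hM).1 hSM hS hη0 hηχ hKk₁ hKk₂
    h₁ h₂ h₃ h₄ b₁ b₂ b₃ b₄ h₅ h₆ hC
  have hψ : psi d p = 1 / 2 * d * κ := by rw [psi, hκ]; ring
  rw [hψ]
  exact bounds_of_scaled_bounds (by exact_mod_cast hd) hη0.le hηδ r₁ r₂

end Combination

/-! ### Transfer to the exact-edge model -/

section Transfer

lemma exists_isPerfect {X : Type*} [Fintype X] [DecidableEq X] (h : Even (Fintype.card X)) :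
    ∃ M : Finset (Sym2 X), IsPerfect M := by
  obtain ⟨k, hk⟩ := h
  have e : Fin k × Bool ≃ X := Fintype.equivOfCardEq (by simp [hk, mul_two])
  refine ⟨univ.image fun i => s(e (i, false), e (i, true)), fun f hf => ?_, fun x => ?_⟩
  · obtain ⟨i, -, rfl⟩ := mem_image.1 hf
    simp
  · obtain ⟨⟨i, b⟩, rfl⟩ := e.surjective x
    refine ⟨s(e (i, false), e (i, true)), ⟨mem_image_of_mem _ (mem_univ i), ?_⟩, ?_⟩
    · cases b
      · exact Sym2.mem_mk_left _ _
      · exact Sym2.mem_mk_right _ _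
    · rintro f ⟨hf, hx⟩
      obtain ⟨j, -, rfl⟩ := mem_image.1 hf
      have : i = j := by
        rcases Sym2.mem_iff.1 hx with h | h <;> exact (Prod.mk.inj (e.injective h)).1
      rw [this]

/-- The probability that a binomial variable takes the value `k`. -/
noncomputable def binomialWeight (p : ℝ) (l k : ℕ) : ℝ := p ^ k * (1 - p) ^ (l - k) * l.choose k

lemma binomialWeight_nonneg {p : ℝ} (hp : 0 ≤ p) (hp1 : p ≤ 1) (l k : ℕ) :
    0 ≤ binomialWeight p l k := by
  have : 0 ≤ 1 - p := by linarith
  unfold binomialWeight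
  positivity

lemma binomialWeight_succ (p : ℝ) {l k : ℕ} (hk : k < l) :
    binomialWeight p l (k + 1) * ((k + 1) * (1 - p)) = binomialWeight p l k * ((l - k) * p) := by
  have h1 : (l.choose (k + 1) : ℝ) * (k + 1) = l.choose k * (l - k) := by
    have := Nat.choose_succ_right_eq l k
    have h2 : ((l - k : ℕ) : ℝ) = l - k := Nat.cast_sub hk.le
    rw [← h2]
    exact_mod_cast this
  have h2 : l - k = l - (k + 1) + 1 := by omega
  unfold binomialWeight
  rw [h2, pow_succ, pow_succ]
  calc _ = p ^ k * p * (1 - p) ^ (l - (k + 1)) * (1 - p) * (l.choose (k + 1) * (k + 1)) := by ring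
    _ = _ := by rw [h1]; ring

/-- Near its mean, a binomial variable takes every value with at least polynomially small
probability. -/
lemma one_le_binomialWeight {p : ℝ} (hp : 0 < p) (hp1 : p < 1) {l m : ℕ} (h : |(m : ℝ) - p * l| < 1)
    (hl : 1 ≤ l * p) (hl' : 1 ≤ l * (1 - p)) :
    1 ≤ (l + 1) * (2 + 1 / (1 - p)) * binomialWeight p l m := by
  have hq : 0 < 1 - p := by linarith
  obtain ⟨hm1, hm2⟩ := abs_lt.1 h
  have hml : m < l + 1 := by
    have : (m : ℝ) < l + 1 := by linarith
    exact_mod_cast this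
  have hnn := binomialWeight_nonneg hp.le hp1.le l
  -- From `m + 1` on, past the mean, the weights decrease.
  have hup : ∀ k, m + 1 ≤ k → k ≤ l → binomialWeight p l k ≤ binomialWeight p l (m + 1) := by
    intro k hk
    induction k, hk using Nat.le_induction with
    | base => exact fun _ => le_rfl
    | succ k hk ih =>
      intro hkl
      refine le_trans ?_ (ih (by omega))
      have hk' : (m : ℝ) + 1 ≤ k := by exact_mod_cast hk
      have h1 := binomialWeight_succ p (l := l) (k := k) (by omega)
      refine le_of_mul_le_mul_right (h1.le.trans ?_)
        (show (0 : ℝ) < (k + 1) * (1 - p) by positivity)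
      exact mul_le_mul_of_nonneg_left (by nlinarith) (hnn k)
  have hup' : m + 1 ≤ l → binomialWeight p l (m + 1) ≤ 1 / (1 - p) * binomialWeight p l m := by
    intro hlt
    have h1 := binomialWeight_succ p (l := l) (k := m) (by omega)
    have h2 : binomialWeight p l m * ((l - m) * p) ≤ binomialWeight p l m * (m + 1) := by
      refine mul_le_mul_of_nonneg_left ?_ (hnn m)
      have : (0 : ℝ) ≤ m * p := by positivity
      nlinarith
    rw [one_div, inv_mul_eq_div, le_div_iff₀ hq]
    refine le_of_mul_le_mul_right ?_ (show (0 : ℝ) < m + 1 by positivity)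
    linarith
  -- The weights increase up to `m - 1`. The last step to `m` may decrease, but by at most a factor
  -- 2, because `m ≤ l * p + 1 ≤ 2 * l * p`.
  have hdown : ∀ j k, k + j + 1 = m → binomialWeight p l k ≤ 2 * binomialWeight p l m := by
    intro j
    induction j with
    | zero =>
      intro k hk
      have hkm : (k : ℝ) + 1 = m := by exact_mod_cast hk
      have h1 := binomialWeight_succ p (l := l) (k := k) (by omega)
      have hk1 : k + 1 = m := hk
      rw [hk1, hkm] at h1
      refine le_of_mul_le_mul_right ?_ (show (0 : ℝ) < l * (1 - p) * p by nlinarith)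
      calc binomialWeight p l k * (l * (1 - p) * p) ≤ binomialWeight p l k * ((l - k) * p) := by
            refine mul_le_mul_of_nonneg_left ?_ (hnn k)
            exact mul_le_mul_of_nonneg_right (by linarith) hp.le
        _ = binomialWeight p l m * (m * (1 - p)) := h1.symm
        _ ≤ binomialWeight p l m * (2 * (l * p) * (1 - p)) := by
            refine mul_le_mul_of_nonneg_left ?_ (hnn m)
            exact mul_le_mul_of_nonneg_right (by linarith) hq.le
        _ = _ := by ring
    | succ j ih =>
      intro k hk
      refine le_trans ?_ (ih (k + 1) (by omega))
      have h1 := binomialWeight_succ p (l := l) (k := k) (by omega)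
      have hkm : (k : ℝ) + 2 ≤ m := by exact_mod_cast (by omega : k + 2 ≤ m)
      refine le_of_mul_le_mul_right ?_ (show (0 : ℝ) < (k + 1) * (1 - p) by positivity)
      rw [h1]
      exact mul_le_mul_of_nonneg_left (by nlinarith) (hnn k)
  have hall : ∀ k ∈ range (l + 1), binomialWeight p l k ≤
      (2 + 1 / (1 - p)) * binomialWeight p l m := by
    intro k hk
    have hkl : k ≤ l := Nat.lt_succ_iff.1 (mem_range.1 hk)
    have hinv : 0 ≤ 1 / (1 - p) := by positivity
    have h1 := mul_nonneg hinv (hnn m)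
    have h2 := hnn m
    rcases lt_trichotomy k m with hkm | rfl | hkm
    · have := hdown (m - k - 1) k (by omega)
      linarith
    · linarith
    · have := hup k hkm hkl
      have := hup' (by omega)
      linarith
  have hsum : ∑ k ∈ range (l + 1), binomialWeight p l k = 1 := by
    have := add_pow p (1 - p) l
    rw [add_sub_cancel, one_pow] at this
    exact this.symm
  have h3 := sum_le_sum hall
  rw [hsum, sum_const, card_range, nsmul_eq_mul] at h3
  push_cast at h3
  linarith

variable {n d : ℕ}

lemma pairings_eq (n d : ℕ) : pairings n d = extensions (∅ : Finset (Sym2 (Point n d))) := by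
  ext M
  simp [pairings, mem_extensions, IsPerfect]

lemma extCount_empty_pos (h : Even (d * n)) :
    0 < extCount (∅ : Finset (Sym2 (Point n d))) := by
  obtain ⟨M, hM⟩ := exists_isPerfect (X := Point n d) (by simpa [mul_comm] using h)
  have : 0 < (extensions (∅ : Finset (Sym2 (Point n d)))).card :=
    card_pos.2 ⟨M, mem_extensions.2 ⟨hM, empty_subset _⟩⟩
  rw [extCount]
  exact Nat.cast_pos.2 this

open Classical in
lemma binomialEdgeProb_eq (h : Even (d * n)) (p : ℝ)
    (A : Graph (Fin n) (Sym2 (Point n d)) → Prop) :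
    binomialEdgeProb n d p A = 1 - percSum p ∅ ∅ (fun S => if A (project S) then 0 else 1) /
      extCount (∅ : Finset (Sym2 (Point n d))) := by
  have hpos := extCount_empty_pos (n := n) (d := d) h
  have h1 : ∑ M ∈ pairings n d, ∑ S ∈ M.powerset with A (project S),
      p ^ S.card * (1 - p) ^ (M.card - S.card) =
      percSum p ∅ ∅ (fun S => if A (project S) then 1 else 0) := by
    rw [percSum_empty, pairings_eq]
    refine sum_congr rfl fun M _ => ?_
    rw [sum_filter]
    refine sum_congr rfl fun S hS => ?_
    rw [card_sdiff_of_subset (mem_powerset.1 hS)]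
    split_ifs <;> simp
  have h2 := percSum_add p ∅ ∅ (fun S : Finset (Sym2 (Point n d)) =>
    if A (project S) then (1 : ℝ) else 0) (fun S => if A (project S) then 0 else 1)
  have h3 : (fun S : Finset (Sym2 (Point n d)) => (if A (project S) then (1 : ℝ) else 0) +
      if A (project S) then 0 else 1) = fun _ => 1 := by
    funext S; split_ifs <;> simp
  rw [h3, percSum_const, one_mul] at h2
  have h4 : ((pairings n d).card : ℝ) = extCount (∅ : Finset (Sym2 (Point n d))) := by
    rw [pairings_eq, extCount]
  unfold binomialEdgeProb
  rw [h1, h4, eq_sub_iff_add_eq, ← add_div, ← h2, div_self hpos.ne']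

open Classical in
-- All sets of `m` edges have the same weight in the binomial-edge model, so the failure probability
-- for `m` edges times the probability of keeping exactly `m` is at most the total failure
-- probability.
lemma exactEdgeProb_ge (h : Even (d * n)) {p : ℝ} (hp : 0 < p) (hp1 : p < 1) {l m : ℕ}
    (hl : 2 * l = n * d) (hw : 0 < binomialWeight p l m)
    (A : Graph (Fin n) (Sym2 (Point n d)) → Prop) :
    1 - percSum p ∅ ∅ (fun S => if A (project S) then 0 else 1) /
      extCount (∅ : Finset (Sym2 (Point n d))) / binomialWeight p l m ≤ exactEdgeProb n d m A := by
  have hpos := extCount_empty_pos (n := n) (d := d) h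
  have hq : 0 < 1 - p := by linarith
  set t := p ^ m * (1 - p) ^ (l - m) with ht
  have ht0 : 0 < t := by positivity
  have hwt : binomialWeight p l m = t * l.choose m := rfl
  have hC : (0 : ℝ) < l.choose m := by
    rw [hwt] at hw
    exact pos_of_mul_pos_right hw ht0.le
  have hM : ∀ M ∈ extensions (∅ : Finset (Sym2 (Point n d))),
      1 - (∑ S ∈ M.powerset, p ^ S.card * (1 - p) ^ (M \ S).card *
        if A (project S) then 0 else 1) / binomialWeight p l m ≤
      (((M.powersetCard m).filter fun S => A (project S)).card : ℝ) / (M.powersetCard m).card := by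
    intro M hM
    have hcard : M.card = l := by
      have := (mem_extensions.1 hM).1.two_mul_card
      rw [Fintype.card_prod, Fintype.card_fin, Fintype.card_fin] at this
      omega
    have h1 : t * ((M.powersetCard m).filter fun S => ¬ A (project S)).card ≤
        ∑ S ∈ M.powerset, p ^ S.card * (1 - p) ^ (M \ S).card *
          if A (project S) then 0 else 1 := by
      rw [mul_comm, ← nsmul_eq_mul, ← sum_const]
      have h2 : (M.powersetCard m).filter (fun S => ¬ A (project S)) ⊆ M.powerset := fun S hS =>
        mem_powerset.2 (mem_powersetCard.1 (mem_filter.1 hS).1).1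
      refine le_trans (le_of_eq (sum_congr rfl fun S hS => ?_))
        (sum_le_sum_of_subset_of_nonneg h2 fun S _ _ => ?_)
      · obtain ⟨hS1, hS2⟩ := mem_filter.1 hS
        obtain ⟨hS3, hS4⟩ := mem_powersetCard.1 hS1
        rw [if_neg hS2, card_sdiff_of_subset hS3, hS4, hcard, mul_one]
      · have : (0 : ℝ) ≤ if A (project S) then 0 else 1 := by split_ifs <;> norm_num
        positivity
    have h2 := card_filter_add_card_filter_not (s := M.powersetCard m) fun S => A (project S)
    rw [card_powersetCard, hcard] at h2 ⊢
    have h3 : (((M.powersetCard m).filter fun S => A (project S)).card : ℝ) =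
        l.choose m - ((M.powersetCard m).filter fun S => ¬ A (project S)).card := by
      rw [eq_sub_iff_add_eq]; exact_mod_cast h2
    rw [h3, sub_div, div_self hC.ne', hwt]
    refine sub_le_sub_left ?_ _
    rw [div_le_div_iff₀ hC (by positivity)]
    nlinarith
  have h4 := sum_le_sum hM
  rw [sum_sub_distrib, ← sum_div, ← percSum_empty, sum_const, nsmul_one] at h4
  change extCount ∅ - _ ≤ _ at h4
  unfold exactEdgeProb
  have h5 : ((pairings n d).card : ℝ) = extCount (∅ : Finset (Sym2 (Point n d))) := by
    rw [pairings_eq, extCount]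
  rw [h5, pairings_eq, le_div_iff₀ hpos]
  refine le_trans (le_of_eq ?_) h4
  field_simp

lemma exists_poly_mul_exp_le {c D : ℝ} (hc : 0 < c) :
    ∃ n₀ : ℕ, ∀ n : ℕ, n₀ ≤ n → D * n * Real.exp (-c * n) ≤ Real.exp (-(c / 2) * n) := by
  refine ⟨⌈16 * D / c ^ 2⌉₊, fun n hn => ?_⟩
  have hn1 : 16 * D / c ^ 2 ≤ n := (Nat.le_ceil _).trans (by exact_mod_cast hn)
  rw [div_le_iff₀ (by positivity)] at hn1
  have hn0 : (0 : ℝ) ≤ n := Nat.cast_nonneg n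
  have h1 : c * n / 4 ≤ Real.exp (c * n / 4) := by
    have := Real.add_one_le_exp (c * n / 4)
    linarith
  have h2 : (c * n / 4) ^ 2 ≤ Real.exp (c / 2 * n) := by
    have h3 := pow_le_pow_left₀ (by positivity) h1 2
    rw [← Real.exp_nat_mul] at h3
    refine h3.trans_eq ?_
    congr 1; push_cast; ring
  have h4 : D * n ≤ Real.exp (c / 2 * n) := by
    refine le_trans ?_ h2
    nlinarith [mul_le_mul_of_nonneg_right hn1 hn0]
  calc _ ≤ Real.exp (c / 2 * n) * Real.exp (-c * n) :=
        mul_le_mul_of_nonneg_right h4 (Real.exp_pos _).le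
    _ = _ := by rw [← Real.exp_add]; congr 1; ring

end Transfer

/-- The giant component in both models. -/
theorem giant_component {d : ℕ} (hd : 3 ≤ d) {p : unitInterval}
    (hp : 1 / ((d : ℝ) - 1) < (p : ℝ)) (hp0 : 0 < (p : ℝ)) (hp1 : (p : ℝ) < 1) {δ : ℝ}
    (hδ : 0 < δ) : ∃ c : ℝ, 0 < c ∧ ∃ n₀ : ℕ, ∀ n : ℕ, n₀ ≤ n → Even (d * n) →
      1 - Real.exp (-c * n) ≤ binomialEdgeProb n d p (fun G => GiantEvent d p δ G) ∧
      ∀ m : ℕ, |(m : ℝ) - p * d * n / 2| < 1 →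
        1 - Real.exp (-c * n) ≤ exactEdgeProb n d m (fun G => GiantEvent d p δ G) := by
  obtain ⟨c, hc, n₁, hn₁⟩ := expSmall_not_giantEvent hd hp hp0 hp1 hδ
  have hq : 0 < 1 - (p : ℝ) := by linarith
  have hd' : (0 : ℝ) < d := by exact_mod_cast (by omega)
  set B : ℝ := 2 + 1 / (1 - (p : ℝ)) with hB
  have hB0 : 0 < B := by positivity
  -- Conditioning on the number of kept edges costs at most the factor `d * B * n`, which is
  -- absorbed by halving the rate.
  obtain ⟨n₂, hn₂⟩ := exists_poly_mul_exp_le (c := c) (D := d * B) hc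
  refine ⟨c / 2, by positivity, max (max n₁ n₂)
    (max 1 (max ⌈2 / (d * (p : ℝ))⌉₊ ⌈2 / (d * (1 - (p : ℝ)))⌉₊)), fun n hn hev => ?_⟩
  have hnn₁ : n₁ ≤ n := le_of_max_le_left (le_of_max_le_left hn)
  have hnn₂ : n₂ ≤ n := le_of_max_le_right (le_of_max_le_left hn)
  have hn' := le_of_max_le_right hn
  have hn1 : 1 ≤ n := le_of_max_le_left hn'
  have ha : 2 / (d * (p : ℝ)) ≤ n := (Nat.le_ceil _).trans
    (by exact_mod_cast le_of_max_le_left (le_of_max_le_right hn'))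
  have hb : 2 / (d * (1 - (p : ℝ))) ≤ n := (Nat.le_ceil _).trans
    (by exact_mod_cast le_of_max_le_right (le_of_max_le_right hn'))
  rw [div_le_iff₀ (by positivity)] at ha hb
  have hn0 : (1 : ℝ) ≤ n := by exact_mod_cast hn1
  have hpos := extCount_empty_pos (n := n) (d := d) hev
  have hbad := hn₁ n hnn₁
  beta_reduce at hbad
  rw [← div_le_iff₀ hpos] at hbad
  have hexp : Real.exp (-c * n) ≤ Real.exp (-(c / 2) * n) :=
    Real.exp_le_exp.2 (by nlinarith)
  refine ⟨?_, fun m hm => ?_⟩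
  · rw [binomialEdgeProb_eq hev]
    linarith
  · obtain ⟨l, hl⟩ := hev
    have hl2 : 2 * l = n * d := by rw [mul_comm n d]; omega
    have hlr : 2 * (l : ℝ) = n * d := by exact_mod_cast hl2
    have hm' : |(m : ℝ) - p * l| < 1 := by
      have : (p : ℝ) * d * n / 2 = p * l := by
        have : (l : ℝ) = n * d / 2 := by linarith
        rw [this]; ring
      rwa [this] at hm
    have hw := one_le_binomialWeight hp0 hp1 hm' (by nlinarith) (by nlinarith)
    rw [← hB] at hw
    have hw0 : 0 < binomialWeight p l m := by
      refine pos_of_mul_pos_right (lt_of_lt_of_le one_pos hw) ?_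
      positivity
    refine le_trans ?_ (exactEdgeProb_ge ⟨l, hl⟩ hp0 hp1 hl2 hw0 _)
    refine sub_le_sub_left ?_ _
    rw [div_le_iff₀ hw0]
    have h1 : ((l : ℝ) + 1) * B ≤ d * B * n := by
      have hd3 : (3 : ℝ) ≤ d := by exact_mod_cast hd
      have : (l : ℝ) + 1 ≤ d * n := by nlinarith
      calc _ ≤ (d * n : ℝ) * B := mul_le_mul_of_nonneg_right this hB0.le
        _ = _ := by ring
    have h2 := hn₂ n hnn₂
    calc _ ≤ Real.exp (-c * n) := hbad
      _ ≤ Real.exp (-c * n) * ((l + 1) * B * binomialWeight p l m) :=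
          le_mul_of_one_le_right (Real.exp_pos _).le hw
      _ ≤ Real.exp (-c * n) * (d * B * n * binomialWeight p l m) := by gcongr
      _ = d * B * n * Real.exp (-c * n) * binomialWeight p l m := by ring
      _ ≤ _ := by gcongr

end GiantPerc

theorem mainTheorem8 (d : ℕ) (hd : 3 ≤ d) (p : unitInterval)
    (hp : 1 / ((d : ℝ) - 1) < (p : ℝ)) (hp1 : (p : ℝ) < 1) :
    (0 < GiantPerc.extinctionProb d p ∧ GiantPerc.extinctionProb d p < 1 ∧
      ∀ y : ℝ, 0 < y → y < 1 →
        (y = ((p : ℝ) * y + 1 - p) ^ (d - 1) ↔ y = GiantPerc.extinctionProb d p)) ∧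
    ∀ δ : ℝ, 0 < δ → ∃ c : ℝ, 0 < c ∧ ∃ n₀ : ℕ, ∀ n : ℕ, n₀ ≤ n → Even (d * n) →
      1 - Real.exp (-c * n) ≤
        GiantPerc.binomialEdgeProb n d p (fun G => GiantPerc.GiantEvent d p δ G) ∧
      ∀ m : ℕ, |(m : ℝ) - p * d * n / 2| < 1 →
        1 - Real.exp (-c * n) ≤
          GiantPerc.exactEdgeProb n d m (fun G => GiantPerc.GiantEvent d p δ G) := by
  have hp0 : 0 < (p : ℝ) := by
    have hd3 : (3 : ℝ) ≤ d := by exact_mod_cast hd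
    exact lt_trans (one_div_pos.2 (by linarith)) hp
  refine ⟨⟨GiantPerc.extinctionProb_pos d p hp1, GiantPerc.extinctionProb_lt_one hd hp hp0 hp1,
    fun y hy0 hy1 => ⟨fun h => GiantPerc.eq_extinctionProb hd hp hp0 hp1 hy0 hy1 h.symm, ?_⟩⟩,
    fun δ hδ => GiantPerc.giant_component hd hp hp0 hp1 hδ⟩
  rintro rfl
  exact (GiantPerc.offspringGen_extinctionProb d p).symm
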